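/- Let $(E,\mathcal E)$ be a measurable space with countably generated $\sigma$-field, and let $\{X_n,n\ge 0\}$ be a phi-irreducible, aperiodic Markov chain on $E$, defined on a probability space with probability $\mathbb P$, with initial distribution $\mu_0$, transition kernel $P$ and invariant probability distribution $\pi$. For $W:E\to[1,\infty)$ let $\mathcal L_W$ be the set of measurable $h:E\to\mathbb R$ with $|h|_W:=\sup|h|/W<\infty$, and write $\|\mu\|_W:=\sup\{|\mu(g)|: g \text{ measurable}, |g|_W\le 1\}$. Assume (A1): there is a measurable $V:E\to[1,\infty)$ with $\int V\,d\mu_0<\infty$ such that * for every $s\in(0,1]$ there are $\rho\in(0,1)$ and $C\in(0,\infty)$ with $\|P^n(x,\cdot)-\pi\|_{V^s}\le C\rho^nV^s(x)$ for all $x\in E$, $n\ge 0$; * there are $b\in(0,\infty)$, $\lambda\in(0,1)$ with $PV(x)\le\lambda V(x)+b$ for all $x\in E$. Let $\beta\in(0,1/2)$, $h\in\mathcal L_{V^\beta}$, and put $\bar h:=h-\pi(h)$ (so $\bar h=h$ if $\pi(h)=0$). Then $$\sigma^2(h):=\pi(\bar h^2)+2\sum_{j\ge 1}\pi(\bar h\,P^j\bar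 h)$$ is well defined and finite: all the integrals exist and the series converges absolutely. Let $w:\mathbb R\to\mathbb R$ satisfy $w(x)=0$ for $|x|\ge 1$ and (A3): $w$ is even, $w(0)=1$, and the restriction of $w$ to $[0,1]$ is twice continuously differentiable. For positive numbers $b_n$, let $$\Gamma_n^2(h)=\sum_{k=-n}^n w(kb_n)\gamma_n(k),$$ where $\pi_n(h)=n^{-1}\sum_{k=1}^nh(X_k)$, and $\gamma_n(k)=\gamma_n(-k)=\frac1n\sum_{j=1}^{n-k}(h(X_j)-\pi_n(h))(h(X_{j+k})-\pi_n(h))$ for $0\le k<n$, $\gamma_n(k)=0$ for $|k|\ge n$. Let $\delta_\beta:=\frac23\bigl(1-\max(\tfrac12,2\beta)\bigr)$. 1. If $b_n=c\,n^{-\delta_\beta}$ ($n\ge1$) for a constant $c>0$, then $\Gamma_n^2(h)\in L^{1/(2\beta)}(\mathbb P)$ for all $n$ and $\Gamma_n^2(h)\to\sigma^2(h)$ in $L^{1/(2\beta)}(\mathbb P)$. 2. The convergence $\Gamma_n^2(h)\to\sigma^2(h)$ also holds $\mathbb P$-almost surely in each of the following two cases: (i) $\beta\in(0,1/4)$ and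 $b_n=c\,n^{-\delta}$ ($n\ge1$) with $c>0$ and $\delta\in(2\beta,1/2)$ (in particular with $\delta=\delta_\beta$ when $2\beta<\delta_\beta<1/2$); (ii) $b_n=c\,n^{-\delta_\beta}$ ($n\ge1$) with $c>0$, and in addition to A3 the restriction of $w$ to $[0,1]$ is $(r+1)$-times continuously differentiable for some integer $r\ge2$ with $r>1+2\beta\,\delta_\beta^{-1}$ (A4). -/

import Mathlib

open MeasureTheory ProbabilityTheory Filter Topology
open scoped ENNReal

noncomputable section

namespace KernelVariance

/-- `|g|_W ≤ c`, i.e. `sup |g| / W ≤ c`, written pointwise (for a positive function `W`). -/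
def WBound {E : Type*} (W g : E → ℝ) (c : ℝ) : Prop :=
  ∀ x, |g x| ≤ c * W x

/-- The class `L_W` of measurable functions with finite `W`-norm. -/
def InLW {E : Type*} [MeasurableSpace E] (W h : E → ℝ) : Prop :=
  Measurable h ∧ ∃ c : ℝ, WBound W h c

/-- The `W`-norm `‖μ - ν‖_W = sup {|μ(g) - ν(g)| : g measurable, |g|_W ≤ 1}` of the difference of
two measures, as an extended nonnegative number. -/
def wNormDist {E : Type*} [MeasurableSpace E] (W : E → ℝ) (μ ν : Measure E) : ℝ≥0∞ :=
  ⨆ (g : E → ℝ) (_ : Measurable g) (_ : WBound W g 1),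
    ENNReal.ofReal |(∫ y, g y ∂μ) - ∫ y, g y ∂ν|

/-- phi-irreducibility: some nonzero sigma-finite measure is an irreducibility measure. -/
def PhiIrreducible {E : Type*} [MeasurableSpace E] (P : Kernel E E) : Prop :=
  ∃ φ : Measure E, SigmaFinite φ ∧ φ ≠ 0 ∧ Kernel.IsIrreducible φ P

/-- Aperiodicity of a kernel with invariant probability `π`: there is no `d ≥ 2` with disjoint
measurable sets `D_0, …, D_{d-1}`, of positive `π`-measure, that the chain visits cyclically. -/
def Aperiodic {E : Type*} [MeasurableSpace E] (P : Kernel E E) (π : Measure E) : Prop :=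
  ∀ d : ℕ, 2 ≤ d → ∀ D : ZMod d → Set E,
    (∀ i, MeasurableSet (D i)) → (∀ i j, i ≠ j → Disjoint (D i) (D j)) →
    (∀ i, ∀ x ∈ D i, P x (D (i + 1)) = 1) → ∀ i, π (D i) = 0

/-- The geometric ergodicity assumption for a single kernel `P` with invariant distribution `π`,
initial distribution `μ₀` and Lyapunov function `V`. -/
structure GeometricErgodicity {E : Type*} [MeasurableSpace E] (P : Kernel E E)
    (π μ₀ : Measure E) (V : E → ℝ) : Prop where
  irreducible : PhiIrreducible P
  aperiodic : Aperiodic P π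
  invariant : Kernel.Invariant P π
  measurable_V : Measurable V
  one_le_V : ∀ x, 1 ≤ V x
  initial : ∫⁻ x, ENNReal.ofReal (V x) ∂μ₀ < ∞
  rate : ∀ s : ℝ, 0 < s → s ≤ 1 → ∃ ρ C : ℝ, 0 < ρ ∧ ρ < 1 ∧ 0 < C ∧
    ∀ (x : E) (n : ℕ),
      wNormDist (fun y => V y ^ s) ((P ^ n) x) π ≤ ENNReal.ofReal (C * ρ ^ n * V x ^ s)
  drift : ∃ b l : ℝ, 0 < b ∧ 0 < l ∧ l < 1 ∧
    ∀ x, ∫⁻ y, ENNReal.ofReal (V y) ∂(P x) ≤ ENNReal.ofReal (l * V x + b)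

/-- The natural filtration at time `n`: the sigma-algebra generated by `X_0, …, X_n`. -/
@[reducible] def naturalSigma {Ω E : Type*} [MeasurableSpace E] (X : ℕ → Ω → E) (n : ℕ) : MeasurableSpace Ω :=
  ⨆ k ∈ Set.Iic n, MeasurableSpace.comap (X k) inferInstance

/-- `X` is a Markov chain under `Pr` with transition kernel `P` and initial distribution `μ₀`. -/
structure IsMarkovChain {Ω E : Type*} [MeasurableSpace Ω] [MeasurableSpace E] (Pr : Measure Ω)
    (X : ℕ → Ω → E) (P : Kernel E E) (μ₀ : Measure E) : Prop where
  measurable : ∀ n, Measurable (X n)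
  initial : Pr.map (X 0) = μ₀
  markov : ∀ (n : ℕ) (A : Set E), MeasurableSet A →
    Pr[(X (n + 1) ⁻¹' A).indicator (fun _ => (1 : ℝ)) | naturalSigma X n]
      =ᵐ[Pr] fun ω => (P (X n ω) A).toReal

/-- The function `P^j h`. -/
def iterApply {E : Type*} [MeasurableSpace E] (P : Kernel E E) (j : ℕ) (h : E → ℝ) (x : E) : ℝ :=
  ∫ y, h y ∂((P ^ j) x)

/-- The number `π(h²) + 2 ∑_{j ≥ 1} π(h P^j h)`. -/
def sigmaSq {E : Type*} [MeasurableSpace E] (P : Kernel E E) (π : Measure E) (h : E → ℝ) : ℝ :=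
  (∫ x, h x ^ 2 ∂π) + 2 * ∑' j : ℕ, ∫ x, h x * iterApply P (j + 1) h x ∂π

/-- All the integrals in `sigmaSq P π h` exist and its series converges (absolutely). -/
structure SigmaSqFinite {E : Type*} [MeasurableSpace E] (P : Kernel E E) (π : Measure E)
    (h : E → ℝ) : Prop where
  sq : Integrable (fun x => h x ^ 2) π
  iter : ∀ (j : ℕ) (x : E), Integrable h ((P ^ (j + 1)) x)
  cross : ∀ j : ℕ, Integrable (fun x => h x * iterApply P (j + 1) h x) π
  series : Summable fun j : ℕ => ∫ x, h x * iterApply P (j + 1) h x ∂π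

/-- The function `h - π(h)`. -/
def centre {E : Type*} [MeasurableSpace E] (π : Measure E) (h : E → ℝ) (x : E) : ℝ :=
  h x - ∫ y, h y ∂π

/-- The sample mean of `h(X_1), …, h(X_n)`. -/
def sampleMean {Ω E : Type*} (h : E → ℝ) (X : ℕ → Ω → E) (n : ℕ) (ω : Ω) : ℝ :=
  (1 / (n : ℝ)) * ∑ j ∈ Finset.Icc 1 n, h (X j ω)

/-- The sample autocovariance of order `k ∈ ℤ`; it vanishes for `|k| ≥ n`. -/
def sampleAutocov {Ω E : Type*} (h : E → ℝ) (X : ℕ → Ω → E) (n : ℕ) (k : ℤ) (ω : Ω) : ℝ :=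
  if n ≤ k.natAbs then 0
  else (1 / (n : ℝ)) * ∑ j ∈ Finset.Icc 1 (n - k.natAbs),
    (h (X j ω) - sampleMean h X n ω) * (h (X (j + k.natAbs) ω) - sampleMean h X n ω)

/-- The kernel estimator `Γ²_n(h) = ∑_{k=-n}^{n} w(k b_n) γ_n(k)`. -/
def kernelEstimator {Ω E : Type*} (w : ℝ → ℝ) (b : ℕ → ℝ) (h : E → ℝ) (X : ℕ → Ω → E)
    (n : ℕ) (ω : Ω) : ℝ :=
  ∑ k ∈ Finset.Icc (-(n : ℤ)) n, w ((k : ℝ) * b n) * sampleAutocov h X n k ω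

/-- An even kernel `w` with `w(0) = 1`, vanishing off `(-1, 1)`, whose restriction to `[0, 1]` is
`m` times continuously differentiable. -/
structure SmoothKernel (w : ℝ → ℝ) (m : ℕ) : Prop where
  supp : ∀ x, 1 ≤ |x| → w x = 0
  even : ∀ x, w (-x) = w x
  zero : w 0 = 1
  smooth : ContDiffOn ℝ m w (Set.Icc 0 1)

/-- The bandwidth exponent `δ = (2/3) (1 - max(1/2, 2β))`. -/
def bandwidthExponent (β : ℝ) : ℝ := 2 / 3 * (1 - max (1 / 2) (2 * β))

end KernelVariance

end

/-! Write `z_j = h̄(X_j)`, `p = 1/(2β) > 1` and `κ = max(1/p, 1/2)`. Geometric ergodicity makes `P^r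
h̄(X_j)` decay like `ρ^r V(X_j)^β`, and the drift condition keeps `V(X_j)^β` bounded in `L^{2p}`;
`GeometricArray` isolates this structure. Up to the sample-mean correction, the estimator is `1/n`
times `∑ z_j² + 2 ∑ w(l b_n) z_{j-l} z_j`. Writing the later factor through the potentials `∑_r
w((l+r) b_n) P^r h̄(X_j)` splits the lagged products exactly into a drift `∑ z_j ∑_r w((r+1) b_n)
P^{r+1} h̄(X_j)`, a martingale and a boundary term (`sum_lag_mul_eq_quadMartingale`). Replacing the
weights in the drift by 1 costs `O(b_n)` and leaves the empirical average of `varianceDensity`,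
whose `π`-mean is `σ²(h)` and whose fluctuations are again handled by martingale approximation.

With `K ~ 1/b_n ~ n^δ` active lags the martingale differences are `O(K)` in `L^p`, so
`exists_eLpNorm_sum_le` gives `n^(κ+δ-1)` after division by `n`. The boundary term is no larger, and
the mean correction is `K/n` up to logarithms. All the errors vanish polynomially as soon as `δ > 0`
and `δ + κ < 1`. This covers `δ_β = (2/3)(1-κ)`, and also case (i), where `κ = 1/2`.

To obtain `L^p` and almost sure convergence together, the errors are bounded for the maximum over a
dyadic block `2^k ≤ n < 2^(k+1)`. For fixed weights, chaining (`HasMaximalBound.of_increments`)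
costs one logarithm. Inside a block the weights move with `n`; the martingale is linear in them, and
their total variation over the block is bounded because `w` is Lipschitz on `[0,∞)` and `K b_n` is
bounded. The resulting block bounds `(k+2)² 2^(-ηk)` are summable (`tendsto_zero_of_block_bounds`).
-/

noncomputable section

namespace KernelVariance

/-! ### Weighted norms, truncation and integrability -/

section KernelIntegrals

variable {E : Type*} [MeasurableSpace E]

theorem isMarkovKernel_pow (P : Kernel E E) [IsMarkovKernel P] (n : ℕ) :
    IsMarkovKernel (P ^ n) := by
  induction n with
  | zero => exact inferInstanceAs (IsMarkovKernel Kernel.id)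
  | succ n ih => rw [Kernel.pow_add P n 1, pow_one]; infer_instance

/-- Homogeneity: `g / c` is an admissible test function. The case `c = 0` is separate, and there `g`
vanishes. -/
theorem abs_integral_sub_le_of_wNormDist {W : E → ℝ} {μ ν : Measure E} {D : ℝ} (hD : 0 ≤ D)
    (h : wNormDist W μ ν ≤ ENNReal.ofReal D) {g : E → ℝ} {c : ℝ} (hc : 0 ≤ c)
    (hg : Measurable g) (hgW : WBound W g c) :
    |∫ y, g y ∂μ - ∫ y, g y ∂ν| ≤ c * D := by
  rcases hc.eq_or_lt with rfl | hc
  · have : g = fun _ => 0 := by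
      ext x
      simpa using hgW x
    simp [this]
  have h1 : ENNReal.ofReal |∫ y, g y / c ∂μ - ∫ y, g y / c ∂ν| ≤ ENNReal.ofReal D := by
    refine le_trans ?_ h
    refine le_iSup_of_le (fun y => g y / c) (le_iSup_of_le (hg.div_const c)
      (le_iSup_of_le ?_ le_rfl))
    intro x
    rw [abs_div, abs_of_pos hc, one_mul, div_le_iff₀ hc]
    linarith [hgW x]
  rw [ENNReal.ofReal_le_ofReal_iff hD, integral_div, integral_div, ← sub_div, abs_div,
    abs_of_pos hc, div_le_iff₀ hc] at h1
  linarith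

/-- Monotone convergence along truncations. Testing `wNormDist` on `V` itself would be inconclusive,
since the Bochner integral of a non-integrable function is 0; the bounded truncations avoid this. -/
theorem lintegral_ofReal_le_of_integral_min_le {μ : Measure E} [IsFiniteMeasure μ] {V : E → ℝ}
    (hV : Measurable V) (hV0 : ∀ x, 0 ≤ V x) {B : ℝ}
    (h : ∀ N : ℕ, ∫ x, min (V x) N ∂μ ≤ B) :
    ∫⁻ x, ENNReal.ofReal (V x) ∂μ ≤ ENNReal.ofReal B := by
  have hm : ∀ N : ℕ, Measurable fun x => min (V x) (N : ℝ) := fun N => hV.min measurable_const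
  have hlim := lintegral_tendsto_of_tendsto_of_monotone (μ := μ)
    (f := fun (N : ℕ) x => ENNReal.ofReal (min (V x) N)) (F := fun x => ENNReal.ofReal (V x))
    (fun N => (hm N).ennreal_ofReal.aemeasurable)
    (ae_of_all _ fun x a b hab => ENNReal.ofReal_le_ofReal
      (min_le_min_left _ (by exact_mod_cast hab)))
    (ae_of_all _ fun x => by
      refine tendsto_const_nhds.congr' ?_
      obtain ⟨N, hN⟩ := exists_nat_ge (V x)
      filter_upwards [eventually_ge_atTop N] with M hM
      rw [min_eq_left (hN.trans (by exact_mod_cast hM))])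
  refine le_of_tendsto' hlim fun N => ?_
  rw [← ofReal_integral_eq_lintegral_ofReal]
  · exact ENNReal.ofReal_le_ofReal (h N)
  · refine Integrable.of_bound (hm N).aestronglyMeasurable N (ae_of_all _ fun x => ?_)
    rw [Real.norm_of_nonneg (le_min (hV0 x) (Nat.cast_nonneg N))]
    exact min_le_right _ _
  · exact ae_of_all _ fun x => le_min (hV0 x) (Nat.cast_nonneg N)

theorem rpow_le_self_of_one_le {v s : ℝ} (hv : 1 ≤ v) (hs : s ≤ 1) : v ^ s ≤ v := by
  simpa using Real.rpow_le_rpow_of_exponent_le hv hs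

theorem integrable_of_wBound {μ : Measure E} [IsFiniteMeasure μ] {V : E → ℝ}
    (hV : Measurable V) (hV1 : ∀ x, 1 ≤ V x) (hfin : ∫⁻ x, ENNReal.ofReal (V x) ∂μ < ∞)
    {s : ℝ} (hs : s ≤ 1) {g : E → ℝ} (hg : Measurable g) {c : ℝ}
    (hgc : WBound (fun x => V x ^ s) g c) : Integrable g μ := by
  have hVi : Integrable V μ :=
    ⟨hV.aestronglyMeasurable, by
      rwa [hasFiniteIntegral_iff_ofReal (ae_of_all _ fun x => zero_le_one.trans (hV1 x))]⟩
  refine (hVi.const_mul |c|).mono' hg.aestronglyMeasurable (ae_of_all _ fun x => ?_)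
  have h0 : 0 ≤ V x ^ s := Real.rpow_nonneg (zero_le_one.trans (hV1 x)) s
  calc ‖g x‖ ≤ c * V x ^ s := hgc x
    _ ≤ |c| * V x ^ s := by gcongr; exact le_abs_self c
    _ ≤ |c| * V x := by gcongr; exact rpow_le_self_of_one_le (hV1 x) hs

end KernelIntegrals

/-! ### Consequences of geometric ergodicity and the asymptotic variance -/

section Ergodic

variable {E : Type*} [MeasurableSpace E] {P : Kernel E E} [IsMarkovKernel P]
  {π μ₀ : Measure E} [IsProbabilityMeasure π] {V : E → ℝ}

omit [IsMarkovKernel P] [IsProbabilityMeasure π] in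
theorem GeometricErgodicity.V_pos (hA : GeometricErgodicity P π μ₀ V) (x : E) : 0 < V x :=
  zero_lt_one.trans_le (hA.one_le_V x)

omit [IsMarkovKernel P] [IsProbabilityMeasure π] in
-- Every truncation has `V`-norm at most 1, so the rate with `s = 1` is uniform in the truncation
-- level. This transfers finiteness of the integral of `V` between `π` and `P^n(x,·)`.
theorem GeometricErgodicity.exists_min_bound (hA : GeometricErgodicity P π μ₀ V) :
    ∃ C : ℝ, 0 ≤ C ∧ ∀ (x : E) (n N : ℕ),
      |∫ y, min (V y) (N : ℝ) ∂((P ^ n) x) - ∫ y, min (V y) (N : ℝ) ∂π| ≤ C * V x := by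
  obtain ⟨ρ, C, hρ0, hρ1, hC, h⟩ := hA.rate 1 one_pos le_rfl
  refine ⟨C, hC.le, fun x n N => ?_⟩
  have hV := hA.V_pos x
  have := abs_integral_sub_le_of_wNormDist (by positivity) (h x n) zero_le_one
    (hA.measurable_V.min (measurable_const (a := (N : ℝ)))) (fun y => by
      rw [abs_of_nonneg (le_min (hA.V_pos y).le (Nat.cast_nonneg N))]
      simp)
  refine this.trans ?_
  rw [Real.rpow_one, one_mul]
  have : ρ ^ n ≤ 1 := pow_le_one₀ hρ0.le hρ1.le
  calc C * ρ ^ n * V x ≤ C * 1 * V x := by gcongr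
    _ = C * V x := by ring

omit [IsMarkovKernel P] in
-- Take `n = 0` in the truncated bound: `P^0(x,·)` is the Dirac mass at `x`, which compares `π` with
-- the finite number `V x`.
theorem GeometricErgodicity.lintegral_V_lt_top (hA : GeometricErgodicity P π μ₀ V) :
    ∫⁻ x, ENNReal.ofReal (V x) ∂π < ∞ := by
  obtain ⟨C, hC, h⟩ := hA.exists_min_bound
  have : Nonempty E := π.nonempty_of_neZero
  obtain ⟨x⟩ := ‹Nonempty E›
  refine (lintegral_ofReal_le_of_integral_min_le hA.measurable_V (fun y => (hA.V_pos y).le)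
    (B := V x + C * V x) fun N => ?_).trans_lt ENNReal.ofReal_lt_top
  have h0 := h x 0 N
  have h1 : ∫ y, min (V y) (N : ℝ) ∂((P ^ 0) x) = min (V x) N := by
    change ∫ y, min (V y) (N : ℝ) ∂(Kernel.id x) = _
    rw [Kernel.id_apply, integral_dirac' _ _
      (hA.measurable_V.min (measurable_const (a := (N : ℝ)))).stronglyMeasurable]
  rw [h1] at h0
  linarith [(abs_le.1 h0).1, min_le_left (V x) (N : ℝ)]

theorem GeometricErgodicity.lintegral_pow_lt_top (hA : GeometricErgodicity P π μ₀ V) (n : ℕ)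
    (x : E) : ∫⁻ y, ENNReal.ofReal (V y) ∂((P ^ n) x) < ∞ := by
  obtain ⟨C, hC, h⟩ := hA.exists_min_bound
  have := isMarkovKernel_pow P n
  refine (lintegral_ofReal_le_of_integral_min_le hA.measurable_V (fun y => (hA.V_pos y).le)
    (B := ∫ y, V y ∂π + C * V x) fun N => ?_).trans_lt ENNReal.ofReal_lt_top
  have hVi : Integrable V π :=
    integrable_of_wBound hA.measurable_V hA.one_le_V hA.lintegral_V_lt_top (s := 1) le_rfl
      hA.measurable_V (c := 1) fun y => by simp [abs_of_pos (hA.V_pos y)]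
  have h1 : ∫ y, min (V y) (N : ℝ) ∂π ≤ ∫ y, V y ∂π := by
    refine integral_mono_of_nonneg (ae_of_all _ fun y => le_min (hA.V_pos y).le
      (Nat.cast_nonneg N)) hVi (ae_of_all _ fun y => min_le_left _ _)
  linarith [(abs_le.1 (h x n N)).2]

omit [IsMarkovKernel P] in
theorem GeometricErgodicity.integrable_pi (hA : GeometricErgodicity P π μ₀ V) {s : ℝ}
    (hs : s ≤ 1) {f : E → ℝ} (hf : Measurable f) {c : ℝ}
    (hfc : WBound (fun x => V x ^ s) f c) : Integrable f π :=
  integrable_of_wBound hA.measurable_V hA.one_le_V hA.lintegral_V_lt_top hs hf hfc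

theorem GeometricErgodicity.integrable_pow (hA : GeometricErgodicity P π μ₀ V) {s : ℝ}
    (hs : s ≤ 1) {f : E → ℝ} (hf : Measurable f) {c : ℝ}
    (hfc : WBound (fun x => V x ^ s) f c) (n : ℕ) (x : E) : Integrable f ((P ^ n) x) :=
  have := isMarkovKernel_pow P n
  integrable_of_wBound hA.measurable_V hA.one_le_V (hA.lintegral_pow_lt_top n x) hs hf hfc

omit [IsMarkovKernel P] in
theorem measurable_iterApply {f : E → ℝ} (hf : Measurable f) (n : ℕ) :
    Measurable (iterApply P n f) :=
  hf.stronglyMeasurable.integral_kernel.measurable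

omit [IsMarkovKernel P] in
theorem iterApply_zero {f : E → ℝ} (hf : Measurable f) : iterApply P 0 f = f := by
  ext x
  change ∫ y, f y ∂(Kernel.id x) = f x
  rw [Kernel.id_apply, integral_dirac' _ _ hf.stronglyMeasurable]

/-- Chapman–Kolmogorov with the single step taken first, the form that turns into a one-step
conditional expectation along the chain. -/
theorem GeometricErgodicity.iterApply_succ (hA : GeometricErgodicity P π μ₀ V) {s : ℝ}
    (hs : s ≤ 1) {f : E → ℝ} (hf : Measurable f) {c : ℝ}
    (hfc : WBound (fun x => V x ^ s) f c) (n : ℕ) (x : E) :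
    iterApply P (n + 1) f x = ∫ y, iterApply P n f y ∂(P x) := by
  have h := hA.integrable_pow hs hf hfc (n + 1) x
  unfold iterApply
  rw [Kernel.pow_add P n 1, pow_one] at h ⊢
  exact Kernel.integral_comp h

omit [IsMarkovKernel P] [IsProbabilityMeasure π] in
/-- Geometric decay of `P^n f` for centred `f`. -/
theorem GeometricErgodicity.exists_decay (hA : GeometricErgodicity P π μ₀ V) {s : ℝ}
    (hs0 : 0 < s) (hs : s ≤ 1) {f : E → ℝ} (hf : Measurable f) {c : ℝ}
    (hfc : WBound (fun x => V x ^ s) f c) (h0 : ∫ x, f x ∂π = 0) :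
    ∃ ρ C : ℝ, 0 < ρ ∧ ρ < 1 ∧ 0 < C ∧ ∀ n x, |iterApply P n f x| ≤ C * ρ ^ n * V x ^ s := by
  obtain ⟨ρ, C, hρ0, hρ1, hC, h⟩ := hA.rate s hs0 hs
  -- `c` may be 0, while the constant has to be strictly positive.
  refine ⟨ρ, (|c| + 1) * C, hρ0, hρ1, by positivity, fun n x => ?_⟩
  have hV := Real.rpow_pos_of_pos (hA.V_pos x) s
  have := abs_integral_sub_le_of_wNormDist (by positivity) (h x n)
    (add_nonneg (abs_nonneg c) zero_le_one) hf (fun y => (hfc y).trans (by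
      have := Real.rpow_pos_of_pos (hA.V_pos y) s
      dsimp only
      gcongr
      linarith [le_abs_self c]))
  rw [h0, sub_zero] at this
  calc |iterApply P n f x| ≤ _ := this
    _ = _ := by ring

omit [IsMarkovKernel P] [IsProbabilityMeasure π] in
-- Since `V^s ≥ 1`, the subtracted constant is absorbed in the weight.
theorem GeometricErgodicity.wBound_centre (hA : GeometricErgodicity P π μ₀ V) {s : ℝ}
    (hs : 0 ≤ s) {f : E → ℝ} {c : ℝ} (hfc : WBound (fun x => V x ^ s) f c) :
    WBound (fun x => V x ^ s) (centre π f) (c + |∫ y, f y ∂π|) := by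
  intro x
  have h1 : 1 ≤ V x ^ s := Real.one_le_rpow (hA.one_le_V x) hs
  have := hfc x
  dsimp only at this
  calc |centre π f x| ≤ |f x| + |∫ y, f y ∂π| := abs_sub _ _
    _ ≤ (c + |∫ y, f y ∂π|) * V x ^ s := by nlinarith [abs_nonneg (∫ y, f y ∂π)]

omit [IsMarkovKernel P] [IsProbabilityMeasure π] in
theorem measurable_centre {f : E → ℝ} (hf : Measurable f) : Measurable (centre π f) :=
  hf.sub_const _

theorem integral_centre {f : E → ℝ} (hf : Integrable f π) : ∫ x, centre π f x ∂π = 0 := by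
  unfold centre
  rw [integral_sub hf (integrable_const _)]
  simp

omit [MeasurableSpace E] in
theorem wBound_mul {V : E → ℝ} (hV : ∀ x, 0 < V x) {s : ℝ} {f g : E → ℝ} {c d : ℝ}
    (hf : WBound (fun x => V x ^ s) f c) (hg : WBound (fun x => V x ^ s) g d) :
    WBound (fun x => V x ^ (2 * s)) (fun x => f x * g x) (c * d) := by
  intro x
  have h1 := hf x
  have h2 := hg x
  have : V x ^ (2 * s) = V x ^ s * V x ^ s := by rw [two_mul, Real.rpow_add (hV x)]
  dsimp only at h1 h2 ⊢
  rw [this, abs_mul]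
  calc |f x| * |g x| ≤ (c * V x ^ s) * (d * V x ^ s) :=
        mul_le_mul h1 h2 (abs_nonneg _) ((abs_nonneg _).trans h1)
    _ = _ := by ring

/-- The function `h² + 2 h ∑_{j ≥ 1} P^j h`, whose `π`-integral is the asymptotic variance. -/
def varianceDensity (P : Kernel E E) (f : E → ℝ) (x : E) : ℝ :=
  f x * f x + 2 * (f x * ∑' j : ℕ, iterApply P (j + 1) f x)

/-- Consequences of geometric ergodicity for a centred function in `L_{V^s}`, `s ≤ 1/2`. -/
theorem GeometricErgodicity.sigmaSqFinite (hA : GeometricErgodicity P π μ₀ V) {s : ℝ}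
    (hs0 : 0 < s) (hs : s ≤ 1 / 2) {f : E → ℝ} (hf : Measurable f) {c : ℝ}
    (hfc : WBound (fun x => V x ^ s) f c) (h0 : ∫ x, f x ∂π = 0) :
    SigmaSqFinite P π f ∧ Measurable (varianceDensity P f) ∧
      (∃ d, WBound (fun x => V x ^ (2 * s)) (varianceDensity P f) d) ∧
      ∫ x, varianceDensity P f x ∂π = sigmaSq P π f := by
  have hs1 : s ≤ 1 := by linarith
  have h2s : 2 * s ≤ 1 := by linarith
  obtain ⟨ρ, C, hρ0, hρ1, hC, hdec⟩ := hA.exists_decay hs0 hs1 hf hfc h0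
  have hPm : ∀ j, Measurable (iterApply P j f) := measurable_iterApply hf
  -- Both factors lie in `L_{V^s}`, so the product is controlled by `V^(2s) ≤ V`; this is where `s ≤
  -- 1/2` matters.
  have hcross : ∀ j : ℕ, WBound (fun x => V x ^ (2 * s))
      (fun x => f x * iterApply P (j + 1) f x) (c * (C * ρ ^ (j + 1))) := fun j =>
    wBound_mul hA.V_pos hfc (hdec (j + 1))
  have hsq := wBound_mul hA.V_pos hfc hfc
  have hint : ∀ j : ℕ, Integrable (fun x => f x * iterApply P (j + 1) f x) π := fun j =>
    hA.integrable_pi h2s (hf.mul (hPm _)) (hcross j)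
  have hgeo : Summable fun j : ℕ => C * ρ ^ (j + 1) :=
    (((summable_geometric_of_lt_one hρ0.le hρ1).mul_right ρ).mul_left C).congr fun j => by
      rw [pow_succ]
  have hVi : Integrable (fun x => V x ^ (2 * s)) π :=
    hA.integrable_pi h2s (hA.measurable_V.pow_const _) (c := 1) fun x => by
      simp [abs_of_pos (Real.rpow_pos_of_pos (hA.V_pos x) (2 * s))]
  have hnorm : ∀ j : ℕ, ∫ x, ‖f x * iterApply P (j + 1) f x‖ ∂π
      ≤ c * (C * ρ ^ (j + 1)) * ∫ x, V x ^ (2 * s) ∂π := fun j => by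
    rw [← integral_const_mul]
    exact integral_mono (hint j).norm (hVi.const_mul _) fun x => hcross j x
  have hsumn : Summable fun j : ℕ => ∫ x, ‖f x * iterApply P (j + 1) f x‖ ∂π :=
    Summable.of_nonneg_of_le (fun j => integral_nonneg fun x => norm_nonneg _) hnorm
      ((hgeo.mul_left c).mul_right _)
  -- The geometric decay makes the integrals of the norms summable, which permits exchanging
  -- integral and series.
  have hhas := hasSum_integral_of_summable_integral_norm hint hsumn
  have htb : WBound (fun x => V x ^ s) (fun x => ∑' j : ℕ, iterApply P (j + 1) f x)
      (∑' j : ℕ, C * ρ ^ (j + 1)) := fun x => by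
    have := tsum_of_norm_bounded (f := fun j : ℕ => iterApply P (j + 1) f x)
      (hgeo.mul_right (V x ^ s)).hasSum fun j => hdec (j + 1) x
    rwa [tsum_mul_right] at this
  have htm : Measurable fun x => ∑' j : ℕ, iterApply P (j + 1) f x :=
    Measurable.tsum fun j => hPm (j + 1)
  have hfb := wBound_mul hA.V_pos hfc htb
  refine ⟨⟨?_, fun j x => hA.integrable_pow hs1 hf hfc _ x, hint, hhas.summable⟩, ?_, ?_, ?_⟩
  · simp_rw [sq]
    exact hA.integrable_pi h2s (hf.mul hf) hsq
  · exact (hf.mul hf).add ((hf.mul htm).const_mul 2)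
  · refine ⟨c * c + 2 * (c * ∑' j : ℕ, C * ρ ^ (j + 1)), fun x => ?_⟩
    have h1 := hsq x
    have h2 := hfb x
    dsimp only at h1 h2 ⊢
    calc |varianceDensity P f x| ≤ |f x * f x| + |2 * (f x * ∑' j : ℕ, iterApply P (j + 1) f x)| :=
          abs_add_le _ _
      _ = |f x * f x| + 2 * |f x * ∑' j : ℕ, iterApply P (j + 1) f x| := by
          rw [abs_mul 2, abs_two]
      _ ≤ _ := by linarith
  · unfold varianceDensity sigmaSq
    have e : (∫ x, f x * ∑' j : ℕ, iterApply P (j + 1) f x ∂π)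
        = ∑' j : ℕ, ∫ x, f x * iterApply P (j + 1) f x ∂π := by
      rw [hhas.tsum_eq]
      simp_rw [tsum_mul_left]
    have i1 : Integrable (fun x => f x * f x) π := hA.integrable_pi h2s (hf.mul hf) hsq
    have i2 : Integrable (fun x => 2 * (f x * ∑' j : ℕ, iterApply P (j + 1) f x)) π :=
      (hA.integrable_pi h2s (hf.mul htm) hfb).const_mul 2
    rw [integral_add i1 i2, integral_const_mul, e]
    simp_rw [sq]

end Ergodic

/-! ### A scalar Taylor bound for `|s + d|^q` -/

section ScalarInequality

/-- For `q ≤ 2` the power of `N` is trivial and `t² ≤ |t|^q`. For `q ≥ 2`, either `t² ≤ 1/N`, or `N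
t² > 1` and multiplying `t²` by `(N t²)^(q/2-1) ≥ 1` only enlarges it. The exponent of `N` is what
later produces `n^max(1/q, 1/2)`. -/
theorem sq_le_inv_add_rpow {q N t : ℝ} (hq : 1 < q) (hN : 1 ≤ N) (ht : |t| ≤ 1) :
    t ^ 2 ≤ 1 / N + N ^ (q * max (1 / q) (1 / 2) - 1) * |t| ^ q := by
  have hN0 : 0 < N := by linarith
  have hq0 : 0 < q := by linarith
  rcases eq_or_ne t 0 with rfl | ht0
  · simp only [abs_zero]
    rw [Real.zero_rpow hq0.ne']
    simp [hN0.le]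
  have hta : 0 < |t| := abs_pos.2 ht0
  rcases le_total q 2 with h2 | h2
  · have e : q * max (1 / q) (1 / 2) - 1 = 0 := by
      rw [max_eq_left (one_div_le_one_div_of_le hq0 h2)]
      field_simp
      ring
    rw [e, Real.rpow_zero, one_mul]
    have : |t| ^ (2 : ℝ) ≤ |t| ^ q := Real.rpow_le_rpow_of_exponent_ge hta ht h2
    rw [Real.rpow_two, sq_abs] at this
    have : 0 < 1 / N := by positivity
    linarith
  · have e : q * max (1 / q) (1 / 2) - 1 = q / 2 - 1 := by
      rw [max_eq_right (one_div_le_one_div_of_le two_pos h2)]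
      ring
    rw [e]
    by_cases h : N * t ^ 2 ≤ 1
    · have : t ^ 2 ≤ 1 / N := by rw [le_div_iff₀ hN0]; linarith
      have : 0 ≤ N ^ (q / 2 - 1) * |t| ^ q := by positivity
      linarith
    · push Not at h
      have h1 : 1 ≤ (N * t ^ 2) ^ (q / 2 - 1) := Real.one_le_rpow h.le (by linarith)
      have e2 : |t| ^ q = t ^ 2 * (t ^ 2) ^ (q / 2 - 1) := by
        have ht2 : 0 < t ^ 2 := by positivity
        have ha := Real.rpow_add ht2 1 (q / 2 - 1)
        rw [Real.rpow_one] at ha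
        rw [← ha, ← sq_abs t, ← Real.rpow_natCast, ← Real.rpow_mul hta.le]
        congr 1
        push_cast
        ring
      have e3 : N ^ (q / 2 - 1) * |t| ^ q = t ^ 2 * (N * t ^ 2) ^ (q / 2 - 1) := by
        rw [e2, Real.mul_rpow hN0.le (sq_nonneg t)]
        ring
      rw [e3]
      have : 0 < 1 / N := by positivity
      nlinarith [sq_nonneg t]

/-- Bernoulli's inequality at `1/(1+t)` gives `(1+t)^q - 1 ≤ q t (1+t)^(q-1)`. The remaining
`(1+t)^(q-1) - 1` is `O(t)` because `u^(q-1)` is Lipschitz on `[1/2, 3/2]`. -/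
theorem exists_rpow_one_add_le {q : ℝ} (hq : 1 < q) :
    ∃ C : ℝ, 0 < C ∧ ∀ t : ℝ, |t| ≤ 1 / 2 → (1 + t) ^ q ≤ 1 + q * t + C * t ^ 2 := by
  have hc : ContDiffOn ℝ 1 (fun u : ℝ => u ^ (q - 1)) (Set.Icc (1 / 2) (3 / 2)) := fun u hu =>
    (Real.contDiffAt_rpow_const_of_ne (by have := hu.1; linarith)).contDiffWithinAt
  obtain ⟨L, hL⟩ := hc.exists_lipschitzOnWith one_ne_zero (convex_Icc _ _) isCompact_Icc
  refine ⟨q * (L + 1), by positivity, fun t ht => ?_⟩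
  obtain ⟨h1, h2⟩ := abs_le.1 ht
  have hu : 0 < 1 + t := by linarith
  have hB := one_add_mul_self_le_rpow_one_add (s := 1 / (1 + t) - 1) (p := q)
    (by have : 0 < 1 / (1 + t) := by positivity
        linarith) hq.le
  have e1 : (1 + (1 / (1 + t) - 1)) ^ q = 1 / (1 + t) ^ q := by
    rw [add_sub_cancel, Real.div_rpow zero_le_one hu.le, Real.one_rpow]
  rw [e1, le_div_iff₀ (Real.rpow_pos_of_pos hu q)] at hB
  have e2 : (1 + q * (1 / (1 + t) - 1)) * (1 + t) ^ q
      = (1 + t) ^ q - q * t * (1 + t) ^ (q - 1) := by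
    rw [Real.rpow_sub_one hu.ne']
    field_simp
    ring
  rw [e2] at hB
  have hl := hL.dist_le_mul (1 + t) ⟨by linarith, by linarith⟩ 1 ⟨by norm_num, by norm_num⟩
  rw [Real.dist_eq, Real.dist_eq, Real.one_rpow, add_sub_cancel_left] at hl
  have h3 : t * ((1 + t) ^ (q - 1) - 1) ≤ (L + 1) * t ^ 2 := by
    calc t * ((1 + t) ^ (q - 1) - 1) ≤ |t| * |(1 + t) ^ (q - 1) - 1| := by
          rw [← abs_mul]; exact le_abs_self _
      _ ≤ |t| * (L * |t|) := by gcongr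
      _ = L * t ^ 2 := by rw [← sq_abs t]; ring
      _ ≤ (L + 1) * t ^ 2 := by nlinarith [sq_nonneg t]
  nlinarith

theorem abs_mul_rpow_sub_two {q : ℝ} (hq : 1 < q) (s : ℝ) :
    |q * |s| ^ (q - 2) * s| = q * |s| ^ (q - 1) := by
  rcases eq_or_ne s 0 with rfl | hs
  · simp [Real.zero_rpow (by linarith : q - 1 ≠ 0)]
  · have hs' : 0 < |s| := abs_pos.2 hs
    rw [abs_mul, abs_mul, abs_of_pos (by linarith : (0 : ℝ) < q),
      abs_of_nonneg (Real.rpow_nonneg hs'.le _), mul_assoc,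
      show q - 1 = (q - 2) + 1 by ring, Real.rpow_add_one hs'.ne']

/-- A Taylor-type upper bound for `|s + d|^q`, with a free parameter `N`. -/
theorem exists_abs_add_rpow_le {q : ℝ} (hq : 1 < q) :
    ∃ C : ℝ, 0 < C ∧ ∀ N : ℝ, 1 ≤ N → ∀ s d : ℝ,
      |s + d| ^ q ≤ (1 + C / N) * |s| ^ q + (q * |s| ^ (q - 2) * s) * d
        + C * N ^ (q * max (1 / q) (1 / 2) - 1) * |d| ^ q := by
  obtain ⟨C₁, hC₁, h₁⟩ := exists_rpow_one_add_le hq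
  have hq0 : 0 < q := by linarith
  refine ⟨C₁ + (3 ^ q + q * 2 ^ (q - 1)), by positivity, fun N hN s d => ?_⟩
  have hN0 : 0 < N := by linarith
  set κ := q * max (1 / q) (1 / 2) - 1 with hκ
  have hκ0 : 0 ≤ κ := by
    have : q * (1 / q) ≤ q * max (1 / q) (1 / 2) := by gcongr; exact le_max_left _ _
    rw [mul_one_div_cancel hq0.ne'] at this
    linarith
  have hNκ : 1 ≤ N ^ κ := Real.one_le_rpow hN hκ0
  set C₂ : ℝ := 3 ^ q + q * 2 ^ (q - 1) with hC₂
  have hC₂0 : 0 < C₂ := by positivity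
  have hsq : 0 ≤ |s| ^ q := by positivity
  have hdq : 0 ≤ |d| ^ q := by positivity
  -- If `|s| ≤ 2|d|`, both `|s+d|^q` and the linear term are multiples of `|d|^q`, with constants
  -- `3^q` and `q 2^(q-1)`. Otherwise, by homogeneity, only the expansion at `t = d/s` with `|t| ≤
  -- 1/2` is needed.
  rcases le_or_gt |s| (2 * |d|) with h | h
  · have a1 : |s + d| ^ q ≤ 3 ^ q * |d| ^ q := by
      rw [← Real.mul_rpow (by norm_num) (abs_nonneg d)]
      refine Real.rpow_le_rpow (abs_nonneg _) ?_ hq0.le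
      linarith [abs_add_le s d]
    have a2 : -(q * 2 ^ (q - 1) * |d| ^ q) ≤ (q * |s| ^ (q - 2) * s) * d := by
      refine neg_le_of_abs_le ?_
      rw [abs_mul, abs_mul_rpow_sub_two hq]
      rcases eq_or_ne d 0 with rfl | hd
      · simp [Real.zero_rpow hq0.ne']
      have hd' : 0 < |d| := abs_pos.2 hd
      calc q * |s| ^ (q - 1) * |d| ≤ q * (2 * |d|) ^ (q - 1) * |d| := by
            gcongr
        _ = q * 2 ^ (q - 1) * |d| ^ q := by
            rw [Real.mul_rpow two_pos.le hd'.le, Real.rpow_sub_one hd'.ne']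
            field_simp
    have a3 : C₂ * |d| ^ q ≤ (C₁ + C₂) * N ^ κ * |d| ^ q := by
      gcongr
      nlinarith
    have a4 : 0 ≤ (C₁ + C₂) / N * |s| ^ q := by positivity
    rw [hC₂] at a3
    nlinarith
  · have hs' : 0 < |s| := lt_of_le_of_lt (by positivity) h
    have hs : s ≠ 0 := abs_pos.1 hs'
    set t := d / s with ht
    have hd : d = s * t := by rw [ht]; field_simp
    have hta : |t| ≤ 1 / 2 := by
      rw [ht, abs_div, div_le_iff₀ hs']
      linarith
    have e1 : |s + d| ^ q = |s| ^ q * (1 + t) ^ q := by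
      have : 0 ≤ 1 + t := by linarith [(abs_le.1 hta).1]
      rw [hd, show s + s * t = s * (1 + t) by ring, abs_mul, abs_of_nonneg this,
        Real.mul_rpow hs'.le this]
    have e2 : (q * |s| ^ (q - 2) * s) * d = |s| ^ q * (q * t) := by
      have : |s| ^ q = |s| ^ (q - 2) * (s * s) := by
        rw [show q = (q - 2) + 2 by ring, Real.rpow_add hs', Real.rpow_two, sq_abs, sq]
        ring_nf
      rw [this, hd]
      ring
    have e3 : |d| ^ q = |s| ^ q * |t| ^ q := by
      rw [hd, abs_mul, Real.mul_rpow hs'.le (abs_nonneg t)]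
    rw [e1, e2, e3]
    have b1 := h₁ t hta
    have b2 := sq_le_inv_add_rpow hq hN (hta.trans (by norm_num))
    rw [← hκ] at b2
    have b3 : C₁ * t ^ 2 ≤ (C₁ + C₂) / N + (C₁ + C₂) * N ^ κ * |t| ^ q := by
      have : 0 ≤ 1 / N + N ^ κ * |t| ^ q := by positivity
      calc C₁ * t ^ 2 ≤ C₁ * (1 / N + N ^ κ * |t| ^ q) := by gcongr
        _ ≤ (C₁ + C₂) * (1 / N + N ^ κ * |t| ^ q) := by gcongr; linarith
        _ = _ := by ring
    have b4 := mul_le_mul_of_nonneg_left (b1.trans (add_le_add_right b3 _)) hsq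
    linarith

end ScalarInequality

/-! ### Moment inequality for martingale differences -/

section Martingale

variable {Ω : Type*} {m0 : MeasurableSpace Ω} {μ : Measure Ω}

theorem eLpNorm_le_ofReal_iff {q : ℝ} (hq : 0 < q) {f : Ω → ℝ}
    (hf : MemLp f (ENNReal.ofReal q) μ) {B : ℝ} (hB : 0 ≤ B) :
    eLpNorm f (ENNReal.ofReal q) μ ≤ ENNReal.ofReal B ↔ ∫ ω, |f ω| ^ q ∂μ ≤ B ^ q := by
  rw [hf.eLpNorm_eq_integral_rpow_norm (by simpa using hq) ENNReal.ofReal_ne_top,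
    ENNReal.toReal_ofReal hq.le, ENNReal.ofReal_le_ofReal_iff hB]
  have h0 : 0 ≤ ∫ ω, |f ω| ^ q ∂μ := integral_nonneg fun ω => by positivity
  simp only [Real.norm_eq_abs]
  rw [Real.rpow_inv_le_iff_of_pos h0 hB hq]

theorem MemLp.integrable_abs_rpow {q : ℝ} (hq : 0 < q) {f : Ω → ℝ}
    (hf : MemLp f (ENNReal.ofReal q) μ) : Integrable (fun ω => |f ω| ^ q) μ := by
  have := hf.integrable_norm_rpow (by simpa using hq) ENNReal.ofReal_ne_top
  simpa [ENNReal.toReal_ofReal hq.le] using this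

/-- Integrate the Taylor bound: its linear coefficient `q |S|^(q-2) S` is measurable with respect to
the past, hence orthogonal to `D`. -/
theorem integral_abs_add_rpow_le [IsFiniteMeasure μ] {q C N : ℝ} (hq : 1 < q)
    (hC : ∀ s d : ℝ, |s + d| ^ q ≤ (1 + C / N) * |s| ^ q + (q * |s| ^ (q - 2) * s) * d
        + C * N ^ (q * max (1 / q) (1 / 2) - 1) * |d| ^ q)
    {m : MeasurableSpace Ω} (hm : m ≤ m0) {S D : Ω → ℝ} (hSm : StronglyMeasurable[m] S)
    (hS : MemLp S (ENNReal.ofReal q) μ) (hD : MemLp D (ENNReal.ofReal q) μ)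
    (hD0 : μ[D|m] =ᵐ[μ] 0) :
    ∫ ω, |S ω + D ω| ^ q ∂μ ≤ (1 + C / N) * ∫ ω, |S ω| ^ q ∂μ
      + C * N ^ (q * max (1 / q) (1 / 2) - 1) * ∫ ω, |D ω| ^ q ∂μ := by
  have hq0 : 0 < q := by linarith
  have iS := MemLp.integrable_abs_rpow hq0 hS
  have iD := MemLp.integrable_abs_rpow hq0 hD
  have iSD := MemLp.integrable_abs_rpow hq0 (hS.add hD)
  have hψ : StronglyMeasurable[m] fun ω => q * |S ω| ^ (q - 2) * S ω := by
    have := hSm.measurable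
    exact Measurable.stronglyMeasurable (by fun_prop)
  -- Comparing `|S|` with `|D|` yields `|S|^(q-1) |D| ≤ |S|^q + |D|^q`.
  have iψ : Integrable (fun ω => (q * |S ω| ^ (q - 2) * S ω) * D ω) μ := by
    refine ((iS.add iD).const_mul q).mono' ((hψ.mono hm).aestronglyMeasurable.mul
      hD.aestronglyMeasurable) (ae_of_all _ fun ω => ?_)
    rw [norm_mul, Real.norm_eq_abs, Real.norm_eq_abs, abs_mul_rpow_sub_two hq, mul_assoc]
    refine mul_le_mul_of_nonneg_left ?_ hq0.le
    have e : ∀ x : ℝ, 0 ≤ x → x ^ (q - 1) * x = x ^ q := fun x hx => by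
      rcases hx.eq_or_lt with rfl | hx
      · simp [Real.zero_rpow hq0.ne']
      · rw [Real.rpow_sub_one hx.ne']
        field_simp
    have n1 : 0 ≤ |S ω| ^ q := by positivity
    have n2 : 0 ≤ |D ω| ^ q := by positivity
    change |S ω| ^ (q - 1) * |D ω| ≤ |S ω| ^ q + |D ω| ^ q
    rcases le_total |S ω| |D ω| with h | h
    · have : |S ω| ^ (q - 1) * |D ω| ≤ |D ω| ^ (q - 1) * |D ω| := by gcongr
      rw [e _ (abs_nonneg _)] at this
      linarith
    · have : |S ω| ^ (q - 1) * |D ω| ≤ |S ω| ^ (q - 1) * |S ω| := by gcongr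
      rw [e _ (abs_nonneg _)] at this
      linarith
  have h0 : ∫ ω, (q * |S ω| ^ (q - 2) * S ω) * D ω ∂μ = 0 := by
    have hDi : Integrable D μ := hD.integrable (by simpa using hq.le)
    rw [← integral_condExp hm]
    have h1 := condExp_mul_of_stronglyMeasurable_left hψ iψ hDi
    rw [integral_congr_ae (g := fun _ => (0 : ℝ))]
    · simp
    · filter_upwards [h1, hD0] with ω h1 h2
      change (μ[(fun ω => q * |S ω| ^ (q - 2) * S ω) * D|m]) ω = 0
      rw [h1]
      simp [h2]
  calc ∫ ω, |S ω + D ω| ^ q ∂μ ≤ ∫ ω, ((1 + C / N) * |S ω| ^ q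
          + (q * |S ω| ^ (q - 2) * S ω) * D ω
          + C * N ^ (q * max (1 / q) (1 / 2) - 1) * |D ω| ^ q) ∂μ :=
        integral_mono iSD (((iS.const_mul _).add iψ).add (iD.const_mul _)) fun ω => hC _ _
    _ = _ := by
        have i1 := iS.const_mul (1 + C / N)
        have i2 := iD.const_mul (C * N ^ (q * max (1 / q) (1 / 2) - 1))
        have i3 : Integrable (fun ω => (1 + C / N) * |S ω| ^ q
          + (q * |S ω| ^ (q - 2) * S ω) * D ω) μ := i1.add iψ
        rw [integral_add i3 i2, integral_add i1 iψ, h0, integral_const_mul, integral_const_mul,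
          add_zero]

/-- Moment inequality for sums of martingale differences in `L^q`, `q > 1`. -/
theorem exists_eLpNorm_sum_le {q : ℝ} (hq : 1 < q) :
    ∃ C : ℝ, 0 < C ∧ ∀ {Ω : Type*} {m0 : MeasurableSpace Ω} {μ : Measure Ω}
      [IsFiniteMeasure μ] (ℱ : Filtration ℕ m0) (D : ℕ → Ω → ℝ) (M : ℝ), 0 ≤ M →
      (∀ i, StronglyMeasurable[ℱ i] (D i)) → (∀ i, μ[D (i + 1)|ℱ i] =ᵐ[μ] 0) →
      (∀ i, eLpNorm (D (i + 1)) (ENNReal.ofReal q) μ ≤ ENNReal.ofReal M) → ∀ a n : ℕ,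
      eLpNorm (fun ω => ∑ i ∈ Finset.range n, D (a + i + 1) ω) (ENNReal.ofReal q) μ
        ≤ ENNReal.ofReal (C * M * (n : ℝ) ^ max (1 / q) (1 / 2)) := by
  obtain ⟨C, hC0, hC⟩ := exists_abs_add_rpow_le hq
  have hq0 : 0 < q := by linarith
  refine ⟨(C * Real.exp C) ^ (1 / q), by positivity, ?_⟩
  intro Ω m0 μ _ ℱ D M hM hDm hD0 hDM a n
  rcases Nat.eq_zero_or_pos n with rfl | hn
  · simp
  set κ := max (1 / q) (1 / 2) with hκ
  have hDL : ∀ i, MemLp (D (i + 1)) (ENNReal.ofReal q) μ := fun i =>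
    ⟨((hDm _).mono (ℱ.le _)).aestronglyMeasurable, (hDM i).trans_lt ENNReal.ofReal_lt_top⟩
  have hDM' : ∀ i, ∫ ω, |D (i + 1) ω| ^ q ∂μ ≤ M ^ q := fun i =>
    (eLpNorm_le_ofReal_iff hq0 (hDL i) hM).1 (hDM i)
  have hSL : ∀ k, MemLp (fun ω => ∑ i ∈ Finset.range k, D (a + i + 1) ω)
      (ENNReal.ofReal q) μ := fun k => memLp_finsetSum _ fun i _ => hDL _
  have hSm : ∀ k, StronglyMeasurable[ℱ (a + k)]
      (fun ω => ∑ i ∈ Finset.range k, D (a + i + 1) ω) := fun k =>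
    Finset.stronglyMeasurable_fun_sum _ fun i hi =>
      (hDm _).mono (ℱ.mono (by have := Finset.mem_range.1 hi; omega))
  have hn1 : (1 : ℝ) ≤ n := by exact_mod_cast hn
  set K : ℝ := C * (n : ℝ) ^ (q * κ - 1) * M ^ q with hK
  have hK0 : 0 ≤ K := by positivity
  have hx : 1 ≤ 1 + C / (n : ℝ) := by have : 0 ≤ C / (n : ℝ) := by positivity
                                      linarith
  -- The free parameter is set to the total number `n` of summands: each step multiplies by `1 +
  -- C/n`, so `n` steps cost at most `e^C`, while the added terms total `n K = C n^(qκ) M^q`.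
  have key : ∀ k : ℕ, ∫ ω, |∑ i ∈ Finset.range k, D (a + i + 1) ω| ^ q ∂μ
      ≤ k * K * (1 + C / n) ^ k := by
    intro k
    induction k with
    | zero => simp [Real.zero_rpow hq0.ne']
    | succ k ih =>
      have h1 := integral_abs_add_rpow_le hq (hC n hn1) (ℱ.le (a + k)) (hSm k) (hSL k)
        (hDL (a + k)) (hD0 (a + k))
      have h2 : C * (n : ℝ) ^ (q * κ - 1) * ∫ ω, |D (a + k + 1) ω| ^ q ∂μ ≤ K :=
        mul_le_mul_of_nonneg_left (hDM' _) (by positivity)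
      simp only [Finset.sum_range_succ]
      have h3 : (1 + C / (n : ℝ)) * ∫ ω, |∑ i ∈ Finset.range k, D (a + i + 1) ω| ^ q ∂μ
          ≤ (1 + C / n) * (k * K * (1 + C / n) ^ k) :=
        mul_le_mul_of_nonneg_left ih (by linarith)
      have h4 : 1 ≤ (1 + C / (n : ℝ)) ^ (k + 1) := one_le_pow₀ hx
      calc _ ≤ _ := h1
        _ ≤ (1 + C / n) * (k * K * (1 + C / n) ^ k) + K := add_le_add h3 h2
        _ = k * K * (1 + C / n) ^ (k + 1) + K * 1 := by ring
        _ ≤ k * K * (1 + C / n) ^ (k + 1) + K * (1 + C / n) ^ (k + 1) := by gcongr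
        _ = _ := by push_cast; ring
  rw [eLpNorm_le_ofReal_iff hq0 (hSL n) (by positivity)]
  refine (key n).trans ?_
  have h5 : (1 + C / (n : ℝ)) ^ n ≤ Real.exp C := by
    calc (1 + C / (n : ℝ)) ^ n ≤ (Real.exp (C / n)) ^ n := by
          gcongr
          linarith [Real.add_one_le_exp (C / (n : ℝ))]
      _ = Real.exp C := by
          rw [← Real.exp_nat_mul]
          congr 1
          field_simp
  have e : ((C * Real.exp C) ^ (1 / q) * M * (n : ℝ) ^ κ) ^ q
      = n * K * Real.exp C := by
    rw [Real.mul_rpow (by positivity) (by positivity), Real.mul_rpow (by positivity) hM,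
      ← Real.rpow_mul (by positivity), one_div_mul_cancel hq0.ne', Real.rpow_one,
      ← Real.rpow_mul (by positivity), hK, Real.rpow_sub_one (by positivity), mul_comm κ q]
    field_simp
  rw [e]
  gcongr

end Martingale

/-! ### Maximal functions in `L^q` and dyadic chaining -/

section MaximalBound

variable {Ω : Type*} {m0 : MeasurableSpace Ω} {μ : Measure Ω} {ι ι' : Type*}

/-- The maximal function of the family `f i`, `i ∈ s`, is dominated by a function whose
`L^q`-norm is at most `B`. -/
def HasMaximalBound (μ : Measure Ω) (q : ℝ) (s : Set ι) (f : ι → Ω → ℝ) (B : ℝ) : Prop :=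
  0 ≤ B ∧ ∃ Y : Ω → ℝ, AEStronglyMeasurable Y μ ∧ (∀ i ∈ s, ∀ ω, |f i ω| ≤ Y ω) ∧
    eLpNorm Y (ENNReal.ofReal q) μ ≤ ENNReal.ofReal B

theorem HasMaximalBound.mono {q : ℝ} {s : Set ι} {f : ι → Ω → ℝ} {B B' : ℝ}
    (h : HasMaximalBound μ q s f B) (hB : B ≤ B') : HasMaximalBound μ q s f B' := by
  obtain ⟨h0, Y, hY, hd, hn⟩ := h
  exact ⟨h0.trans hB, Y, hY, hd, hn.trans (ENNReal.ofReal_le_ofReal hB)⟩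

/-- The dominating index may depend on `ω`, so random maximisers are allowed. -/
theorem HasMaximalBound.of_le {q : ℝ} {s : Set ι} {f : ι → Ω → ℝ} {B : ℝ}
    (h : HasMaximalBound μ q s f B) {s' : Set ι'} {g : ι' → Ω → ℝ} {c : ℝ} (hc : 0 ≤ c)
    (hg : ∀ j ∈ s', ∀ ω, ∃ i ∈ s, |g j ω| ≤ c * |f i ω|) :
    HasMaximalBound μ q s' g (c * B) := by
  obtain ⟨h0, Y, hY, hd, hn⟩ := h
  refine ⟨mul_nonneg hc h0, fun ω => c * Y ω, hY.const_mul c, fun j hj ω => ?_, ?_⟩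
  · obtain ⟨i, hi, h⟩ := hg j hj ω
    exact h.trans (mul_le_mul_of_nonneg_left (hd i hi ω) hc)
  · have := eLpNorm_const_smul c Y (ENNReal.ofReal q) μ
    change eLpNorm (c • Y) _ μ ≤ _
    rw [this, Real.enorm_of_nonneg hc, ENNReal.ofReal_mul hc]
    gcongr

theorem HasMaximalBound.add {q : ℝ} (hq : 1 ≤ q) {s : Set ι} {f g : ι → Ω → ℝ} {B C : ℝ}
    (hf : HasMaximalBound μ q s f B) (hg : HasMaximalBound μ q s g C) :
    HasMaximalBound μ q s (fun i ω => f i ω + g i ω) (B + C) := by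
  obtain ⟨h0, Y, hY, hd, hn⟩ := hf
  obtain ⟨h0', Y', hY', hd', hn'⟩ := hg
  refine ⟨add_nonneg h0 h0', fun ω => Y ω + Y' ω, hY.add hY', fun i hi ω =>
    (abs_add_le _ _).trans (add_le_add (hd i hi ω) (hd' i hi ω)), ?_⟩
  rw [ENNReal.ofReal_add h0 h0']
  exact (eLpNorm_add_le hY hY' (by simpa using hq)).trans (add_le_add hn hn')

theorem HasMaximalBound.zero {q : ℝ} {s : Set ι} :
    HasMaximalBound μ q s (fun _ _ => (0 : ℝ)) 0 :=
  ⟨le_rfl, fun _ => 0, aestronglyMeasurable_const, fun _ _ _ => by simp, by simp⟩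

theorem HasMaximalBound.finset_sum {q : ℝ} (hq : 1 ≤ q) {s : Set ι} (t : Finset ι')
    {f : ι' → ι → Ω → ℝ} {B : ι' → ℝ} (h : ∀ j ∈ t, HasMaximalBound μ q s (f j) (B j)) :
    HasMaximalBound μ q s (fun i ω => ∑ j ∈ t, f j i ω) (∑ j ∈ t, B j) := by
  classical
  induction t using Finset.induction_on with
  | empty => simpa using HasMaximalBound.zero
  | insert j t hj ih =>
    simp only [Finset.sum_insert hj]
    exact (h j (Finset.mem_insert_self j t)).add hq
      (ih fun k hk => h k (Finset.mem_insert_of_mem hk))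

theorem HasMaximalBound.of_eLpNorm {q : ℝ} {f : Ω → ℝ} (hf : AEStronglyMeasurable f μ) {B : ℝ}
    (hB : 0 ≤ B) (h : eLpNorm f (ENNReal.ofReal q) μ ≤ ENNReal.ofReal B) (s : Set ι) :
    HasMaximalBound μ q s (fun _ => f) B :=
  ⟨hB, fun ω => |f ω|, continuous_abs.comp_aestronglyMeasurable hf, fun _ _ _ => le_rfl, by
    simp only [← Real.norm_eq_abs, eLpNorm_norm]
    exact h⟩

/-- The maximum of the dominating functions is at most their `ℓ^q` sum, and `q`-th moments add up;
hence the factor `card^(1/q)`. -/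
theorem HasMaximalBound.of_finset {q : ℝ} (hq : 0 < q) (t : Finset ι') {s : ι' → Set ι}
    {f : ι' → ι → Ω → ℝ} {B : ℝ} (hB : 0 ≤ B)
    (h : ∀ j ∈ t, HasMaximalBound μ q (s j) (f j) B) :
    HasMaximalBound μ q {x : ι' × ι | x.1 ∈ t ∧ x.2 ∈ s x.1} (fun x => f x.1 x.2)
      ((t.card : ℝ) ^ (1 / q) * B) := by
  choose! h0 Y hY hd hn using h
  refine ⟨by positivity, fun ω => (∑ j ∈ t, |Y j ω| ^ q) ^ (1 / q), ?_, ?_, ?_⟩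
  · have hm : AEMeasurable (fun ω => ∑ j ∈ t, |Y j ω| ^ q) μ := by
      refine Finset.aemeasurable_fun_sum t fun j hj => ?_
      have := (hY j hj).aemeasurable
      exact (continuous_abs.measurable.comp_aemeasurable this).pow_const q
    exact (hm.pow_const _).aestronglyMeasurable
  · rintro ⟨j, i⟩ ⟨hj, hi⟩ ω
    refine (hd j hj i hi ω).trans ((le_abs_self _).trans ?_)
    have : |Y j ω| = (|Y j ω| ^ q) ^ (1 / q) := by
      rw [one_div, Real.rpow_rpow_inv (abs_nonneg _) hq.ne']
    rw [this]
    refine Real.rpow_le_rpow (by positivity) ?_ (by positivity)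
    exact Finset.single_le_sum (f := fun j => |Y j ω| ^ q) (fun j _ => by positivity) hj
  · have hq' : ENNReal.ofReal q ≠ 0 := by simpa using hq
    have key : ∀ g : Ω → ℝ, eLpNorm g (ENNReal.ofReal q) μ
        = (∫⁻ ω, ENNReal.ofReal (|g ω| ^ q) ∂μ) ^ (1 / q) := fun g => by
      rw [eLpNorm_eq_lintegral_rpow_enorm_toReal hq' ENNReal.ofReal_ne_top,
        ENNReal.toReal_ofReal hq.le]
      congr 1
      refine lintegral_congr fun ω => ?_
      rw [← ofReal_norm, Real.norm_eq_abs,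
        ENNReal.ofReal_rpow_of_nonneg (abs_nonneg _) hq.le]
    rw [key]
    have e : ∀ ω, |(∑ j ∈ t, |Y j ω| ^ q) ^ (1 / q)| ^ q = ∑ j ∈ t, |Y j ω| ^ q := fun ω => by
      have : 0 ≤ ∑ j ∈ t, |Y j ω| ^ q := Finset.sum_nonneg fun j _ => by positivity
      rw [abs_of_nonneg (by positivity), one_div, Real.rpow_inv_rpow this hq.ne']
    simp only [e]
    have e2 : ∀ ω, ENNReal.ofReal (∑ j ∈ t, |Y j ω| ^ q)
        = ∑ j ∈ t, ENNReal.ofReal (|Y j ω| ^ q) := fun ω =>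
      ENNReal.ofReal_sum_of_nonneg fun j _ => by positivity
    simp only [e2]
    have hm : ∀ j ∈ t, AEMeasurable (fun ω => ENNReal.ofReal (|Y j ω| ^ q)) μ := fun j hj =>
      ((continuous_abs.measurable.comp_aemeasurable
        (hY j hj).aemeasurable).pow_const q).ennreal_ofReal
    rw [lintegral_finsetSum' t hm]
    have hj : ∀ j ∈ t, ∫⁻ ω, ENNReal.ofReal (|Y j ω| ^ q) ∂μ ≤ ENNReal.ofReal B ^ q :=
      fun j hj => by
        have := hn j hj
        rw [key, one_div, ENNReal.rpow_inv_le_iff hq] at this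
        exact this
    calc (∑ j ∈ t, ∫⁻ ω, ENNReal.ofReal (|Y j ω| ^ q) ∂μ) ^ (1 / q)
        ≤ (∑ _j ∈ t, ENNReal.ofReal B ^ q) ^ (1 / q) := by
          gcongr with j hj'
          exact hj j hj'
      _ = ENNReal.ofReal ((t.card : ℝ) ^ (1 / q) * B) := by
          rw [Finset.sum_const, nsmul_eq_mul, ENNReal.mul_rpow_of_nonneg _ _ (by positivity),
            one_div, ENNReal.rpow_rpow_inv hq.ne', ENNReal.ofReal_mul (by positivity),
            ← ENNReal.ofReal_rpow_of_nonneg (by positivity) (by positivity),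
            ENNReal.ofReal_natCast]

theorem eLpNorm_sq_eq {q : ℝ} (Y : Ω → ℝ) :
    eLpNorm (fun ω => Y ω ^ 2) (ENNReal.ofReal q) μ
      = eLpNorm Y (ENNReal.ofReal (2 * q)) μ ^ 2 := by
  have := eLpNorm_norm_rpow (p := ENNReal.ofReal q) (μ := μ) Y (q := 2) two_pos
  have e : (fun ω => Y ω ^ 2) = fun ω => ‖Y ω‖ ^ (2 : ℝ) := by
    ext ω
    rw [Real.rpow_two, Real.norm_eq_abs, sq_abs]
  rw [e, this, mul_comm (ENNReal.ofReal q), ← ENNReal.ofReal_mul two_pos.le, ENNReal.rpow_two]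

theorem HasMaximalBound.sq {q : ℝ} {s : Set ι} {f : ι → Ω → ℝ} {B : ℝ}
    (h : HasMaximalBound μ (2 * q) s f B) :
    HasMaximalBound μ q s (fun i ω => f i ω ^ 2) (B ^ 2) := by
  obtain ⟨h0, Y, hY, hd, hn⟩ := h
  refine ⟨by positivity, fun ω => Y ω ^ 2, hY.pow 2, fun i hi ω => ?_, ?_⟩
  · change |f i ω ^ 2| ≤ Y ω ^ 2
    rw [abs_of_nonneg (sq_nonneg _), ← sq_abs]
    have := hd i hi ω
    gcongr
  · rw [eLpNorm_sq_eq, ENNReal.ofReal_pow h0]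
    gcongr

/-- Chaining over dyadic blocks turns increment bounds into a bound for the maximum of the
increments, at the price of a logarithmic factor. -/
theorem HasMaximalBound.of_increments {q κ A : ℝ} (hq : 1 ≤ q) (hκ : 1 / q ≤ κ) (hA : 0 ≤ A)
    {S : ℕ → Ω → ℝ} (hS : ∀ i, AEStronglyMeasurable (S i) μ)
    (h : ∀ a m : ℕ, eLpNorm (fun ω => S (a + m) ω - S a ω) (ENNReal.ofReal q) μ
      ≤ ENNReal.ofReal (A * (m : ℝ) ^ κ)) (k a : ℕ) :
    HasMaximalBound μ q {m : ℕ | m ≤ 2 ^ k} (fun m ω => S (a + m) ω - S a ω)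
      (A * (k + 1) * (2 ^ k : ℝ) ^ κ) := by
  have hq0 : 0 < q := by linarith
  have hκ0 : 0 < κ := lt_of_lt_of_le (by positivity) hκ
  induction k generalizing a with
  | zero =>
    have h1 : HasMaximalBound μ q Set.univ (fun (_ : Unit) ω => S (a + 1) ω - S a ω) A :=
      HasMaximalBound.of_eLpNorm (f := fun ω => S (a + 1) ω - S a ω)
        ((hS _).sub (hS _)) hA (by simpa using h a 1) _
    have := h1.of_le (s' := {m : ℕ | m ≤ 2 ^ 0}) (g := fun m ω => S (a + m) ω - S a ω)
      zero_le_one (fun m hm ω => ⟨(), trivial, by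
        have : m ≤ 1 := by simpa using hm
        interval_cases m <;> simp⟩)
    simpa using this
  | succ k ih =>
    have h1 : HasMaximalBound μ q {m : ℕ | m ≤ 2 ^ (k + 1)}
        (fun _ ω => S (a + 2 ^ k) ω - S a ω) (A * (2 ^ k : ℝ) ^ κ) :=
      HasMaximalBound.of_eLpNorm (f := fun ω => S (a + 2 ^ k) ω - S a ω)
        ((hS _).sub (hS _)) (by positivity)
        (by simpa using h a (2 ^ k)) _
    -- The two halves of the block are treated by induction. Their union costs `2^(1/q) ≤ 2^κ`,
    -- exactly the growth allowed for doubling the length; the jump across the first half adds the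
    -- one unit that becomes the logarithmic factor `k + 1`.
    have h2 := HasMaximalBound.of_finset hq0 (Finset.range 2)
      (s := fun _ => {m : ℕ | m ≤ 2 ^ k})
      (f := fun j m ω => S (a + j * 2 ^ k + m) ω - S (a + j * 2 ^ k) ω)
      (B := A * (k + 1) * (2 ^ k : ℝ) ^ κ) (by positivity) (fun j _ => ih (a + j * 2 ^ k))
    have h3 := h2.of_le (s' := {m : ℕ | m ≤ 2 ^ (k + 1)})
      (g := fun m ω => if m ≤ 2 ^ k then S (a + m) ω - S a ω
        else S (a + m) ω - S (a + 2 ^ k) ω) zero_le_one (fun m hm ω => by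
        by_cases hmk : m ≤ 2 ^ k
        · exact ⟨(0, m), ⟨by simp, hmk⟩, by simp [hmk]⟩
        · refine ⟨(1, m - 2 ^ k), ⟨by simp, ?_⟩, ?_⟩
          · have : m ≤ 2 ^ (k + 1) := hm
            change m - 2 ^ k ≤ 2 ^ k
            rw [pow_succ] at this
            omega
          · have e : a + 2 ^ k + (m - 2 ^ k) = a + m := by omega
            simp [hmk, e])
    have h4 : HasMaximalBound μ q {m : ℕ | m ≤ 2 ^ (k + 1)}
        (fun m ω => if m ≤ 2 ^ k then 0 else S (a + 2 ^ k) ω - S a ω)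
        (A * (2 ^ k : ℝ) ^ κ) := by
      have := h1.of_le (s' := {m : ℕ | m ≤ 2 ^ (k + 1)})
        (g := fun m ω => if m ≤ 2 ^ k then 0 else S (a + 2 ^ k) ω - S a ω) zero_le_one
        (fun m hm ω => ⟨m, hm, by split_ifs <;> simp⟩)
      simpa using this
    have h5 := (h3.add hq h4).of_le (s' := {m : ℕ | m ≤ 2 ^ (k + 1)})
      (g := fun m ω => S (a + m) ω - S a ω) zero_le_one (fun m hm ω => ⟨m, hm, by
        split_ifs <;> simp⟩)
    refine h5.mono ?_
    have e1 : (2 : ℝ) ^ (1 / q) ≤ 2 ^ κ := Real.rpow_le_rpow_of_exponent_le one_le_two hκ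
    have e2 : (1 : ℝ) ≤ 2 ^ κ := Real.one_le_rpow one_le_two hκ0.le
    have e3 : ((2 : ℝ) ^ (k + 1)) ^ κ = (2 ^ k : ℝ) ^ κ * 2 ^ κ := by
      rw [pow_succ, Real.mul_rpow (by positivity) (by positivity)]
    have e4 : 0 ≤ A * (2 ^ k : ℝ) ^ κ := by positivity
    rw [e3]
    simp only [Finset.card_range, one_mul]
    push_cast
    calc (2 : ℝ) ^ (1 / q) * (A * (k + 1) * (2 ^ k : ℝ) ^ κ) + A * (2 ^ k : ℝ) ^ κ
        ≤ 2 ^ κ * (A * (k + 1) * (2 ^ k : ℝ) ^ κ) + A * (2 ^ k : ℝ) ^ κ * 2 ^ κ :=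
          add_le_add (mul_le_mul_of_nonneg_right e1 (by positivity))
            (le_mul_of_one_le_right e4 e2)
      _ = _ := by ring

end MaximalBound

/-! ### Telescoping of lagged products -/

section Algebra

/-- A weighted sum of lagged products, written through a telescoping family `pv` with
`a l * z j = v l j - pv (l + 1) j`. -/
theorem sum_lag_mul_eq (a z : ℕ → ℝ) (v pv : ℕ → ℕ → ℝ)
    (h : ∀ l j, 1 ≤ j → a l * z j = v l j - pv (l + 1) j) (n : ℕ) :
    ∑ i ∈ Finset.range n, ∑ l ∈ Finset.range i, a (l + 1) * z (i - l) * z (i + 1)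
      = ∑ j ∈ Finset.range n, z (j + 1) * pv 1 (j + 1)
        + ∑ i ∈ Finset.range n, ∑ l ∈ Finset.range i,
            z (i - l) * (v (l + 1) (i + 1) - pv (l + 1) i)
        - ∑ l ∈ Finset.range n, z (n - l) * pv (l + 1) n := by
  induction n with
  | zero => simp
  | succ n ih =>
    rw [Finset.sum_range_succ, ih, Finset.sum_range_succ (fun j => z (j + 1) * pv 1 (j + 1)),
      Finset.sum_range_succ (fun i => ∑ l ∈ Finset.range i,
            z (i - l) * (v (l + 1) (i + 1) - pv (l + 1) i)),
      Finset.sum_range_succ' (fun l => z (n + 1 - l) * pv (l + 1) (n + 1))]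
    -- In the new row, the `v` parts combine with the old boundary into martingale differences. The
    -- `pv` parts are the new boundary without its `l = 0` term, which is the new drift term.
    have e1 : ∑ l ∈ Finset.range n, a (l + 1) * z (n - l) * z (n + 1)
        = ∑ l ∈ Finset.range n, (z (n - l) * v (l + 1) (n + 1)
          - z (n - l) * pv (l + 1 + 1) (n + 1)) := by
      refine Finset.sum_congr rfl fun l _ => ?_
      rw [← mul_sub, ← h (l + 1) (n + 1) (by omega)]
      ring
    have e2 : ∑ l ∈ Finset.range n, z (n + 1 - (l + 1)) * pv (l + 1 + 1) (n + 1)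
        = ∑ l ∈ Finset.range n, z (n - l) * pv (l + 1 + 1) (n + 1) :=
      Finset.sum_congr rfl fun l _ => by rw [Nat.add_sub_add_right]
    rw [e1, e2]
    simp only [mul_sub, Finset.sum_sub_distrib, Nat.sub_zero, zero_add]
    ring

end Algebra

/-! ### Geometric arrays and martingale approximation of their sums -/

section Array

variable {Ω : Type*} {m0 : MeasurableSpace Ω} {μ : Measure Ω}

theorem HasMaximalBound.eLpNorm_le {ι : Type*} {q : ℝ} {s : Set ι} {f : ι → Ω → ℝ} {B : ℝ}
    (h : HasMaximalBound μ q s f B) {i : ι} (hi : i ∈ s) :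
    eLpNorm (f i) (ENNReal.ofReal q) μ ≤ ENNReal.ofReal B := by
  obtain ⟨_, Y, _, hd, hn⟩ := h
  exact (eLpNorm_mono_real fun ω => hd i hi ω).trans hn

/-- An array `Φ r i` behaving like `P^r f (X_i)` for a geometrically ergodic chain and a centred
function `f`, with domination by a process `W` bounded in `L^q`. -/
structure GeometricArray (μ : Measure Ω) (ℱ : Filtration ℕ m0) (q C ρ B : ℝ) (W : ℕ → Ω → ℝ)
    (Φ : ℕ → ℕ → Ω → ℝ) : Prop where
  rho_pos : 0 < ρ
  rho_lt_one : ρ < 1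
  C_nonneg : 0 ≤ C
  B_nonneg : 0 ≤ B
  adapted : ∀ r i, StronglyMeasurable[ℱ i] (Φ r i)
  condExp : ∀ r i, μ[Φ r (i + 1)|ℱ i] =ᵐ[μ] Φ (r + 1) i
  bound : ∀ r i ω, |Φ r i ω| ≤ C * ρ ^ r * W i ω
  aestronglyMeasurable_W : ∀ i, AEStronglyMeasurable (W i) μ
  W_nonneg : ∀ i ω, 0 ≤ W i ω
  W_norm : ∀ i, eLpNorm (W i) (ENNReal.ofReal q) μ ≤ ENNReal.ofReal B

variable {ℱ : Filtration ℕ m0} {q C ρ B : ℝ} {W : ℕ → Ω → ℝ} {Φ : ℕ → ℕ → Ω → ℝ}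

theorem GeometricArray.hasMaximalBound_W (h : GeometricArray μ ℱ q C ρ B W Φ) {ι : Type*}
    (s : Set ι) (i : ℕ) : HasMaximalBound μ q s (fun _ => W i) B :=
  .of_eLpNorm (h.aestronglyMeasurable_W i) h.B_nonneg (h.W_norm i) s

theorem GeometricArray.aestronglyMeasurable (h : GeometricArray μ ℱ q C ρ B W Φ) (r i : ℕ) :
    AEStronglyMeasurable (Φ r i) μ :=
  ((h.adapted r i).mono (ℱ.le i)).aestronglyMeasurable

theorem GeometricArray.memLp (h : GeometricArray μ ℱ q C ρ B W Φ) (r i : ℕ) :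
    MemLp (Φ r i) (ENNReal.ofReal q) μ :=
  MemLp.of_le_mul ⟨h.aestronglyMeasurable_W i, (h.W_norm i).trans_lt ENNReal.ofReal_lt_top⟩
    (h.aestronglyMeasurable r i) (ae_of_all _ fun ω => by
      rw [Real.norm_of_nonneg (h.W_nonneg i ω)]
      exact h.bound r i ω)

/-- The sum of the first `K` terms of the geometrically decaying family, with weights. -/
theorem GeometricArray.abs_sum_weight_le (h : GeometricArray μ ℱ q C ρ B W Φ) {a : ℕ → ℝ} {A : ℝ}
    (ha : ∀ l, |a l| ≤ A) (K l r₀ i : ℕ) (ω : Ω) :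
    |∑ r ∈ Finset.range K, a (l + r) * Φ (r + r₀) i ω| ≤ A * (C / (1 - ρ)) * W i ω := by
  have hA : 0 ≤ A := (abs_nonneg _).trans (ha 0)
  have hρ := h.rho_lt_one
  have hgeo : ∑ r ∈ Finset.range K, ρ ^ r ≤ (1 - ρ)⁻¹ := by
    rw [← tsum_geometric_of_lt_one h.rho_pos.le hρ]
    exact (summable_geometric_of_lt_one h.rho_pos.le hρ).sum_le_tsum _
      fun r _ => pow_nonneg h.rho_pos.le r
  calc |∑ r ∈ Finset.range K, a (l + r) * Φ (r + r₀) i ω|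
      ≤ ∑ r ∈ Finset.range K, |a (l + r) * Φ (r + r₀) i ω| := Finset.abs_sum_le_sum_abs _ _
    _ ≤ ∑ r ∈ Finset.range K, A * (C * ρ ^ r * W i ω) := by
        refine Finset.sum_le_sum fun r _ => ?_
        rw [abs_mul]
        refine mul_le_mul (ha _) ((h.bound _ _ _).trans ?_) (abs_nonneg _) hA
        have := h.C_nonneg
        have := h.W_nonneg i ω
        have := pow_le_pow_of_le_one h.rho_pos.le hρ.le (Nat.le_add_right r r₀)
        gcongr
    _ = A * C * W i ω * ∑ r ∈ Finset.range K, ρ ^ r := by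
        rw [Finset.mul_sum]
        exact Finset.sum_congr rfl fun r _ => by ring
    _ ≤ A * C * W i ω * (1 - ρ)⁻¹ := by
        have := h.C_nonneg
        have := h.W_nonneg i ω
        gcongr
    _ = _ := by rw [div_eq_mul_inv]; ring

/-- Martingale differences of the weighted potentials of an array. -/
def arrayDiff (Φ : ℕ → ℕ → Ω → ℝ) (a : ℕ → ℝ) (K l : ℕ) : ℕ → Ω → ℝ
  | 0 => fun _ => 0
  | i + 1 => fun ω => ∑ r ∈ Finset.range K, a (l + r) * (Φ r (i + 1) ω - Φ (r + 1) i ω)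

theorem GeometricArray.abs_arrayDiff_le (h : GeometricArray μ ℱ q C ρ B W Φ) {a : ℕ → ℝ} {A : ℝ}
    (ha : ∀ l, |a l| ≤ A) (K l i : ℕ) (ω : Ω) :
    |arrayDiff Φ a K l (i + 1) ω| ≤ A * (C / (1 - ρ)) * (W (i + 1) ω + W i ω) := by
  have h1 := h.abs_sum_weight_le ha K l 0 (i + 1) ω
  have h2 := h.abs_sum_weight_le ha K l 1 i ω
  simp only [add_zero] at h1
  simp only [arrayDiff, mul_sub, Finset.sum_sub_distrib]
  calc _ ≤ _ := abs_sub _ _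
    _ ≤ _ := add_le_add h1 h2
    _ = _ := by ring

theorem GeometricArray.stronglyMeasurable_arrayDiff (h : GeometricArray μ ℱ q C ρ B W Φ)
    (a : ℕ → ℝ) (K l i : ℕ) : StronglyMeasurable[ℱ i] (arrayDiff Φ a K l i) := by
  cases i with
  | zero => exact stronglyMeasurable_const
  | succ i =>
    exact Finset.stronglyMeasurable_fun_sum _ fun r _ => ((h.adapted r (i + 1)).sub
      ((h.adapted (r + 1) i).mono (ℱ.mono i.le_succ))).const_mul _

theorem GeometricArray.memLp_arrayDiff (h : GeometricArray μ ℱ q C ρ B W Φ)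
    (a : ℕ → ℝ) (K l i : ℕ) : MemLp (arrayDiff Φ a K l i) (ENNReal.ofReal q) μ := by
  cases i with
  | zero => exact MemLp.zero
  | succ i => exact memLp_finsetSum _ fun r _ => ((h.memLp _ _).sub (h.memLp _ _)).const_mul _

/-- Each summand is centred separately: `Φ (r + 1) i` is the one-step prediction of `Φ r (i + 1)`.
-/
theorem GeometricArray.condExp_arrayDiff [IsFiniteMeasure μ] (h : GeometricArray μ ℱ q C ρ B W Φ)
    (hq : 1 ≤ q) (a : ℕ → ℝ) (K l i : ℕ) :
    μ[arrayDiff Φ a K l (i + 1)|ℱ i] =ᵐ[μ] 0 := by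
  have hq' : 1 ≤ ENNReal.ofReal q := by simpa using hq
  have hi : ∀ r i, Integrable (Φ r i) μ := fun r i => (h.memLp r i).integrable hq'
  have e : arrayDiff Φ a K l (i + 1)
      = ∑ r ∈ Finset.range K, a (l + r) • (Φ r (i + 1) - Φ (r + 1) i) := by
    ext ω
    simp [arrayDiff, Finset.sum_apply]
  rw [e]
  refine (condExp_finsetSum (fun r _ => ((hi r (i + 1)).sub (hi (r + 1) i)).smul (a (l + r)))
    _).trans ?_
  have : ∀ r, μ[a (l + r) • (Φ r (i + 1) - Φ (r + 1) i)|ℱ i] =ᵐ[μ] 0 := fun r => by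
    have h1 := condExp_smul (μ := μ) (a (l + r)) (Φ r (i + 1) - Φ (r + 1) i) (ℱ i)
    have h2 := condExp_sub (hi r (i + 1)) (hi (r + 1) i) (ℱ i)
    have h3 := condExp_of_stronglyMeasurable (ℱ.le i) (h.adapted (r + 1) i) (hi (r + 1) i)
    filter_upwards [h1, h2, h.condExp r i] with ω h1 h2 h4
    rw [h1, Pi.smul_apply, h2, Pi.sub_apply, h3, h4]
    simp
  have hall := ae_all_iff.2 this
  filter_upwards [hall] with ω hω
  simp [Finset.sum_apply, hω]

/-- Maximal inequality for the partial sums of the array's first row. -/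
theorem GeometricArray.exists_maximalBound_sum [IsFiniteMeasure μ]
    (h : GeometricArray μ ℱ q C ρ B W Φ) (hq : 1 < q) :
    ∃ C' : ℝ, 0 ≤ C' ∧ ∀ k : ℕ, HasMaximalBound μ q {n : ℕ | n ≤ 2 ^ k}
      (fun n ω => ∑ i ∈ Finset.range n, Φ 0 (i + 1) ω)
      (C' * (k + 1) * (2 ^ k : ℝ) ^ max (1 / q) (1 / 2)) := by
  obtain ⟨C₀, hC₀, hmart⟩ := exists_eLpNorm_sum_le hq
  have hq0 : 0 < q := by linarith
  set κ := max (1 / q) (1 / 2) with hκ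
  have hκq : 1 / q ≤ κ := le_max_left _ _
  have hκ0 : 0 < κ := lt_of_lt_of_le (by positivity) hκq
  have hB := h.B_nonneg
  have hC := h.C_nonneg
  have hρ : 0 < 1 - ρ := by linarith [h.rho_lt_one]
  set G := C / (1 - ρ) with hG
  have hG0 : 0 ≤ G := by positivity
  refine ⟨C₀ * (2 * G * B) + C * B + (G * B + 3 * (G * B)), by positivity, fun k => ?_⟩
  -- `K` is so large that `2^k ρ^K < 1`; the truncation errors summed over the whole block are then
  -- `O(1)`.
  obtain ⟨K, hK⟩ := ((tendsto_pow_atTop_nhds_zero_of_lt_one h.rho_pos.le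
    h.rho_lt_one).const_mul (2 ^ k : ℝ)).eventually (gt_mem_nhds (by simp : (2 ^ k : ℝ) * 0 < 1))
    |>.exists
  set D := arrayDiff Φ (fun _ => 1) K 0 with hD
  have habs1 : ∀ l : ℕ, |(fun _ => (1 : ℝ)) l| ≤ 1 := fun l => by simp
  have hDM : ∀ i, eLpNorm (D (i + 1)) (ENNReal.ofReal q) μ ≤ ENNReal.ofReal (2 * G * B) := by
    intro i
    have h1 := ((h.hasMaximalBound_W (Set.univ : Set Unit) (i + 1)).add hq.le
      (h.hasMaximalBound_W Set.univ i)).of_le (s' := (Set.univ : Set Unit))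
      (g := fun _ => D (i + 1)) hG0 (fun _ _ ω => ⟨(), trivial, by
        rw [abs_of_nonneg (add_nonneg (h.W_nonneg _ ω) (h.W_nonneg _ ω))]
        simpa using h.abs_arrayDiff_le habs1 K 0 i ω⟩)
    refine (h1.eLpNorm_le (i := ()) trivial).trans (ENNReal.ofReal_le_ofReal (le_of_eq ?_))
    ring
  have hinc := hmart ℱ D (2 * G * B) (by positivity)
    (fun i => h.stronglyMeasurable_arrayDiff _ K 0 i)
    (fun i => h.condExp_arrayDiff hq.le _ K 0 i) hDM
  have hM := HasMaximalBound.of_increments hq.le hκq (A := C₀ * (2 * G * B)) (by positivity)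
    (S := fun n ω => ∑ i ∈ Finset.range n, D (i + 1) ω)
    (fun n => (Finset.stronglyMeasurable_fun_sum _ fun i _ =>
      (h.stronglyMeasurable_arrayDiff _ K 0 (i + 1)).mono (ℱ.le _)).aestronglyMeasurable)
    (fun a m => by
      refine le_trans (le_of_eq ?_) (hinc a m)
      congr 1
      ext ω
      rw [Finset.sum_range_add, add_sub_cancel_left]) k 0
  simp only [zero_add, Finset.range_zero, Finset.sum_empty, sub_zero] at hM
  -- Predictable part of a truncated solution of the Poisson equation: `Φ 0 (i+1) = D (i+1) + Φ K
  -- (i+1) + (R i - R (i+1))`, so its contribution telescopes.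
  set R : ℕ → Ω → ℝ := fun i ω => ∑ r ∈ Finset.range K, Φ (r + 1) i ω with hR
  have hRle : ∀ i ω, |R i ω| ≤ G * W i ω := fun i ω => by
    simpa using h.abs_sum_weight_le habs1 K 0 1 i ω
  have hRone : ∀ i, HasMaximalBound μ q (Set.univ : Set Unit) (fun _ => R i) (G * B) := fun i =>
    (h.hasMaximalBound_W (Set.univ : Set Unit) i).of_le hG0
      (fun _ _ ω => ⟨(), trivial, by
        rw [abs_of_nonneg (h.W_nonneg _ ω)]
        exact hRle i ω⟩)
  -- A crude union over `2^k + 1` indices suffices, since `1/q ≤ κ`.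
  have hRmax : HasMaximalBound μ q {n : ℕ | n ≤ 2 ^ k} R
      (((2 ^ k + 1 : ℕ) : ℝ) ^ (1 / q) * (G * B)) := by
    have := (HasMaximalBound.of_finset hq0 (Finset.range (2 ^ k + 1))
      (s := fun _ => (Set.univ : Set Unit)) (f := fun i _ => R i) (B := G * B) (by positivity)
      (fun i _ => hRone i)).of_le (s' := {n : ℕ | n ≤ 2 ^ k}) (g := R) zero_le_one
      (fun n hn ω => ⟨(n, ()), ⟨by
        simpa [Nat.lt_succ_iff] using hn, trivial⟩, by simp⟩)
    simpa using this
  have hΦK : HasMaximalBound μ q {n : ℕ | n ≤ 2 ^ k}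
      (fun n ω => ∑ i ∈ Finset.range n, Φ K (i + 1) ω) (C * B) := by
    have hs := HasMaximalBound.finset_sum hq.le (s := (Set.univ : Set Unit))
      (Finset.range (2 ^ k)) (f := fun i _ => W (i + 1)) (B := fun _ => B)
      (fun i _ => h.hasMaximalBound_W _ _)
    have := hs.of_le (s' := {n : ℕ | n ≤ 2 ^ k})
      (g := fun n ω => ∑ i ∈ Finset.range n, Φ K (i + 1) ω) (c := C * ρ ^ K)
      (by have := h.rho_pos; positivity) (fun n hn ω => ⟨(), trivial, by
        rw [abs_of_nonneg (Finset.sum_nonneg fun i _ => h.W_nonneg _ ω), Finset.mul_sum]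
        calc |∑ i ∈ Finset.range n, Φ K (i + 1) ω|
            ≤ ∑ i ∈ Finset.range n, |Φ K (i + 1) ω| := Finset.abs_sum_le_sum_abs _ _
          _ ≤ ∑ i ∈ Finset.range n, C * ρ ^ K * W (i + 1) ω :=
              Finset.sum_le_sum fun i _ => h.bound _ _ _
          _ ≤ _ := by
              refine Finset.sum_le_sum_of_subset_of_nonneg
                (Finset.range_subset_range.2 hn) fun i _ _ => ?_
              have := h.rho_pos
              have := h.W_nonneg (i + 1) ω
              positivity⟩)
    refine this.mono ?_
    rw [Finset.sum_const, Finset.card_range, nsmul_eq_mul]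
    push_cast
    calc C * ρ ^ K * (2 ^ k * B) = C * B * (2 ^ k * ρ ^ K) := by ring
      _ ≤ C * B * 1 := by gcongr
      _ = C * B := mul_one _
  have hR0 : HasMaximalBound μ q {n : ℕ | n ≤ 2 ^ k} (fun _ => R 0) (G * B) := by
    simpa using (hRone 0).of_le (s' := {n : ℕ | n ≤ 2 ^ k}) (g := fun _ => R 0) zero_le_one
      (fun n hn ω => ⟨(), trivial, by simp⟩)
  have hRneg : HasMaximalBound μ q {n : ℕ | n ≤ 2 ^ k} (fun n ω => -R n ω)
      (((2 ^ k + 1 : ℕ) : ℝ) ^ (1 / q) * (G * B)) := by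
    simpa using hRmax.of_le (s' := {n : ℕ | n ≤ 2 ^ k}) (g := fun n ω => -R n ω) zero_le_one
      (fun n hn ω => ⟨n, hn, by simp⟩)
  have hsum := (hM.add hq.le hΦK).add hq.le (hR0.add hq.le hRneg)
  have hident : ∀ (n : ℕ) (ω : Ω), ∑ i ∈ Finset.range n, Φ 0 (i + 1) ω
      = (∑ i ∈ Finset.range n, D (i + 1) ω + ∑ i ∈ Finset.range n, Φ K (i + 1) ω)
        + (R 0 ω + -R n ω) := by
    intro n ω
    have hstep : ∀ i, Φ 0 (i + 1) ω = D (i + 1) ω + Φ K (i + 1) ω + (R i ω - R (i + 1) ω) := by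
      intro i
      have e1 := Finset.sum_range_succ (fun r => Φ r (i + 1) ω) K
      have e2 := Finset.sum_range_succ' (fun r => Φ r (i + 1) ω) K
      simp only [hD, hR, arrayDiff, one_mul, Finset.sum_sub_distrib]
      linarith
    rw [Finset.sum_congr rfl fun i _ => hstep i, Finset.sum_add_distrib, Finset.sum_add_distrib,
      Finset.sum_range_sub']
    ring
  simp only [← hident] at hsum
  refine hsum.mono ?_
  have hN : (1 : ℝ) ≤ 2 ^ k := one_le_pow₀ one_le_two
  have hX : (1 : ℝ) ≤ (2 ^ k : ℝ) ^ κ := Real.one_le_rpow hN hκ0.le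
  have hY : (1 : ℝ) ≤ (k + 1) * (2 ^ k : ℝ) ^ κ := by
    have : (0 : ℝ) ≤ k := Nat.cast_nonneg k
    nlinarith
  have hcard : (((2 ^ k + 1 : ℕ) : ℝ)) ^ (1 / q) ≤ 3 * ((k + 1) * (2 ^ k : ℝ) ^ κ) := by
    calc (((2 ^ k + 1 : ℕ) : ℝ)) ^ (1 / q) ≤ (3 * 2 ^ k : ℝ) ^ (1 / q) := by
          refine Real.rpow_le_rpow (by positivity) ?_ (by positivity)
          push_cast
          linarith
      _ = 3 ^ (1 / q) * (2 ^ k : ℝ) ^ (1 / q) := Real.mul_rpow (by norm_num) (by positivity)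
      _ ≤ 3 ^ (1 : ℝ) * (2 ^ k : ℝ) ^ κ := by
          gcongr
          · norm_num
          · rw [div_le_one hq0]; exact hq.le
      _ ≤ 3 * ((k + 1) * (2 ^ k : ℝ) ^ κ) := by
          rw [Real.rpow_one]
          have : (0 : ℝ) ≤ k := Nat.cast_nonneg k
          nlinarith
  have hGB : 0 ≤ G * B := by positivity
  have hCB : 0 ≤ C * B := by positivity
  have i1 : C * B ≤ C * B * ((k + 1) * (2 ^ k : ℝ) ^ κ) := le_mul_of_one_le_right hCB hY
  have i2 : G * B ≤ G * B * ((k + 1) * (2 ^ k : ℝ) ^ κ) := le_mul_of_one_le_right hGB hY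
  have i3 := mul_le_mul_of_nonneg_right hcard hGB
  calc _ ≤ C₀ * (2 * G * B) * (k + 1) * (2 ^ k : ℝ) ^ κ + C * B * ((k + 1) * (2 ^ k : ℝ) ^ κ)
        + (G * B * ((k + 1) * (2 ^ k : ℝ) ^ κ) + 3 * ((k + 1) * (2 ^ k : ℝ) ^ κ) * (G * B)) := by
        gcongr
    _ = _ := by ring

end Array

/-! ### The martingale part of the lagged products -/

section Quadratic

variable {Ω : Type*} {m0 : MeasurableSpace Ω} {μ : Measure Ω}
  {ℱ : Filtration ℕ m0} {p C ρ B : ℝ} {W : ℕ → Ω → ℝ} {Φ : ℕ → ℕ → Ω → ℝ}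

/-- `xy ≤ (x² + y²)/2`, and squaring passes from `L^{2p}` to `L^p`. -/
theorem GeometricArray.hasMaximalBound_W_mul (h : GeometricArray μ ℱ (2 * p) C ρ B W Φ)
    (hp : 1 ≤ p) {ι : Type*} (s : Set ι) (i j : ℕ) :
    HasMaximalBound μ p s (fun _ ω => W i ω * W j ω) (B ^ 2) := by
  have h1 := (h.hasMaximalBound_W s i).sq
  have h2 := (h.hasMaximalBound_W s j).sq
  have h3 := (h1.add hp h2).of_le (s' := s) (g := fun _ ω => W i ω * W j ω)
    (c := 1 / 2) (by norm_num) (fun x hx ω => ⟨x, hx, by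
      rw [abs_of_nonneg (mul_nonneg (h.W_nonneg i ω) (h.W_nonneg j ω)),
        abs_of_nonneg (add_nonneg (sq_nonneg _) (sq_nonneg _))]
      nlinarith [sq_nonneg (W i ω - W j ω)]⟩)
  exact h3.mono (by ring_nf; rfl)

/-- Martingale differences of the centred weighted sums of lagged products. -/
def quadDiff (Φ : ℕ → ℕ → Ω → ℝ) (a : ℕ → ℝ) (K : ℕ) : ℕ → Ω → ℝ
  | 0 => fun _ => 0
  | i + 1 => fun ω => ∑ l ∈ Finset.range i, Φ 0 (i - l) ω * arrayDiff Φ a K (l + 1) (i + 1) ω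

/-- The martingale part of the weighted sum of lagged products. -/
def quadMartingale (Φ : ℕ → ℕ → Ω → ℝ) (a : ℕ → ℝ) (K n : ℕ) (ω : Ω) : ℝ :=
  ∑ i ∈ Finset.range n, quadDiff Φ a K (i + 1) ω

theorem arrayDiff_sub (a a' : ℕ → ℝ) (K l i : ℕ) (ω : Ω) :
    arrayDiff Φ (fun l => a l - a' l) K l i ω
      = arrayDiff Φ a K l i ω - arrayDiff Φ a' K l i ω := by
  cases i with
  | zero => simp [arrayDiff]
  | succ i => simp [arrayDiff, sub_mul, Finset.sum_sub_distrib]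

/-- Linearity in the weights is what allows weights that change with `n` to be handled by
telescoping. -/
theorem quadMartingale_sub (a a' : ℕ → ℝ) (K n : ℕ) (ω : Ω) :
    quadMartingale Φ (fun l => a l - a' l) K n ω
      = quadMartingale Φ a K n ω - quadMartingale Φ a' K n ω := by
  simp only [quadMartingale, quadDiff, arrayDiff_sub, mul_sub, Finset.sum_sub_distrib]

theorem GeometricArray.stronglyMeasurable_quadDiff
    (h : GeometricArray μ ℱ (2 * p) C ρ B W Φ) (a : ℕ → ℝ) (K i : ℕ) :
    StronglyMeasurable[ℱ i] (quadDiff Φ a K i) := by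
  cases i with
  | zero => exact stronglyMeasurable_const
  | succ i =>
    exact Finset.stronglyMeasurable_fun_sum _ fun l _ =>
      ((h.adapted 0 (i - l)).mono (ℱ.mono (by omega))).mul
        (h.stronglyMeasurable_arrayDiff a K (l + 1) (i + 1))

/-- The earlier factor `Φ 0 (i - l)` belongs to the past and is pulled out; `2p ≥ 2` makes the
products integrable. -/
theorem GeometricArray.condExp_quadDiff [IsFiniteMeasure μ]
    (h : GeometricArray μ ℱ (2 * p) C ρ B W Φ) (hp : 1 ≤ p) (a : ℕ → ℝ) (K i : ℕ) :
    μ[quadDiff Φ a K (i + 1)|ℱ i] =ᵐ[μ] 0 := by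
  have h2p : (2 : ℝ≥0∞) ≤ ENNReal.ofReal (2 * p) := by
    rw [← ENNReal.ofReal_ofNat]
    exact ENNReal.ofReal_le_ofReal (by linarith)
  have hDi : ∀ l, Integrable (arrayDiff Φ a K (l + 1) (i + 1)) μ := fun l =>
    (h.memLp_arrayDiff a K (l + 1) (i + 1)).integrable (le_trans (by norm_num) h2p)
  have hi : ∀ l, Integrable (Φ 0 (i - l) * arrayDiff Φ a K (l + 1) (i + 1)) μ := fun l =>
    MemLp.integrable_mul ((h.memLp 0 (i - l)).mono_exponent h2p)
      ((h.memLp_arrayDiff a K (l + 1) (i + 1)).mono_exponent h2p)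
  have e : quadDiff Φ a K (i + 1)
      = ∑ l ∈ Finset.range i, Φ 0 (i - l) * arrayDiff Φ a K (l + 1) (i + 1) := by
    ext ω
    simp [quadDiff, Finset.sum_apply]
  rw [e]
  refine (condExp_finsetSum (fun l _ => hi l) _).trans ?_
  have hl : ∀ l, μ[Φ 0 (i - l) * arrayDiff Φ a K (l + 1) (i + 1)|ℱ i] =ᵐ[μ] 0 := fun l => by
    have h1 := condExp_mul_of_stronglyMeasurable_left
      ((h.adapted 0 (i - l)).mono (ℱ.mono (Nat.sub_le i l))) (hi l) (hDi l)
    filter_upwards [h1, h.condExp_arrayDiff (by linarith) a K (l + 1) i] with ω h1 h2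
    rw [h1, Pi.mul_apply, h2]
    simp
  filter_upwards [ae_all_iff.2 hl] with ω hω
  simp [Finset.sum_apply, hω]

/-- Lags `l ≥ K` drop out because only weights beyond the cut-off occur there. Each of the at most
`K` remaining products is bounded in `L^p`, whence the factor `K`. -/
theorem GeometricArray.eLpNorm_quadDiff_le
    (h : GeometricArray μ ℱ (2 * p) C ρ B W Φ) (hp : 1 ≤ p) {a : ℕ → ℝ} {A : ℝ}
    (ha : ∀ l, |a l| ≤ A) {K : ℕ} (haK : ∀ l, K ≤ l → a l = 0) (i : ℕ) :
    eLpNorm (quadDiff Φ a K (i + 1)) (ENNReal.ofReal p) μ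
      ≤ ENNReal.ofReal (2 * C * (C / (1 - ρ)) * B ^ 2 * (A * K)) := by
  have hA : 0 ≤ A := (abs_nonneg _).trans (ha 0)
  have hC := h.C_nonneg
  have hρ : 0 < 1 - ρ := by linarith [h.rho_lt_one]
  have hterm : ∀ l ∈ Finset.range K, HasMaximalBound μ p (Set.univ : Set Unit)
      (fun _ ω => W (i - l) ω * W (i + 1) ω + W (i - l) ω * W i ω) (B ^ 2 + B ^ 2) :=
    fun l _ => (h.hasMaximalBound_W_mul hp _ _ _).add hp (h.hasMaximalBound_W_mul hp _ _ _)
  have hpos : ∀ l ω, 0 ≤ W (i - l) ω * W (i + 1) ω + W (i - l) ω * W i ω := fun l ω => by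
    have := h.W_nonneg (i - l) ω
    have := h.W_nonneg (i + 1) ω
    have := h.W_nonneg i ω
    positivity
  have hs := (HasMaximalBound.finset_sum hp (Finset.range K) hterm).of_le
    (s' := (Set.univ : Set Unit)) (g := fun _ => quadDiff Φ a K (i + 1))
    (c := C * (A * (C / (1 - ρ)))) (by positivity) (fun _ _ ω => ⟨(), trivial, by
      have hzero : ∀ l, ¬ l < K → arrayDiff Φ a K (l + 1) (i + 1) ω = 0 := fun l hl => by
        refine Finset.sum_eq_zero fun r _ => ?_
        rw [haK _ (by omega), zero_mul]
      have hle : ∀ l, |Φ 0 (i - l) ω * arrayDiff Φ a K (l + 1) (i + 1) ω|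
          ≤ C * (A * (C / (1 - ρ))) * (W (i - l) ω * W (i + 1) ω + W (i - l) ω * W i ω) := by
        intro l
        have h1 := h.bound 0 (i - l) ω
        rw [pow_zero, mul_one] at h1
        rw [abs_mul]
        refine (mul_le_mul h1 (h.abs_arrayDiff_le ha K (l + 1) i ω) (abs_nonneg _)
          ((abs_nonneg _).trans h1)).trans (le_of_eq ?_)
        ring
      rw [abs_of_nonneg (Finset.sum_nonneg fun l _ => hpos l ω), Finset.mul_sum]
      calc |quadDiff Φ a K (i + 1) ω|
          ≤ ∑ l ∈ Finset.range i, |Φ 0 (i - l) ω * arrayDiff Φ a K (l + 1) (i + 1) ω| :=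
            Finset.abs_sum_le_sum_abs _ _
        _ = ∑ l ∈ Finset.range i with l < K,
              |Φ 0 (i - l) ω * arrayDiff Φ a K (l + 1) (i + 1) ω| := by
            rw [Finset.sum_filter_of_ne]
            intro l _ hne
            by_contra hl
            exact hne (by rw [hzero l hl, mul_zero, abs_zero])
        _ ≤ ∑ l ∈ Finset.range K, |Φ 0 (i - l) ω * arrayDiff Φ a K (l + 1) (i + 1) ω| := by
            refine Finset.sum_le_sum_of_subset_of_nonneg (fun l hl => ?_) fun _ _ _ => abs_nonneg _
            exact Finset.mem_range.2 (Finset.mem_filter.1 hl).2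
        _ ≤ _ := Finset.sum_le_sum fun l _ => hle l⟩)
  refine (hs.eLpNorm_le (i := ()) trivial).trans (ENNReal.ofReal_le_ofReal (le_of_eq ?_))
  rw [Finset.sum_const, Finset.card_range, nsmul_eq_mul]
  ring

/-- Maximal inequality for the martingale part of the weighted sums of lagged products. -/
theorem GeometricArray.exists_maximalBound_quadMartingale [IsFiniteMeasure μ]
    (h : GeometricArray μ ℱ (2 * p) C ρ B W Φ) (hp : 1 < p) :
    ∃ C' : ℝ, 0 ≤ C' ∧ ∀ (a : ℕ → ℝ) (A : ℝ) (K k : ℕ), (∀ l, |a l| ≤ A) →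
      (∀ l, K ≤ l → a l = 0) →
      HasMaximalBound μ p {n : ℕ | n ≤ 2 ^ k} (quadMartingale Φ a K)
        (C' * (k + 1) * (2 ^ k : ℝ) ^ max (1 / p) (1 / 2) * K * A) := by
  obtain ⟨C₀, hC₀, hmart⟩ := exists_eLpNorm_sum_le hp
  have hC := h.C_nonneg
  have hρ : 0 < 1 - ρ := by linarith [h.rho_lt_one]
  refine ⟨C₀ * (2 * C * (C / (1 - ρ)) * B ^ 2), by positivity, fun a A K k ha haK => ?_⟩
  have hA : 0 ≤ A := (abs_nonneg _).trans (ha 0)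
  have hinc := hmart ℱ (quadDiff Φ a K) (2 * C * (C / (1 - ρ)) * B ^ 2 * (A * K))
    (by positivity) (h.stronglyMeasurable_quadDiff a K) (h.condExp_quadDiff hp.le a K)
    (h.eLpNorm_quadDiff_le hp.le ha haK)
  have hM := HasMaximalBound.of_increments hp.le (le_max_left (1 / p) (1 / 2))
    (A := C₀ * (2 * C * (C / (1 - ρ)) * B ^ 2 * (A * K))) (by positivity)
    (S := quadMartingale Φ a K)
    (fun n => (Finset.stronglyMeasurable_fun_sum _ fun i _ =>
      (h.stronglyMeasurable_quadDiff a K (i + 1)).mono (ℱ.le _)).aestronglyMeasurable)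
    (fun a' m => by
      refine le_trans (le_of_eq ?_) (hinc a' m)
      congr 1
      ext ω
      rw [quadMartingale, quadMartingale, Finset.sum_range_add, add_sub_cancel_left]) k 0
  simp only [zero_add] at hM
  have hM' := hM.of_le (s' := {n : ℕ | n ≤ 2 ^ k}) (g := quadMartingale Φ a K) zero_le_one
    (fun n hn ω => ⟨n, hn, by simp [quadMartingale]⟩)
  refine hM'.mono (le_of_eq ?_)
  ring

end Quadratic

/-! ### Reduction of the estimator to lagged products of centred variables -/

section EstimatorAlgebra

theorem sum_Icc_neg_of_even {f : ℤ → ℝ} (hf : ∀ k, f (-k) = f k) (n : ℕ) :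
    ∑ k ∈ Finset.Icc (-(n : ℤ)) n, f k = f 0 + 2 * ∑ k ∈ Finset.range n, f ((k + 1 : ℕ) : ℤ) := by
  induction n with
  | zero => simp
  | succ n ih =>
    have e : Finset.Icc (-((n + 1 : ℕ) : ℤ)) ((n + 1 : ℕ) : ℤ)
        = insert (-((n + 1 : ℕ) : ℤ)) (insert (((n + 1 : ℕ) : ℤ)) (Finset.Icc (-(n : ℤ)) n)) := by
      ext k
      simp only [Finset.mem_Icc, Finset.mem_insert]
      omega
    rw [e, Finset.sum_insert, Finset.sum_insert, ih, Finset.sum_range_succ, hf]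
    · ring
    · simp
    · simp only [Finset.mem_Icc, Finset.mem_insert]
      omega

/-- Reorders the sum by the later time `i + 1`, as the martingale decomposition requires. -/
theorem sum_lag_comm (a z : ℕ → ℝ) (n : ℕ) :
    ∑ l ∈ Finset.range n, a (l + 1) * ∑ j ∈ Finset.range (n - (l + 1)), z (j + 1) * z (j + 1 + (l + 1))
      = ∑ i ∈ Finset.range n, ∑ l ∈ Finset.range i, a (l + 1) * z (i - l) * z (i + 1) := by
  induction n with
  | zero => simp
  | succ n ih =>
    rw [Finset.sum_range_succ, Finset.sum_range_succ (fun i => ∑ l ∈ Finset.range i, _), ← ih,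
      ← Finset.sum_add_distrib]
    simp only [Nat.sub_self, Finset.range_zero, Finset.sum_empty, mul_zero, add_zero]
    refine Finset.sum_congr rfl fun l hl => ?_
    have hl' := Finset.mem_range.1 hl
    rw [show n + 1 - (l + 1) = (n - (l + 1)) + 1 by omega, Finset.sum_range_succ,
      show n - (l + 1) + 1 = n - l by omega, show n - l + (l + 1) = n + 1 by omega]
    ring

variable {Ω E : Type*} {h : E → ℝ} {X : ℕ → Ω → E} {ω : Ω} {e : ℝ} {z : ℕ → ℝ} {n : ℕ}

theorem sampleMean_sub (hz : ∀ j, z j = h (X j ω) - e) (hn : 1 ≤ n) :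
    sampleMean h X n ω - e = (1 / (n : ℝ)) * ∑ j ∈ Finset.range n, z (j + 1) := by
  have hn' : (n : ℝ) ≠ 0 := by positivity
  have e1 : ∑ j ∈ Finset.Icc 1 n, h (X j ω) = ∑ j ∈ Finset.range n, h (X (j + 1) ω) := by
    rw [Finset.range_eq_Ico, Finset.sum_Ico_add' (fun j => h (X j ω)) 0 n 1]
    rfl
  rw [sampleMean, e1]
  simp only [hz, Finset.sum_sub_distrib, Finset.sum_const, Finset.card_range, nsmul_eq_mul]
  field_simp

theorem sampleAutocov_natCast (hz : ∀ j, z j = h (X j ω) - e) {k : ℕ} (hk : k < n) :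
    sampleAutocov h X n k ω = (1 / (n : ℝ)) * ∑ j ∈ Finset.range (n - k),
      (z (j + 1) - (sampleMean h X n ω - e)) * (z (j + 1 + k) - (sampleMean h X n ω - e)) := by
  rw [sampleAutocov, Int.natAbs_natCast, if_neg (by omega)]
  congr 1
  rw [Finset.range_eq_Ico, Finset.sum_Ico_add' (fun j =>
    (z j - (sampleMean h X n ω - e)) * (z (j + k) - (sampleMean h X n ω - e))) 0 (n - k) 1]
  refine Finset.sum_congr rfl fun j _ => ?_
  simp only [hz]
  ring

/-- The error `m` of the sample mean satisfies `|m| ≤ T/n`. After expansion, the cross terms are `m`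
times a combination of three partial sums, at most `3T²/n`, and the square term is at most `T²/n`;
dividing by `n` gives the constant 4. -/
theorem abs_sampleAutocov_sub_le (hz : ∀ j, z j = h (X j ω) - e) {k : ℕ} (hk : k < n) {T : ℝ}
    (hT : ∀ m ≤ n, |∑ j ∈ Finset.range m, z (j + 1)| ≤ T) :
    |sampleAutocov h X n k ω
      - (1 / (n : ℝ)) * ∑ j ∈ Finset.range (n - k), z (j + 1) * z (j + 1 + k)|
      ≤ 4 * T ^ 2 / (n : ℝ) ^ 2 := by
  have hn : 1 ≤ n := by omega
  have hn' : (0 : ℝ) < n := by exact_mod_cast hn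
  have hT0 : 0 ≤ T := (abs_nonneg _).trans (hT 0 (by omega))
  rw [sampleAutocov_natCast hz hk]
  set m := sampleMean h X n ω - e with hm
  have hmT : |m| ≤ T / n := by
    rw [hm, sampleMean_sub hz hn, abs_mul, abs_of_pos (by positivity : (0 : ℝ) < 1 / n),
      div_mul_eq_mul_div, one_mul]
    gcongr
    exact hT n le_rfl
  set S : ℕ → ℝ := fun m => ∑ j ∈ Finset.range m, z (j + 1) with hS
  have hshift : ∑ j ∈ Finset.range (n - k), z (j + 1 + k) = S n - S k := by
    have := Finset.sum_range_add (fun j => z (j + 1)) k (n - k)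
    rw [show k + (n - k) = n by omega] at this
    simp only [hS]
    rw [this, add_sub_cancel_left]
    exact Finset.sum_congr rfl fun j _ => by congr 1; omega
  have hexp : ∑ j ∈ Finset.range (n - k), (z (j + 1) - m) * (z (j + 1 + k) - m)
      = ∑ j ∈ Finset.range (n - k), z (j + 1) * z (j + 1 + k)
        - m * (S (n - k) + (S n - S k)) + ((n - k : ℕ) : ℝ) * m ^ 2 := by
    rw [← hshift]
    simp only [hS, sub_mul, mul_sub, Finset.sum_sub_distrib, Finset.sum_const, Finset.card_range,
      nsmul_eq_mul, ← Finset.sum_mul, ← Finset.mul_sum]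
    ring
  rw [hexp]
  have e1 : (1 / (n : ℝ)) * (∑ j ∈ Finset.range (n - k), z (j + 1) * z (j + 1 + k)
        - m * (S (n - k) + (S n - S k)) + ((n - k : ℕ) : ℝ) * m ^ 2)
      - (1 / (n : ℝ)) * ∑ j ∈ Finset.range (n - k), z (j + 1) * z (j + 1 + k)
      = (1 / (n : ℝ)) * (-(m * (S (n - k) + (S n - S k))) + ((n - k : ℕ) : ℝ) * m ^ 2) := by ring
  rw [e1, abs_mul, abs_of_pos (by positivity : (0 : ℝ) < 1 / n)]
  have b1 : |S (n - k) + (S n - S k)| ≤ 3 * T := by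
    have h1 := abs_le.1 (hT (n - k) (by omega))
    have h2 := abs_le.1 (hT n le_rfl)
    have h3 := abs_le.1 (hT k hk.le)
    rw [abs_le]
    constructor <;> simp only [hS] <;> linarith
  have b2 : |m * (S (n - k) + (S n - S k))| ≤ T / n * (3 * T) := by
    rw [abs_mul]
    gcongr
  have b3 : |((n - k : ℕ) : ℝ) * m ^ 2| ≤ n * (T / n) ^ 2 := by
    rw [abs_of_nonneg (by positivity), ← sq_abs m]
    gcongr
    omega
  calc (1 / (n : ℝ)) * |-(m * (S (n - k) + (S n - S k))) + ((n - k : ℕ) : ℝ) * m ^ 2|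
      ≤ (1 / (n : ℝ)) * (T / n * (3 * T) + n * (T / n) ^ 2) := by
        gcongr
        refine (abs_add_le _ _).trans (add_le_add ?_ b3)
        rwa [abs_neg]
    _ = 4 * T ^ 2 / (n : ℝ) ^ 2 := by
        field_simp
        ring

/-- Replacing the sample mean by the true mean changes the estimator by a controlled amount. -/
theorem abs_kernelEstimator_sub_le {w : ℝ → ℝ} {b : ℕ → ℝ} {L : ℝ} {K : ℕ}
    (heven : ∀ x, w (-x) = w x) (hL : ∀ l : ℕ, |w (l * b n)| ≤ L) (hK : 1 ≤ K)
    (hwK : ∀ l : ℕ, K ≤ l → w (l * b n) = 0) (h0 : w 0 = 1)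
    (hz : ∀ j, z j = h (X j ω) - e) (hn : 1 ≤ n) {T : ℝ}
    (hT : ∀ m ≤ n, |∑ j ∈ Finset.range m, z (j + 1)| ≤ T) :
    |kernelEstimator w b h X n ω - (1 / (n : ℝ)) * (∑ j ∈ Finset.range n, z (j + 1) ^ 2
      + 2 * ∑ i ∈ Finset.range n, ∑ l ∈ Finset.range i,
        w ((l + 1 : ℕ) * b n) * z (i - l) * z (i + 1))| ≤ 12 * K * L * T ^ 2 / (n : ℝ) ^ 2 := by
  have hn' : (0 : ℝ) < n := by exact_mod_cast hn
  have hL0 : 0 ≤ L := (abs_nonneg _).trans (hL 0)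
  set R : ℕ → ℝ := fun k => (1 / (n : ℝ)) * ∑ j ∈ Finset.range (n - k), z (j + 1) * z (j + 1 + k)
    with hR
  have hest : kernelEstimator w b h X n ω = sampleAutocov h X n ((0 : ℕ) : ℤ) ω
      + 2 * ∑ k ∈ Finset.range n, w ((k + 1 : ℕ) * b n) * sampleAutocov h X n ((k + 1 : ℕ) : ℤ) ω := by
    rw [kernelEstimator, sum_Icc_neg_of_even (fun k => by
      have : sampleAutocov h X n (-k) ω = sampleAutocov h X n k ω := by
        simp only [sampleAutocov, Int.natAbs_neg]
      rw [this]
      push_cast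
      rw [neg_mul, heven])]
    simp [h0]
  have hsum : (1 / (n : ℝ)) * (∑ j ∈ Finset.range n, z (j + 1) ^ 2
      + 2 * ∑ i ∈ Finset.range n, ∑ l ∈ Finset.range i,
        w ((l + 1 : ℕ) * b n) * z (i - l) * z (i + 1))
      = R 0 + 2 * ∑ k ∈ Finset.range n, w ((k + 1 : ℕ) * b n) * R (k + 1) := by
    rw [← sum_lag_comm (fun l => w (l * b n)) z n]
    simp only [hR, Nat.sub_zero, add_zero, mul_add, Finset.mul_sum, sq]
    congr 1
    refine Finset.sum_congr rfl fun k _ => Finset.sum_congr rfl fun j _ => ?_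
    ring
  rw [hest, hsum]
  set D := 4 * T ^ 2 / (n : ℝ) ^ 2 with hD
  have hD0 : 0 ≤ D := by positivity
  have hterm : ∀ k ∈ Finset.range n,
      |w ((k + 1 : ℕ) * b n) * (sampleAutocov h X n ((k + 1 : ℕ) : ℤ) ω - R (k + 1))|
        ≤ if k < K then L * D else 0 := by
    intro k hk
    have hk' := Finset.mem_range.1 hk
    split_ifs with hkK
    · rw [abs_mul]
      refine mul_le_mul (hL (k + 1)) ?_ (abs_nonneg _) hL0
      rcases Nat.lt_or_ge (k + 1) n with h1 | h1
      · exact abs_sampleAutocov_sub_le hz h1 hT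
      -- The extreme lag `k + 1 = n`: both autocovariances are zero.
      · have e2 : n - (k + 1) = 0 := by omega
        have e3 : sampleAutocov h X n ((k + 1 : ℕ) : ℤ) ω = 0 := by
          rw [sampleAutocov, if_pos (by rw [Int.natAbs_natCast]; exact h1)]
        simp only [hR, e2, e3]
        simpa using hD0
    · rw [hwK (k + 1) (by omega), zero_mul, abs_zero]
  -- With `K ≥ 1`, this lets `K L D` absorb the lag-zero error; the three copies give the constant
  -- 12.
  have h1L : 1 ≤ L := by
    have := hL 0
    simpa [h0] using this
  have hcount : ∑ k ∈ Finset.range n, (if k < K then L * D else 0) ≤ K * (L * D) := by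
    rw [← Finset.sum_filter, Finset.sum_const, nsmul_eq_mul]
    gcongr
    calc (Finset.filter (fun k => k < K) (Finset.range n)).card ≤ (Finset.range K).card :=
          Finset.card_le_card fun k hk => Finset.mem_range.2 (Finset.mem_filter.1 hk).2
      _ = K := Finset.card_range K
  have hdiff : sampleAutocov h X n ((0 : ℕ) : ℤ) ω
      + 2 * ∑ k ∈ Finset.range n, w ((k + 1 : ℕ) * b n) * sampleAutocov h X n ((k + 1 : ℕ) : ℤ) ω
      - (R 0 + 2 * ∑ k ∈ Finset.range n, w ((k + 1 : ℕ) * b n) * R (k + 1))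
      = (sampleAutocov h X n ((0 : ℕ) : ℤ) ω - R 0) + 2 * ∑ k ∈ Finset.range n,
        w ((k + 1 : ℕ) * b n) * (sampleAutocov h X n ((k + 1 : ℕ) : ℤ) ω - R (k + 1)) := by
    simp only [mul_sub, Finset.sum_sub_distrib]
    ring
  rw [hdiff]
  have b0 : |sampleAutocov h X n ((0 : ℕ) : ℤ) ω - R 0| ≤ D :=
    abs_sampleAutocov_sub_le hz (by omega) hT
  have hK1 : (1 : ℝ) ≤ K := by exact_mod_cast hK
  calc _ ≤ |sampleAutocov h X n ((0 : ℕ) : ℤ) ω - R 0| + |2 * ∑ k ∈ Finset.range n,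
        w ((k + 1 : ℕ) * b n) * (sampleAutocov h X n ((k + 1 : ℕ) : ℤ) ω - R (k + 1))| :=
        abs_add_le _ _
    _ ≤ D + 2 * (K * (L * D)) := by
        refine add_le_add b0 ?_
        rw [abs_mul, abs_two]
        gcongr
        exact (Finset.abs_sum_le_sum_abs _ _).trans ((Finset.sum_le_sum hterm).trans hcount)
    _ ≤ K * (L * D) + 2 * (K * (L * D)) := by
        have : 1 * (1 * D) ≤ K * (L * D) := by gcongr
        linarith
    _ = _ := by rw [hD]; ring

end EstimatorAlgebra

/-! ### Drift, martingale and boundary terms over a dyadic block -/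

section Blocks

variable {Ω : Type*} {m0 : MeasurableSpace Ω} {μ : Measure Ω}
  {ℱ : Filtration ℕ m0} {p C ρ B : ℝ} {W : ℕ → Ω → ℝ} {Φ : ℕ → ℕ → Ω → ℝ}

/-- The predictable part of the weighted potential of an array. -/
def lagPotential (Φ : ℕ → ℕ → Ω → ℝ) (a : ℕ → ℝ) (K l j : ℕ) (ω : Ω) : ℝ :=
  ∑ r ∈ Finset.range K, a (l + r) * Φ (r + 1) j ω

theorem lagPotential_eq_zero {a : ℕ → ℝ} {K l : ℕ} (haK : ∀ l, K ≤ l → a l = 0) (hl : K ≤ l)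
    (j : ℕ) (ω : Ω) : lagPotential Φ a K l j ω = 0 :=
  Finset.sum_eq_zero fun r _ => by rw [haK _ (by omega), zero_mul]

/-- Truncating the potentials after `K` terms loses nothing: the leftover term carries the weight `a
(l + K) = 0`. -/
theorem sum_lag_mul_eq_quadMartingale {a : ℕ → ℝ} {K : ℕ} (haK : ∀ l, K ≤ l → a l = 0)
    (n : ℕ) (ω : Ω) :
    ∑ i ∈ Finset.range n, ∑ l ∈ Finset.range i, a (l + 1) * Φ 0 (i - l) ω * Φ 0 (i + 1) ω
      = ∑ j ∈ Finset.range n, Φ 0 (j + 1) ω * lagPotential Φ a K 1 (j + 1) ω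
        + quadMartingale Φ a K n ω
        - ∑ l ∈ Finset.range n, Φ 0 (n - l) ω * lagPotential Φ a K (l + 1) n ω := by
  rw [sum_lag_mul_eq a (fun j => Φ 0 j ω)
    (fun l j => ∑ r ∈ Finset.range K, a (l + r) * Φ r j ω)
    (fun l j => lagPotential Φ a K l j ω)]
  · congr 2
    simp only [quadMartingale, quadDiff, arrayDiff, lagPotential, mul_sub,
      Finset.sum_sub_distrib]
  · intro l j _
    have e1 := Finset.sum_range_succ (fun r => a (l + r) * Φ r j ω) K
    have e2 := Finset.sum_range_succ' (fun r => a (l + r) * Φ r j ω) K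
    rw [haK (l + K) (by omega), zero_mul, add_zero] at e1
    rw [e1] at e2
    have e3 : ∑ r ∈ Finset.range K, a (l + (r + 1)) * Φ (r + 1) j ω
        = lagPotential Φ a K (l + 1) j ω :=
      Finset.sum_congr rfl fun r _ => by rw [show l + (r + 1) = l + 1 + r by omega]
    rw [e2, e3, add_zero, add_sub_cancel_left]

theorem GeometricArray.summable (h : GeometricArray μ ℱ (2 * p) C ρ B W Φ) (j : ℕ) (ω : Ω) :
    Summable fun r : ℕ => Φ (r + 1) j ω := by
  refine Summable.of_norm_bounded (g := fun r : ℕ => C * ρ ^ r * W j ω)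
    (((summable_geometric_of_lt_one h.rho_pos.le h.rho_lt_one).mul_left C).mul_right _)
    fun r => (h.bound (r + 1) j ω).trans ?_
  have := h.C_nonneg
  have := h.W_nonneg j ω
  have := pow_le_pow_of_le_one h.rho_pos.le h.rho_lt_one.le r.le_succ
  gcongr

/-- The bias caused by weights `a` that are close to one for small lags. -/
theorem GeometricArray.exists_bias_bound (h : GeometricArray μ ℱ (2 * p) C ρ B W Φ) :
    ∃ G : ℝ, 0 ≤ G ∧ ∀ (a : ℕ → ℝ) (K : ℕ) (t : ℝ), 0 ≤ t → (∀ l, K ≤ l → a l = 0) →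
      (∀ l : ℕ, |a l - 1| ≤ t * l) → ∀ (j : ℕ) (ω : Ω),
      |lagPotential Φ a K 1 j ω - ∑' r : ℕ, Φ (r + 1) j ω| ≤ G * t * W j ω := by
  have hC := h.C_nonneg
  have hρ := h.rho_pos
  -- Weight errors growing linearly in the lag are summable against the geometric decay, so the bias
  -- is linear in `t`.
  have hs : Summable fun r : ℕ => ((r + 1 : ℕ) : ℝ) * ρ ^ (r + 1) := by
    have := summable_pow_mul_geometric_of_norm_lt_one 1
      (r := ρ) (by rw [Real.norm_of_nonneg hρ.le]; exact h.rho_lt_one)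
    simp only [pow_one] at this
    exact (summable_nat_add_iff (f := fun n : ℕ => (n : ℝ) * ρ ^ n) 1).2 this
  refine ⟨C * ∑' r : ℕ, ((r + 1 : ℕ) : ℝ) * ρ ^ (r + 1),
    mul_nonneg hC (tsum_nonneg fun r => by positivity), fun a K t ht haK ha j ω => ?_⟩
  have hpot : lagPotential Φ a K 1 j ω = ∑' r : ℕ, a (1 + r) * Φ (r + 1) j ω :=
    (tsum_eq_sum fun r hr => by
      rw [haK _ (by have := Finset.mem_range.not.1 hr; omega), zero_mul]).symm
  have hsa : Summable fun r : ℕ => a (1 + r) * Φ (r + 1) j ω :=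
    summable_of_ne_finset_zero (s := Finset.range K) fun r hr => by
      rw [haK _ (by have := Finset.mem_range.not.1 hr; omega), zero_mul]
  rw [hpot, ← hsa.tsum_sub (h.summable j ω)]
  have hb := tsum_of_norm_bounded
    (f := fun r : ℕ => a (1 + r) * Φ (r + 1) j ω - Φ (r + 1) j ω)
    ((hs.mul_left C).mul_right (t * W j ω)).hasSum (fun r => by
      rw [Real.norm_eq_abs, ← sub_one_mul, abs_mul]
      refine (mul_le_mul (ha (1 + r)) (h.bound (r + 1) j ω) (abs_nonneg _)
        (by positivity)).trans (le_of_eq ?_)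
      push_cast
      ring)
  rw [tsum_mul_right, tsum_mul_left] at hb
  refine hb.trans (le_of_eq ?_)
  ring

/-- Maximal inequality for the martingale parts when the weights vary slowly with time. -/
theorem HasMaximalBound.quadMartingale_varying (hp : 1 ≤ p) {M A : ℝ} {N K : ℕ}
    {s : Set ℕ}
    (hmax : ∀ (a : ℕ → ℝ) (A : ℝ), (∀ l, |a l| ≤ A) → (∀ l, K ≤ l → a l = 0) →
      HasMaximalBound μ p s (quadMartingale Φ a K) (M * A))
    (hs : ∀ n, N ≤ n → n < 2 * N → n ∈ s)
    {a : ℕ → ℕ → ℝ} {d : ℕ → ℝ} (haN : ∀ l, |a N l| ≤ A)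
    (had : ∀ i < N, ∀ l, |a (N + i + 1) l - a (N + i) l| ≤ d i)
    (haK : ∀ i ≤ N, ∀ l, K ≤ l → a (N + i) l = 0) :
    HasMaximalBound μ p {n : ℕ | N ≤ n ∧ n < 2 * N} (fun n => quadMartingale Φ (a n) K n)
      (M * (A + ∑ i ∈ Finset.range N, d i)) := by
  have h0 := (hmax (a N) A haN (haK 0 (by omega))).of_le
    (s' := {n : ℕ | N ≤ n ∧ n < 2 * N}) (g := quadMartingale Φ (a N) K) zero_le_one
    (fun n hn ω => ⟨n, hs n hn.1 hn.2, by simp⟩)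
  -- Telescoping in the weights: `a n` is `a N` plus the increments with `N + i < n`. Each increment
  -- is a fixed weight sequence, to which the maximal inequality applies.
  have h1 : ∀ i ∈ Finset.range N, HasMaximalBound μ p {n : ℕ | N ≤ n ∧ n < 2 * N}
      (fun n ω => if N + i < n then
        quadMartingale Φ (fun l => a (N + i + 1) l - a (N + i) l) K n ω else 0) (M * d i) := by
    intro i hi
    have hi' := Finset.mem_range.1 hi
    have := (hmax (fun l => a (N + i + 1) l - a (N + i) l) (d i) (had i hi') (fun l hl => by
      rw [haK i hi'.le l hl, add_assoc, haK (i + 1) (by omega) l hl, sub_zero])).of_le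
      (s' := {n : ℕ | N ≤ n ∧ n < 2 * N}) (g := fun n ω => if N + i < n then
        quadMartingale Φ (fun l => a (N + i + 1) l - a (N + i) l) K n ω else 0) zero_le_one
      (fun n hn ω => ⟨n, hs n hn.1 hn.2, by split_ifs <;> simp⟩)
    simpa using this
  have h2 := (h0.add hp (HasMaximalBound.finset_sum hp (Finset.range N) h1)).of_le
    (s' := {n : ℕ | N ≤ n ∧ n < 2 * N}) (g := fun n => quadMartingale Φ (a n) K n) zero_le_one
    (fun n hn ω => ⟨n, hn, by
      obtain ⟨j, rfl⟩ := Nat.exists_eq_add_of_le hn.1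
      have hj : j < N := by have := hn.2; omega
      rw [one_mul]
      refine le_of_eq (congrArg _ ?_)
      rw [← Finset.sum_filter]
      have e : Finset.filter (fun i => N + i < N + j) (Finset.range N) = Finset.range j := by
        ext i
        simp only [Finset.mem_filter, Finset.mem_range]
        omega
      rw [e]
      simp only [quadMartingale_sub]
      have := Finset.sum_range_sub (fun i => quadMartingale Φ (a (N + i)) K (N + j) ω) j
      simp only [← add_assoc, add_zero] at this
      rw [this]
      ring⟩)
  refine h2.mono (le_of_eq ?_)
  rw [← Finset.mul_sum]
  ring

/-- Maximal bound for the boundary term of the decomposition of lagged products. -/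
theorem GeometricArray.hasMaximalBound_boundary (h : GeometricArray μ ℱ (2 * p) C ρ B W Φ)
    (hp : 1 ≤ p) {A : ℝ} {K N : ℕ} {a : ℕ → ℕ → ℝ} (hA : 0 ≤ A)
    (ha : ∀ n, N ≤ n → n < 2 * N → ∀ l, |a n l| ≤ A)
    (haK : ∀ n, N ≤ n → n < 2 * N → ∀ l, K ≤ l → a n l = 0) :
    HasMaximalBound μ p {n : ℕ | N ≤ n ∧ n < 2 * N}
      (fun n ω => ∑ l ∈ Finset.range n, Φ 0 (n - l) ω * lagPotential Φ (a n) K (l + 1) n ω)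
      ((2 * N : ℝ) ^ (1 / p) * (C * (C / (1 - ρ)) * B ^ 2 * (A * K))) := by
  have hC := h.C_nonneg
  have hρ : 0 < 1 - ρ := by linarith [h.rho_lt_one]
  have hp0 : 0 < p := by linarith
  have hfix : ∀ n : ℕ, HasMaximalBound μ p (Set.univ : Set Unit)
      (fun _ ω => ∑ l ∈ Finset.range K, C * (A * (C / (1 - ρ))) * (W (n - l) ω * W n ω))
      (C * (C / (1 - ρ)) * B ^ 2 * (A * K)) := by
    intro n
    have h1 : ∀ l ∈ Finset.range K, HasMaximalBound μ p (Set.univ : Set Unit)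
        (fun _ ω => C * (A * (C / (1 - ρ))) * (W (n - l) ω * W n ω))
        (C * (A * (C / (1 - ρ))) * B ^ 2) := fun l _ =>
      (h.hasMaximalBound_W_mul hp (Set.univ : Set Unit) (n - l) n).of_le (by positivity)
        (fun _ _ ω => ⟨(), trivial, by
          rw [abs_mul, abs_of_nonneg (by positivity : 0 ≤ C * (A * (C / (1 - ρ))))]⟩)
    refine (HasMaximalBound.finset_sum hp _ h1).mono (le_of_eq ?_)
    rw [Finset.sum_const, Finset.card_range, nsmul_eq_mul]
    ring
  -- No cancellation is needed here: a union over the times below `2N` costs `(2N)^(1/p)`.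
  have h2 := (HasMaximalBound.of_finset hp0 (Finset.range (2 * N))
    (s := fun _ => (Set.univ : Set Unit)) (f := fun n _ ω => ∑ l ∈ Finset.range K,
      C * (A * (C / (1 - ρ))) * (W (n - l) ω * W n ω)) (by positivity)
    (fun n _ => hfix n)).of_le (s' := {n : ℕ | N ≤ n ∧ n < 2 * N})
    (g := fun n ω => ∑ l ∈ Finset.range n, Φ 0 (n - l) ω * lagPotential Φ (a n) K (l + 1) n ω)
    zero_le_one (fun n hn ω => ⟨(n, ()), ⟨Finset.mem_range.2 hn.2, trivial⟩, by
      have hle : ∀ l, |Φ 0 (n - l) ω * lagPotential Φ (a n) K (l + 1) n ω|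
          ≤ C * (A * (C / (1 - ρ))) * (W (n - l) ω * W n ω) := by
        intro l
        have h1 := h.bound 0 (n - l) ω
        rw [pow_zero, mul_one] at h1
        rw [abs_mul]
        refine (mul_le_mul h1 (h.abs_sum_weight_le (ha n hn.1 hn.2) K (l + 1) 1 n ω)
          (abs_nonneg _) ((abs_nonneg _).trans h1)).trans (le_of_eq ?_)
        ring
      have hpos : ∀ l, 0 ≤ C * (A * (C / (1 - ρ))) * (W (n - l) ω * W n ω) := fun l => by
        have := h.W_nonneg (n - l) ω
        have := h.W_nonneg n ω
        positivity
      rw [one_mul, abs_of_nonneg (Finset.sum_nonneg fun l _ => hpos l)]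
      calc _ ≤ ∑ l ∈ Finset.range n, |Φ 0 (n - l) ω * lagPotential Φ (a n) K (l + 1) n ω| :=
            Finset.abs_sum_le_sum_abs _ _
        _ = ∑ l ∈ Finset.range n with l < K,
              |Φ 0 (n - l) ω * lagPotential Φ (a n) K (l + 1) n ω| := by
            rw [Finset.sum_filter_of_ne]
            intro l _ hne
            by_contra hl
            exact hne (by rw [lagPotential_eq_zero (haK n hn.1 hn.2) (by omega), mul_zero,
              abs_zero])
        _ ≤ ∑ l ∈ Finset.range K, |Φ 0 (n - l) ω * lagPotential Φ (a n) K (l + 1) n ω| := by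
            refine Finset.sum_le_sum_of_subset_of_nonneg (fun l hl => ?_) fun _ _ _ => abs_nonneg _
            exact Finset.mem_range.2 (Finset.mem_filter.1 hl).2
        _ ≤ _ := Finset.sum_le_sum fun l _ => hle l⟩)
  refine h2.mono (le_of_eq ?_)
  rw [Finset.card_range, one_mul]
  push_cast
  rfl

end Blocks

/-! ### Bandwidth cut-offs and rates -/

section Bandwidth

/-- Elementary facts about the weights `w (l b_n)` for `N ≤ n ≤ 2 N` when `b_n = c n^{-δ}`. -/
theorem exists_weight_cutoff {δ c : ℝ} {b : ℕ → ℝ} (hc : 0 < c) (hδ : 0 < δ)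
    (hb : ∀ n : ℕ, 1 ≤ n → b n = c * (n : ℝ) ^ (-δ)) :
    ∃ CK : ℝ, 0 ≤ CK ∧ ∀ N : ℕ, 1 ≤ N → ∃ K : ℕ, 1 ≤ K ∧ (K : ℝ) ≤ CK * (N : ℝ) ^ δ ∧
      (K : ℝ) * b N ≤ CK * c ∧ ∀ n l : ℕ, N ≤ n → n ≤ 2 * N → K ≤ l → 1 ≤ l * b n := by
  refine ⟨2 ^ δ / c + 2, by positivity, fun N hN => ?_⟩
  have hN0 : (0 : ℝ) < N := by exact_mod_cast hN
  have hNδ : (1 : ℝ) ≤ (N : ℝ) ^ δ := Real.one_le_rpow (by exact_mod_cast hN) hδ.le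
  have hKle : ((⌈(2 * N : ℝ) ^ δ / c⌉₊ + 1 : ℕ) : ℝ) ≤ (2 ^ δ / c + 2) * (N : ℝ) ^ δ := by
    have h1 := (Nat.ceil_lt_add_one (by positivity : 0 ≤ (2 * N : ℝ) ^ δ / c)).le
    push_cast
    rw [Real.mul_rpow two_pos.le hN0.le] at h1 ⊢
    calc _ ≤ 2 ^ δ * (N : ℝ) ^ δ / c + 1 + 1 := by linarith
      _ ≤ 2 ^ δ * (N : ℝ) ^ δ / c + 2 * (N : ℝ) ^ δ := by linarith
      _ = _ := by ring
  -- The cut-off is read off at `2N`, where the bandwidth is smallest, so that it serves the whole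
  -- block; the `+ 1` ensures `K ≥ 1`.
  refine ⟨⌈(2 * N : ℝ) ^ δ / c⌉₊ + 1, by omega, hKle, ?_, fun n l hn hn2 hl => ?_⟩
  · rw [hb N hN]
    calc _ ≤ (2 ^ δ / c + 2) * (N : ℝ) ^ δ * (c * (N : ℝ) ^ (-δ)) := by gcongr
      _ = (2 ^ δ / c + 2) * c * ((N : ℝ) ^ δ * (N : ℝ) ^ (-δ)) := by ring
      _ = _ := by rw [← Real.rpow_add hN0, add_neg_cancel, Real.rpow_zero, mul_one]
  · have hn0 : (0 : ℝ) < n := by exact_mod_cast (by omega : 0 < n)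
    have h1 : (2 * N : ℝ) ^ δ / c ≤ l := (Nat.le_ceil _).trans (by
      exact_mod_cast (by omega : ⌈(2 * N : ℝ) ^ δ / c⌉₊ ≤ l))
    have h2 : (n : ℝ) ^ δ ≤ (2 * N : ℝ) ^ δ :=
      Real.rpow_le_rpow hn0.le (by exact_mod_cast hn2) hδ.le
    rw [hb n (by omega), Real.rpow_neg hn0.le, ← div_eq_mul_inv, mul_div_assoc',
      one_le_div (by positivity)]
    rw [div_le_iff₀ hc] at h1
    linarith

theorem bandwidth_anti {δ c : ℝ} {b : ℕ → ℝ} (hc : 0 < c) (hδ : 0 < δ)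
    (hb : ∀ n : ℕ, 1 ≤ n → b n = c * (n : ℝ) ^ (-δ)) {m n : ℕ} (hm : 1 ≤ m) (hmn : m ≤ n) :
    b n ≤ b m := by
  have hm0 : (0 : ℝ) < m := by exact_mod_cast hm
  rw [hb m hm, hb n (hm.trans hmn)]
  have : (n : ℝ) ^ (-δ) ≤ (m : ℝ) ^ (-δ) :=
    Real.rpow_le_rpow_of_nonpos hm0 (by exact_mod_cast hmn) (by linarith)
  gcongr

/-- The arithmetic behind the block bound: every error term decays like `u² x^{-η}`. -/
theorem block_error_le {x u κ δ η q CS CK L CT C G c B CM D S C5 K : ℝ} (hx1 : 1 ≤ x) (hu : 1 ≤ u)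
    (hκ1 : κ ≤ 1) (hη1 : η ≤ δ) (hη2 : η ≤ 1 - κ - δ) (hq : q ≤ κ) (hκ0 : 0 ≤ κ)
    (hCS : 0 ≤ CS) (hCK : 0 ≤ CK) (hL : 0 ≤ L) (hCT : 0 ≤ CT) (hC : 0 ≤ C) (hG : 0 ≤ G)
    (hc : 0 ≤ c) (hCM : 0 ≤ CM) (hS0 : 0 ≤ S) (hC5 : 0 ≤ C5) (hK0 : 0 ≤ K)
    (hK : K ≤ CK * x ^ δ) (hS : S ≤ D) :
    CS * K * L * u ^ 2 / x + 1 / x * (CT * u * (2 * x) ^ κ)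
      + 2 / x * (C * (G * (L * (c * x ^ (-δ)))) * (2 * x * B ^ 2))
      + 2 / x * (CM * u * (2 * x) ^ κ * K * S) + 2 / x * ((2 * x) ^ q * (C5 * (L * K)))
      ≤ (CS * CK * L + 2 * CT + 4 * C * G * L * c * B ^ 2 + 4 * CM * CK * D + 4 * C5 * L * CK)
        * (u ^ 2 * x ^ (-η)) := by
  have hx0 : 0 < x := by linarith
  have hD : 0 ≤ D := hS0.trans hS
  have hpow : ∀ y : ℝ, y ≤ -η → x ^ y ≤ x ^ (-η) := fun y hy =>
    Real.rpow_le_rpow_of_exponent_le hx1 hy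
  have hdiv : ∀ y : ℝ, x ^ y / x = x ^ (y - 1) := fun y => (Real.rpow_sub_one hx0.ne' y).symm
  -- The rates are `x^(δ-1)` (sample mean), `x^(κ-1)` (variance density), `x^(κ+δ-1)` (martingale
  -- and boundary) and `x^(-δ)` (bias); `η ≤ δ` and `η ≤ 1 - κ - δ` cover them all.
  have f3 : x ^ δ / x ≤ x ^ (-η) := by rw [hdiv]; exact hpow _ (by linarith)
  have f2 : x ^ κ / x ≤ x ^ (-η) := by rw [hdiv]; exact hpow _ (by linarith)
  have f1 : x ^ κ * x ^ δ / x ≤ x ^ (-η) := by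
    rw [← Real.rpow_add hx0, hdiv]; exact hpow _ (by linarith)
  have f4 : x ^ (-δ) ≤ x ^ (-η) := hpow _ (by linarith)
  have g1 : (2 * x) ^ κ ≤ 2 * x ^ κ := by
    rw [Real.mul_rpow two_pos.le hx0.le]
    have : (2 : ℝ) ^ κ ≤ 2 ^ (1 : ℝ) := Real.rpow_le_rpow_of_exponent_le one_le_two hκ1
    rw [Real.rpow_one] at this
    gcongr
  have g2 : (2 * x) ^ q ≤ 2 * x ^ κ :=
    (Real.rpow_le_rpow_of_exponent_le (by linarith) hq).trans g1
  have hPη : 0 ≤ x ^ (-η) := by positivity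
  have huu : u ≤ u ^ 2 := by nlinarith
  have hu1 : (1 : ℝ) ≤ u ^ 2 := by nlinarith
  have t1 : CS * K * L * u ^ 2 / x ≤ CS * CK * L * (u ^ 2 * x ^ (-η)) := by
    calc CS * K * L * u ^ 2 / x ≤ CS * (CK * x ^ δ) * L * u ^ 2 / x := by gcongr
      _ = CS * CK * L * u ^ 2 * (x ^ δ / x) := by ring
      _ ≤ CS * CK * L * u ^ 2 * x ^ (-η) := by gcongr
      _ = _ := by ring
  have t2 : 1 / x * (CT * u * (2 * x) ^ κ) ≤ 2 * CT * (u ^ 2 * x ^ (-η)) := by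
    calc 1 / x * (CT * u * (2 * x) ^ κ) ≤ 1 / x * (CT * u ^ 2 * (2 * x ^ κ)) := by gcongr
      _ = 2 * CT * u ^ 2 * (x ^ κ / x) := by ring
      _ ≤ 2 * CT * u ^ 2 * x ^ (-η) := by gcongr
      _ = _ := by ring
  have t3 : 2 / x * (C * (G * (L * (c * x ^ (-δ)))) * (2 * x * B ^ 2))
      ≤ 4 * C * G * L * c * B ^ 2 * (u ^ 2 * x ^ (-η)) := by
    calc _ = 4 * C * G * L * c * B ^ 2 * (1 * x ^ (-δ)) := by field_simp; ring
      _ ≤ _ := by gcongr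
  have t4 : 2 / x * (CM * u * (2 * x) ^ κ * K * S) ≤ 4 * CM * CK * D * (u ^ 2 * x ^ (-η)) := by
    calc _ ≤ 2 / x * (CM * u ^ 2 * (2 * x ^ κ) * (CK * x ^ δ) * D) := by gcongr
      _ = 4 * CM * CK * D * u ^ 2 * (x ^ κ * x ^ δ / x) := by ring
      _ ≤ 4 * CM * CK * D * u ^ 2 * x ^ (-η) := by gcongr
      _ = _ := by ring
  have t5 : 2 / x * ((2 * x) ^ q * (C5 * (L * K))) ≤ 4 * C5 * L * CK * (u ^ 2 * x ^ (-η)) := by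
    calc _ ≤ 2 / x * ((2 * x ^ κ) * (C5 * (L * (CK * x ^ δ)))) := by gcongr
      _ = 4 * C5 * L * CK * (1 * (x ^ κ * x ^ δ / x)) := by ring
      _ ≤ _ := by gcongr
  linarith

end Bandwidth

/-! ### The block bound for the estimator -/

section BlockBound

variable {Ω : Type*} {m0 : MeasurableSpace Ω} {μ : Measure Ω}
  {ℱ : Filtration ℕ m0} {p C ρ B : ℝ} {W : ℕ → Ω → ℝ} {Φ : ℕ → ℕ → Ω → ℝ}

theorem HasMaximalBound.div_index {s : Set ℕ} {F : ℕ → Ω → ℝ} {D : ℝ}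
    (h : HasMaximalBound μ p s F D) {N : ℕ} (hN : 1 ≤ N) (hs : ∀ n ∈ s, N ≤ n) (t : ℝ) :
    HasMaximalBound μ p s (fun n ω => t / n * F n ω) (|t| / N * D) := by
  have hN0 : (0 : ℝ) < N := by exact_mod_cast hN
  refine h.of_le (by positivity) fun n hn ω => ⟨n, hn, ?_⟩
  have hn' : (N : ℝ) ≤ n := by exact_mod_cast hs n hn
  rw [abs_mul, abs_div, Nat.abs_cast]
  gcongr

theorem GeometricArray.hasMaximalBound_bias (h : GeometricArray μ ℱ (2 * p) C ρ B W Φ)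
    (hp : 1 ≤ p) {G t : ℝ} (hG : 0 ≤ G) (ht : 0 ≤ t) {K N : ℕ} {a : ℕ → ℕ → ℝ}
    (ha : ∀ n, N ≤ n → n < 2 * N → ∀ (j : ℕ) (ω : Ω),
      |lagPotential Φ (a n) K 1 j ω - ∑' r : ℕ, Φ (r + 1) j ω| ≤ G * t * W j ω) :
    HasMaximalBound μ p {n : ℕ | N ≤ n ∧ n < 2 * N}
      (fun n ω => ∑ j ∈ Finset.range n, Φ 0 (j + 1) ω *
        (lagPotential Φ (a n) K 1 (j + 1) ω - ∑' r : ℕ, Φ (r + 1) (j + 1) ω))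
      (C * (G * t) * (2 * N * B ^ 2)) := by
  have hC := h.C_nonneg
  have hsum := HasMaximalBound.finset_sum hp (s := (Set.univ : Set Unit)) (Finset.range (2 * N))
    (f := fun j _ ω => W (j + 1) ω * W (j + 1) ω) (B := fun _ => B ^ 2)
    (fun j _ => h.hasMaximalBound_W_mul hp _ _ _)
  have hpos : ∀ j ω, 0 ≤ W (j + 1) ω * W (j + 1) ω := fun j ω => mul_self_nonneg _
  have := hsum.of_le (s' := {n : ℕ | N ≤ n ∧ n < 2 * N})
    (g := fun n ω => ∑ j ∈ Finset.range n, Φ 0 (j + 1) ω *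
        (lagPotential Φ (a n) K 1 (j + 1) ω - ∑' r : ℕ, Φ (r + 1) (j + 1) ω))
    (c := C * (G * t)) (by positivity) (fun n hn ω => ⟨(), trivial, by
      rw [abs_of_nonneg (Finset.sum_nonneg fun j _ => hpos j ω), Finset.mul_sum]
      refine (Finset.abs_sum_le_sum_abs _ _).trans ((Finset.sum_le_sum fun j _ => ?_).trans
        (Finset.sum_le_sum_of_subset_of_nonneg (Finset.range_subset_range.2 hn.2.le)
          fun j _ _ => mul_nonneg (by positivity) (hpos j ω)))
      have h1 := h.bound 0 (j + 1) ω
      rw [pow_zero, mul_one] at h1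
      rw [abs_mul]
      refine (mul_le_mul h1 (ha n hn.1 hn.2 (j + 1) ω) (abs_nonneg _)
        ((abs_nonneg _).trans h1)).trans (le_of_eq ?_)
      ring⟩)
  refine this.mono (le_of_eq ?_)
  rw [Finset.sum_const, Finset.card_range, nsmul_eq_mul]
  push_cast
  ring

/-- The correction is `O(K T²/n²)` with `T` the largest partial sum. In `L^{2p}` the maximal
inequality has exponent `1/2`, because `2p > 2`; hence `T²` is of order `2^k (k+2)²` in `L^p`,
whatever `p > 1`. -/
theorem GeometricArray.exists_maximalBound_sampleMean [IsFiniteMeasure μ]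
    (h : GeometricArray μ ℱ (2 * p) C ρ B W Φ) (hp : 1 < p) :
    ∃ C' : ℝ, 0 ≤ C' ∧ ∀ {E : Type*} {f : E → ℝ} {X : ℕ → Ω → E} {e L : ℝ} {w : ℝ → ℝ}
      {b : ℕ → ℝ} {k K : ℕ}, (∀ j ω, Φ 0 j ω = f (X j ω) - e) →
      (∀ x, w (-x) = w x) → w 0 = 1 → 1 ≤ K →
      (∀ n, 2 ^ k ≤ n → n < 2 * 2 ^ k → ∀ l : ℕ, |w (l * b n)| ≤ L) →
      (∀ n, 2 ^ k ≤ n → n < 2 * 2 ^ k → ∀ l : ℕ, K ≤ l → w (l * b n) = 0) →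
      HasMaximalBound μ p {n : ℕ | 2 ^ k ≤ n ∧ n < 2 * 2 ^ k}
        (fun n ω => kernelEstimator w b f X n ω
          - (1 / (n : ℝ)) * (∑ j ∈ Finset.range n, Φ 0 (j + 1) ω ^ 2
            + 2 * ∑ i ∈ Finset.range n, ∑ l ∈ Finset.range i,
              w ((l + 1 : ℕ) * b n) * Φ 0 (i - l) ω * Φ 0 (i + 1) ω))
        (C' * K * L * ((k : ℝ) + 2) ^ 2 / 2 ^ k) := by
  obtain ⟨CS, hCS, hS⟩ := h.exists_maximalBound_sum (by linarith)
  refine ⟨24 * CS ^ 2, by positivity, ?_⟩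
  intro E f X e L w b k K hΦ heven h0 hK hL hwK
  have hL0 : 0 ≤ L := (abs_nonneg _).trans (hL (2 ^ k) le_rfl
    (by have := Nat.one_le_two_pow (n := k); omega) 0)
  have h1 := (hS (k + 1)).sq
  have hX : (0 : ℝ) < 2 ^ k := by positivity
  have hmax : max (1 / (2 * p)) (1 / 2) = 1 / 2 :=
    max_eq_right (one_div_le_one_div_of_le two_pos (by linarith))
  have h2 := h1.of_le (s' := {n : ℕ | 2 ^ k ≤ n ∧ n < 2 * 2 ^ k})
    (g := fun n ω => kernelEstimator w b f X n ω
          - (1 / (n : ℝ)) * (∑ j ∈ Finset.range n, Φ 0 (j + 1) ω ^ 2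
            + 2 * ∑ i ∈ Finset.range n, ∑ l ∈ Finset.range i,
              w ((l + 1 : ℕ) * b n) * Φ 0 (i - l) ω * Φ 0 (i + 1) ω))
    (c := 12 * K * L / (2 ^ k : ℝ) ^ 2) (by positivity) (fun n hn ω => by
      have hn1 : 1 ≤ n := (Nat.one_le_two_pow).trans hn.1
      obtain ⟨i, hi, hmaxi⟩ := Finset.exists_max_image (Finset.range (n + 1))
        (fun m => |∑ j ∈ Finset.range m, Φ 0 (j + 1) ω|) ⟨0, by simp⟩
      have hi' := Finset.mem_range.1 hi
      refine ⟨i, by have := hn.2; change i ≤ 2 ^ (k + 1); rw [pow_succ]; omega, ?_⟩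
      refine (abs_kernelEstimator_sub_le heven (hL n hn.1 hn.2) hK (hwK n hn.1 hn.2) h0
        (fun j => hΦ j ω) hn1 (T := |∑ j ∈ Finset.range i, Φ 0 (j + 1) ω|)
        (fun m hm => hmaxi m (Finset.mem_range.2 (by omega)))).trans ?_
      rw [abs_of_nonneg (sq_nonneg (∑ j ∈ Finset.range i, Φ 0 (j + 1) ω)), sq_abs,
        mul_div_right_comm]
      have hn' : (2 ^ k : ℝ) ≤ n := by exact_mod_cast hn.1
      gcongr)
  refine h2.mono (le_of_eq ?_)
  rw [hmax, mul_pow, ← Real.sqrt_eq_rpow, Real.sq_sqrt (by positivity), pow_succ]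
  push_cast
  field_simp
  ring

/-- The block bound: on dyadic blocks the maximal deviation of the kernel estimator is small
in `L^p`. -/
theorem GeometricArray.exists_maximalBound_estimator [IsFiniteMeasure μ]
    (h : GeometricArray μ ℱ (2 * p) C ρ B W Φ) (hp : 1 < p)
    {E : Type*} {f : E → ℝ} {X : ℕ → Ω → E} {e : ℝ} (hΦ : ∀ j ω, Φ 0 j ω = f (X j ω) - e)
    {σ2 CT : ℝ} (hCT : 0 ≤ CT)
    (hT : ∀ k : ℕ, HasMaximalBound μ p {n : ℕ | n ≤ 2 ^ k}
      (fun n ω => ∑ j ∈ Finset.range n, (Φ 0 (j + 1) ω * Φ 0 (j + 1) ω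
        + 2 * (Φ 0 (j + 1) ω * ∑' r : ℕ, Φ (r + 1) (j + 1) ω) - σ2))
      (CT * (k + 1) * (2 ^ k : ℝ) ^ max (1 / p) (1 / 2)))
    {w : ℝ → ℝ} {L : ℝ} (hLip : ∀ x y, 0 ≤ x → 0 ≤ y → |w x - w y| ≤ L * |x - y|)
    (hsupp : ∀ x, 1 ≤ x → w x = 0) (heven : ∀ x, w (-x) = w x) (h0 : w 0 = 1)
    {δ c : ℝ} {b : ℕ → ℝ} (hc : 0 < c) (hb : ∀ n : ℕ, 1 ≤ n → b n = c * (n : ℝ) ^ (-δ))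
    (hδ0 : 0 < δ) (hδ : δ + max (1 / p) (1 / 2) < 1) :
    ∃ C' η : ℝ, 0 ≤ C' ∧ 0 < η ∧ ∀ k : ℕ,
      HasMaximalBound μ p {n : ℕ | 2 ^ k ≤ n ∧ n < 2 * 2 ^ k}
        (fun n ω => kernelEstimator w b f X n ω - σ2)
        (C' * (((k : ℝ) + 2) ^ 2 * (2 ^ k : ℝ) ^ (-η))) := by
  obtain ⟨CS, hCS, hS⟩ := h.exists_maximalBound_sampleMean hp
  obtain ⟨CM, hCM, hM⟩ := h.exists_maximalBound_quadMartingale hp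
  obtain ⟨G, hG, hbias⟩ := h.exists_bias_bound
  obtain ⟨CK, hCK, hcut⟩ := exists_weight_cutoff hc hδ0 hb
  have hL1 : 1 ≤ L := by
    have := hLip 0 1 le_rfl zero_le_one
    rw [h0, hsupp 1 le_rfl] at this
    simpa using this
  have hwL : ∀ x, 0 ≤ x → |w x| ≤ L := fun x hx => by
    rcases le_total 1 x with h1 | h1
    · rw [hsupp x h1, abs_zero]; linarith
    · have := hLip x 1 hx zero_le_one
      rw [hsupp 1 le_rfl, sub_zero] at this
      refine this.trans (mul_le_of_le_one_right (by linarith) ?_)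
      rw [abs_le]
      constructor <;> linarith
  have hC := h.C_nonneg
  have hρ : 0 < 1 - ρ := by linarith [h.rho_lt_one]
  have hp0 : 0 < p := by linarith
  set κ := max (1 / p) (1 / 2) with hκ
  have hκ0 : 0 < κ := lt_of_lt_of_le one_half_pos (le_max_right _ _)
  set C5 := C * (C / (1 - ρ)) * B ^ 2 with hC5
  have hC50 : 0 ≤ C5 := by positivity
  refine ⟨CS * CK * L + 2 * CT + 4 * C * G * L * c * B ^ 2 + 4 * CM * CK * (L + L * (CK * c))
    + 4 * C5 * L * CK, min δ (1 - κ - δ), by positivity, lt_min hδ0 (by linarith), fun k => ?_⟩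
  set η := min δ (1 - κ - δ) with hη
  have hNat1 : 1 ≤ 2 ^ k := Nat.one_le_two_pow
  obtain ⟨K, hK1, hKN, hKb, hKl⟩ := hcut (2 ^ k) hNat1
  push_cast at hKN
  set x : ℝ := 2 ^ k with hx
  have hx1 : 1 ≤ x := one_le_pow₀ one_le_two
  have hx0 : 0 < x := by linarith
  set s : Set ℕ := {n : ℕ | 2 ^ k ≤ n ∧ n < 2 * 2 ^ k} with hs
  set a : ℕ → ℕ → ℝ := fun n l => w (l * b n) with ha
  have hbpos : ∀ n, 1 ≤ n → 0 ≤ b n := fun n hn => by rw [hb n hn]; positivity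
  have haL : ∀ n, 1 ≤ n → ∀ l, |a n l| ≤ L := fun n hn l =>
    hwL _ (mul_nonneg (Nat.cast_nonneg l) (hbpos n hn))
  have haK : ∀ n, 2 ^ k ≤ n → n ≤ 2 * 2 ^ k → ∀ l, K ≤ l → a n l = 0 := fun n h1 h2 l hl =>
    hsupp _ (hKl n l h1 h2 hl)
  have hbN : b (2 ^ k) = c * x ^ (-δ) := by
    rw [hb _ hNat1]
    push_cast
    rfl
  have hsle : ∀ n ∈ s, 2 ^ k ≤ n := fun n hn => hn.1
  -- the five error terms
  have F1 := hS (k := k) (K := K) (L := L) (b := b) hΦ heven h0 hK1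
    (fun n h1 _ l => haL n (hNat1.trans h1) l) (fun n h1 h2 l hl => haK n h1 h2.le l hl)
  have F2 := ((hT (k + 1)).of_le (s' := s) (g := fun n ω => ∑ j ∈ Finset.range n,
      (Φ 0 (j + 1) ω * Φ 0 (j + 1) ω + 2 * (Φ 0 (j + 1) ω * ∑' r : ℕ, Φ (r + 1) (j + 1) ω) - σ2))
      zero_le_one (fun n hn ω => ⟨n, by
        have := hn.2; change n ≤ 2 ^ (k + 1); rw [pow_succ]; omega, by rw [one_mul]⟩)).div_index
      hNat1 hsle 1
  -- Since `w 0 = 1`, the Lipschitz bound gives `|w(l b_n) - 1| ≤ L l b_n`, and `b` is largest at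
  -- the start of the block.
  have F3 := (h.hasMaximalBound_bias hp.le (N := 2 ^ k) (K := K) (a := a) hG
      (t := L * b (2 ^ k)) (mul_nonneg (by linarith) (hbpos _ hNat1)) (fun n h1 h2 j ω => by
        have hbn := bandwidth_anti hc hδ0 hb hNat1 h1
        have hbn0 := hbpos n (hNat1.trans h1)
        refine hbias (a n) K (L * b (2 ^ k)) (mul_nonneg (by linarith) (hbpos _ hNat1))
          (haK n h1 h2.le) (fun l => ?_) j ω
        have hl0 : 0 ≤ l * b n := by positivity
        have := hLip (l * b n) 0 hl0 le_rfl
        rw [h0, sub_zero, abs_of_nonneg hl0] at this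
        refine this.trans ?_
        calc L * (l * b n) = L * b n * l := by ring
          _ ≤ L * b (2 ^ k) * l := by gcongr)).div_index hNat1 hsle 2
  -- From one `n` to the next only weights with `l < K` move, each by at most `L K` times the
  -- decrease of the bandwidth.
  have F4 := (HasMaximalBound.quadMartingale_varying hp.le (μ := μ) (Φ := Φ) (N := 2 ^ k) (K := K)
      (s := {n : ℕ | n ≤ 2 ^ (k + 1)}) (a := a) (A := L)
      (d := fun i => L * K * (b (2 ^ k + i) - b (2 ^ k + i + 1)))
      (fun a' A hA hK => hM a' A K (k + 1) hA hK)
      (fun n _ h2 => by change n ≤ 2 ^ (k + 1); rw [pow_succ]; omega)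
      (haL _ hNat1)
      (fun i hi l => by
        have hanti := bandwidth_anti hc hδ0 hb (by omega : 1 ≤ 2 ^ k + i)
          (Nat.le_succ (2 ^ k + i))
        have hnn : 0 ≤ b (2 ^ k + i) - b (2 ^ k + i + 1) := sub_nonneg.2 hanti
        rcases Nat.lt_or_ge l K with hl | hl
        · have := hLip (l * b (2 ^ k + i + 1)) (l * b (2 ^ k + i))
            (mul_nonneg (Nat.cast_nonneg l) (hbpos _ (by omega)))
            (mul_nonneg (Nat.cast_nonneg l) (hbpos _ (by omega)))
          refine this.trans ?_
          rw [← mul_sub, abs_mul, abs_sub_comm, abs_of_nonneg hnn, Nat.abs_cast, mul_assoc]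
          have hlK : (l : ℝ) ≤ K := by exact_mod_cast hl.le
          gcongr
        · rw [haK _ (by omega) (by omega) l hl, haK _ (by omega) (by omega) l hl, sub_zero,
            abs_zero]
          positivity)
      (fun i hi l hl => haK _ (by omega) (by omega) l hl)).div_index hNat1 hsle 2
  have F5 := (h.hasMaximalBound_boundary hp.le (N := 2 ^ k) (K := K) (a := a) (A := L)
      (by linarith) (fun n h1 _ => haL n (hNat1.trans h1))
      (fun n h1 h2 => haK n h1 h2.le)).div_index hNat1 hsle (-2)
  have hsum := ((((F1.add hp.le F2).add hp.le F3).add hp.le F4).add hp.le F5).of_le (s' := s)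
    (g := fun n ω => kernelEstimator w b f X n ω - σ2) zero_le_one
    (fun n hn ω => ⟨n, hn, le_of_eq (by
      have hn0 : (n : ℝ) ≠ 0 := by
        have := hNat1.trans hn.1
        positivity
      have hQ := sum_lag_mul_eq_quadMartingale (Φ := Φ) (haK n hn.1 hn.2.le) n ω
      rw [one_mul]
      refine congrArg _ ?_
      rw [hQ]
      simp only [Finset.sum_sub_distrib, Finset.sum_add_distrib, mul_sub, ← Finset.mul_sum,
        Finset.sum_const, Finset.card_range, nsmul_eq_mul, sq]
      field_simp
      ring)⟩)
  refine hsum.mono ?_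
  have hu : (1 : ℝ) ≤ (k : ℝ) + 2 := by
    have : (0 : ℝ) ≤ k := Nat.cast_nonneg k
    linarith
  set u : ℝ := (k : ℝ) + 2 with hu'
  have hk1 : (((k + 1 : ℕ) : ℝ) + 1) = u := by rw [hu']; push_cast; ring
  -- The variation telescopes to at most `L K b(2^k)`, bounded uniformly in `k`: moving weights cost
  -- only a constant factor.
  have hd : ∑ i ∈ Finset.range (2 ^ k), L * K * (b (2 ^ k + i) - b (2 ^ k + i + 1))
      ≤ L * (CK * c) := by
    rw [← Finset.mul_sum]
    have e1 := Finset.sum_range_sub' (fun i => b (2 ^ k + i)) (2 ^ k)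
    simp only [← add_assoc, add_zero] at e1
    rw [e1, mul_assoc]
    refine mul_le_mul_of_nonneg_left (le_trans ?_ hKb) (by linarith)
    refine mul_le_mul_of_nonneg_left ?_ (Nat.cast_nonneg K)
    linarith [hbpos (2 ^ k + 2 ^ k) (by omega)]
  have hd0 : 0 ≤ ∑ i ∈ Finset.range (2 ^ k), L * K * (b (2 ^ k + i) - b (2 ^ k + i + 1)) :=
    Finset.sum_nonneg fun i _ => mul_nonneg (by positivity)
      (sub_nonneg.2 (bandwidth_anti hc hδ0 hb (by omega) (Nat.le_succ _)))
  have h2x : (2 ^ (k + 1) : ℝ) = 2 * x := by rw [hx, pow_succ]; ring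
  have hcast : ((2 ^ k : ℕ) : ℝ) = x := by push_cast; rfl
  rw [hcast, hk1, h2x, hbN, abs_one, abs_neg, abs_two, one_mul, one_mul]
  exact block_error_le hx1 hu (by linarith) (min_le_left _ _) (min_le_right _ _)
    (le_max_left _ _) hκ0.le hCS hCK (by linarith) hCT hC hG hc.le hCM (by linarith) hC50
    (Nat.cast_nonneg K) hKN (by linarith)

end BlockBound

/-! ### From block bounds to convergence -/

section Convergence

variable {Ω : Type*} {m0 : MeasurableSpace Ω} {μ : Measure Ω}

theorem mem_dyadic_block {n : ℕ} (hn : 1 ≤ n) :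
    n ∈ {n : ℕ | 2 ^ Nat.log 2 n ≤ n ∧ n < 2 * 2 ^ Nat.log 2 n} :=
  ⟨Nat.pow_log_le_self 2 (by omega), by
    have := Nat.lt_pow_succ_log_self (b := 2) (by norm_num) n
    rw [pow_succ] at this
    omega⟩

theorem tendsto_log_two : Tendsto (fun n : ℕ => Nat.log 2 n) atTop atTop :=
  tendsto_atTop_mono' atTop (f₁ := fun n => Nat.log 2 n) (Eventually.of_forall fun _ => le_rfl)
    (tendsto_atTop_atTop.2 fun k => ⟨2 ^ k, fun _ hn =>
      Nat.le_log_of_pow_le (by norm_num) hn⟩)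

/-- Summable maximal bounds on dyadic blocks give convergence in `L^p` and almost surely. -/
theorem tendsto_zero_of_block_bounds [IsProbabilityMeasure μ] {p : ℝ} (hp : 1 ≤ p)
    {Z : ℕ → Ω → ℝ} {ε : ℕ → ℝ} (hε : Summable ε)
    (h : ∀ k : ℕ, HasMaximalBound μ p {n : ℕ | 2 ^ k ≤ n ∧ n < 2 * 2 ^ k} Z (ε k)) :
    Tendsto (fun n => eLpNorm (Z n) (ENNReal.ofReal p) μ) atTop (𝓝 0) ∧
      ∀ᵐ ω ∂μ, Tendsto (fun n => Z n ω) atTop (𝓝 0) := by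
  constructor
  · have h1 : Tendsto (fun n => ENNReal.ofReal (ε (Nat.log 2 n))) atTop (𝓝 0) := by
      have := (ENNReal.tendsto_ofReal hε.tendsto_atTop_zero).comp tendsto_log_two
      simpa [Function.comp_def] using this
    refine tendsto_of_tendsto_of_tendsto_of_le_of_le' tendsto_const_nhds h1
      (Eventually.of_forall fun _ => zero_le) ?_
    filter_upwards [eventually_ge_atTop 1] with n hn
    exact (h _).eLpNorm_le (mem_dyadic_block hn)
  · choose h0 Y hY hd hn using h
    have hp' : 1 ≤ ENNReal.ofReal p := by simpa using hp
    -- On a probability space the `L^1` norms are dominated by the summable `L^p` bounds, so `∑ |Y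
    -- k|` is finite almost surely and the block maxima tend to 0.
    have hsum : ∫⁻ ω, ∑' k, ‖Y k ω‖ₑ ∂μ ≠ ∞ := by
      rw [lintegral_tsum fun k => (hY k).enorm]
      refine ne_top_of_le_ne_top hε.tsum_ofReal_ne_top (ENNReal.tsum_le_tsum fun k => ?_)
      rw [← eLpNorm_one_eq_lintegral_enorm]
      exact (eLpNorm_le_eLpNorm_of_exponent_le hp' (hY k)).trans (hn k)
    have hae := ae_lt_top' (AEMeasurable.tsum fun k => (hY k).enorm) hsum
    filter_upwards [hae] with ω hω
    have h1 : Tendsto (fun k => ‖Y k ω‖ₑ) atTop (𝓝 0) :=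
      ENNReal.tendsto_atTop_zero_of_tsum_ne_top hω.ne
    have h2 : Tendsto (fun k => Y k ω) atTop (𝓝 0) := by
      rwa [← tendsto_zero_iff_enorm_tendsto_zero] at h1
    refine squeeze_zero_norm' ?_ (h2.comp tendsto_log_two)
    filter_upwards [eventually_ge_atTop 1] with n hn'
    exact hd _ n (mem_dyadic_block hn') ω

theorem summable_block_rate {η : ℝ} (hη : 0 < η) (C : ℝ) :
    Summable fun k : ℕ => C * (((k : ℝ) + 2) ^ 2 * (2 ^ k : ℝ) ^ (-η)) := by
  refine Summable.mul_left _ ?_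
  set r : ℝ := 2 ^ (-η) with hr
  have hr0 : 0 < r := by positivity
  have hr1 : r < 1 := Real.rpow_lt_one_of_one_lt_of_neg one_lt_two (by linarith)
  have hs := summable_pow_mul_geometric_of_norm_lt_one 2 (r := r)
    (by rwa [Real.norm_of_nonneg hr0.le])
  have hs2 := ((summable_nat_add_iff (f := fun n : ℕ => (n : ℝ) ^ 2 * r ^ n) 2).2 hs).mul_right
    ((r ^ 2)⁻¹)
  refine hs2.congr fun k => ?_
  have e : (2 ^ k : ℝ) ^ (-η) = r ^ k := by
    rw [hr, ← Real.rpow_natCast, ← Real.rpow_mul two_pos.le, mul_comm, Real.rpow_mul two_pos.le,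
      Real.rpow_natCast]
  rw [e, pow_add]
  push_cast
  field_simp

end Convergence

/-! ### Lipschitz continuity of the kernel -/

section Lipschitz

/-- A `C^1` function is Lipschitz on the compact interval `[0,1]`. As `w` vanishes from 1 on, 1
included, it equals `w(min(x,1))` on `[0,∞)` and the bound extends. -/
theorem SmoothKernel.exists_lipschitz {w : ℝ → ℝ} {m : ℕ} (hw : SmoothKernel w m) (hm : m ≠ 0) :
    ∃ L : ℝ, ∀ x y, 0 ≤ x → 0 ≤ y → |w x - w y| ≤ L * |x - y| := by
  obtain ⟨L, hL⟩ := hw.smooth.exists_lipschitzOnWith (by exact_mod_cast hm) (convex_Icc 0 1)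
    isCompact_Icc
  have hmin : ∀ x, 0 ≤ x → w x = w (min x 1) := fun x hx => by
    rcases le_total x 1 with h | h
    · rw [min_eq_left h]
    · rw [min_eq_right h, hw.supp x (by rwa [abs_of_nonneg hx]), hw.supp 1 (by simp)]
  refine ⟨L, fun x y hx hy => ?_⟩
  have := hL.dist_le_mul (min x 1) ⟨le_min hx zero_le_one, min_le_right _ _⟩ (min y 1)
    ⟨le_min hy zero_le_one, min_le_right _ _⟩
  rw [Real.dist_eq, Real.dist_eq] at this
  rw [hmin x hx, hmin y hy]
  refine this.trans (mul_le_mul_of_nonneg_left ?_ L.2)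
  refine (abs_min_sub_min_le_max x 1 y 1).trans ?_
  simp

end Lipschitz

/-! ### Geometric arrays from Markov chains -/

section Markov

variable {Ω E : Type*} [mΩ : MeasurableSpace Ω] [MeasurableSpace E] {Pr : Measure Ω}
  {P : Kernel E E} {π μ₀ : Measure E} {X : ℕ → Ω → E} {V : E → ℝ}

/-- The natural filtration of a process, as a `Filtration`. -/
def chainFiltration (hX : ∀ n, Measurable (X n)) : Filtration ℕ mΩ where
  seq := naturalSigma X
  mono' _ _ hmn := biSup_mono fun _ hk => le_trans hk hmn
  le' _ := iSup₂_le fun k _ => (hX k).comap_le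

theorem measurable_chainFiltration (hX : ∀ n, Measurable (X n)) (n : ℕ) :
    Measurable[chainFiltration hX n] (X n) := by
  refine Measurable.of_comap_le ?_
  exact le_iSup₂_of_le (f := fun k (_ : k ∈ Set.Iic n) =>
    MeasurableSpace.comap (X k) inferInstance) n (Set.mem_Iic.2 le_rfl) le_rfl

/-- Recasts the Markov property for indicators as an identity of laws on each past event, so that
integrals of general functions follow without approximation by simple functions. -/
theorem IsMarkovChain.map_restrict [IsProbabilityMeasure Pr] [IsMarkovKernel P]
    (hX : IsMarkovChain Pr X P μ₀) (n : ℕ) {S : Set Ω}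
    (hS : MeasurableSet[chainFiltration hX.measurable n] S) :
    (Pr.restrict S).map (X (n + 1)) = ((Pr.restrict S).map (X n)).bind P := by
  have hle := (chainFiltration hX.measurable).le n
  ext A hA
  have hXn := hX.measurable n
  have hAm := hX.measurable (n + 1) hA
  have hPm : Measurable fun ω => P (X n ω) A := (P.measurable_coe hA).comp hXn
  rw [Measure.map_apply (hX.measurable (n + 1)) hA, Measure.bind_apply hA P.aemeasurable,
    lintegral_map (P.measurable_coe hA) hXn]
  have hind : Integrable ((X (n + 1) ⁻¹' A).indicator fun _ => (1 : ℝ)) Pr :=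
    (integrable_const 1).indicator hAm
  have h1 := setIntegral_condExp hle hind hS
  have h2 : ∫ ω in S, (Pr[(X (n + 1) ⁻¹' A).indicator (fun _ => (1 : ℝ))|
      chainFiltration hX.measurable n]) ω ∂Pr = ∫ ω in S, (P (X n ω) A).toReal ∂Pr :=
    integral_congr_ae (ae_restrict_of_ae (hX.markov n A hA))
  rw [h2, integral_indicator hAm, integral_const, smul_eq_mul, mul_one,
    integral_toReal hPm.aemeasurable (ae_of_all _ fun ω => measure_lt_top _ _)] at h1
  have hfin : ∫⁻ ω in S, P (X n ω) A ∂Pr ≠ ∞ := by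
    refine ne_top_of_le_ne_top (measure_ne_top (Pr.restrict S) Set.univ) ?_
    calc ∫⁻ ω in S, P (X n ω) A ∂Pr ≤ ∫⁻ _ω in S, 1 ∂Pr := lintegral_mono fun ω => prob_le_one
      _ = _ := by rw [lintegral_const, one_mul]
  rw [Measure.real, Measure.restrict_apply_univ,
    ENNReal.toReal_eq_toReal_iff' hfin (measure_ne_top _ _)] at h1
  exact h1.symm

theorem IsMarkovChain.condExp_comp [IsProbabilityMeasure Pr] [IsMarkovKernel P]
    (hX : IsMarkovChain Pr X P μ₀) (n : ℕ) {f : E → ℝ} (hf : Measurable f)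
    (hi : Integrable (fun ω => f (X (n + 1) ω)) Pr)
    (hi' : Integrable (fun ω => ∫ y, f y ∂(P (X n ω))) Pr) :
    Pr[fun ω => f (X (n + 1) ω)|chainFiltration hX.measurable n]
      =ᵐ[Pr] fun ω => ∫ y, f y ∂(P (X n ω)) := by
  have hle := (chainFiltration hX.measurable).le n
  have hg : StronglyMeasurable fun x => ∫ y, f y ∂(P x) :=
    hf.stronglyMeasurable.integral_kernel
  refine (ae_eq_condExp_of_forall_setIntegral_eq hle hi (fun S _ _ => hi'.integrableOn)
    (fun S hS _ => ?_) ?_).symm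
  · have hS' := hX.map_restrict n hS
    have hXn := hX.measurable n
    have hXn1 := hX.measurable (n + 1)
    have e1 : ∫ ω in S, f (X (n + 1) ω) ∂Pr = ∫ y, f y ∂((Pr.restrict S).map (X (n + 1))) :=
      (integral_map hXn1.aemeasurable hf.aestronglyMeasurable).symm
    have e2 : ∫ ω in S, ∫ y, f y ∂(P (X n ω)) ∂Pr
        = ∫ x, ∫ y, f y ∂(P x) ∂((Pr.restrict S).map (X n)) :=
      (integral_map hXn.aemeasurable hg.aestronglyMeasurable).symm
    have hint : Integrable f (((Pr.restrict S).map (X n)).bind P) := by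
      rw [← hS', integrable_map_measure hf.aestronglyMeasurable hXn1.aemeasurable]
      exact hi.integrableOn
    have e3 := Kernel.integral_comp (κ := Kernel.const Unit ((Pr.restrict S).map (X n)))
      (η := P) (a := ()) (f := f) (by rwa [Kernel.comp_apply, Kernel.const_apply])
    rw [Kernel.comp_apply, Kernel.const_apply] at e3
    rw [e1, e2, hS', e3]
  · exact (hg.comp_measurable (measurable_chainFiltration hX.measurable n)).aestronglyMeasurable

theorem GeometricErgodicity.exists_moment_bound [IsProbabilityMeasure Pr] [IsMarkovKernel P]
    (hA : GeometricErgodicity P π μ₀ V) (hX : IsMarkovChain Pr X P μ₀) :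
    ∃ M : ℝ, 0 ≤ M ∧ ∀ n, ∫⁻ ω, ENNReal.ofReal (V (X n ω)) ∂Pr ≤ ENNReal.ofReal M := by
  obtain ⟨b, l, hb, hl0, hl1, hdrift⟩ := hA.drift
  have hV := hA.measurable_V.ennreal_ofReal
  have hl : 0 < 1 - l := by linarith
  set m := (∫⁻ x, ENNReal.ofReal (V x) ∂μ₀).toReal with hm
  have hm0 : 0 ≤ m := ENNReal.toReal_nonneg
  -- `b/(1-l)` is the fixed point of `t ↦ l t + b`, so every level above it is preserved by the
  -- drift inequality; `m` covers the initial law.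
  refine ⟨m + b / (1 - l), by positivity, fun n => ?_⟩
  induction n with
  | zero =>
    have : ∫⁻ ω, ENNReal.ofReal (V (X 0 ω)) ∂Pr = ∫⁻ x, ENNReal.ofReal (V x) ∂μ₀ := by
      rw [← hX.initial, lintegral_map hV (hX.measurable 0)]
    rw [this, ← ENNReal.ofReal_toReal hA.initial.ne]
    refine ENNReal.ofReal_le_ofReal ?_
    have : 0 ≤ b / (1 - l) := by positivity
    linarith
  | succ n ih =>
    have hS := hX.map_restrict n (S := Set.univ) MeasurableSet.univ
    rw [Measure.restrict_univ] at hS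
    have hPV : Measurable fun x => ∫⁻ y, ENNReal.ofReal (V y) ∂(P x) := hV.lintegral_kernel
    calc ∫⁻ ω, ENNReal.ofReal (V (X (n + 1) ω)) ∂Pr
        = ∫⁻ y, ENNReal.ofReal (V y) ∂(Pr.map (X (n + 1))) :=
          (lintegral_map hV (hX.measurable _)).symm
      _ = ∫⁻ ω, ∫⁻ y, ENNReal.ofReal (V y) ∂(P (X n ω)) ∂Pr := by
          rw [hS, Measure.lintegral_bind P.aemeasurable hV.aemeasurable,
            lintegral_map hPV (hX.measurable n)]
      _ ≤ ∫⁻ ω, (ENNReal.ofReal l * ENNReal.ofReal (V (X n ω)) + ENNReal.ofReal b) ∂Pr := by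
          refine lintegral_mono fun ω => (hdrift (X n ω)).trans (le_of_eq ?_)
          rw [ENNReal.ofReal_add (mul_nonneg hl0.le (hA.V_pos _).le) hb.le,
            ENNReal.ofReal_mul hl0.le]
      _ = ENNReal.ofReal l * ∫⁻ ω, ENNReal.ofReal (V (X n ω)) ∂Pr + ENNReal.ofReal b := by
          have hVX : Measurable fun ω => ENNReal.ofReal (V (X n ω)) := hV.comp (hX.measurable n)
          rw [lintegral_add_right _ measurable_const, lintegral_const_mul _ hVX, lintegral_const,
            measure_univ, mul_one]
      _ ≤ ENNReal.ofReal l * ENNReal.ofReal (m + b / (1 - l)) + ENNReal.ofReal b := by gcongr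
      _ = ENNReal.ofReal (l * (m + b / (1 - l)) + b) := by
          rw [← ENNReal.ofReal_mul hl0.le, ← ENNReal.ofReal_add (by positivity) hb.le]
      _ ≤ ENNReal.ofReal (m + b / (1 - l)) := by
          refine ENNReal.ofReal_le_ofReal ?_
          have : b = (1 - l) * (b / (1 - l)) := by field_simp
          nlinarith

/-- The source of the moment exponents: a first moment of `V` places `V^s` in `L^(1/s)`. -/
theorem eLpNorm_rpow_le {U : Ω → ℝ} (hU : ∀ ω, 0 ≤ U ω) {s M : ℝ} (hs : 0 < s) (hM : 0 ≤ M)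
    (h : ∫⁻ ω, ENNReal.ofReal (U ω) ∂Pr ≤ ENNReal.ofReal M) :
    eLpNorm (fun ω => U ω ^ s) (ENNReal.ofReal (1 / s)) Pr ≤ ENNReal.ofReal (M ^ s) := by
  have hs' : 0 < 1 / s := by positivity
  rw [eLpNorm_eq_lintegral_rpow_enorm_toReal (by simpa using hs) ENNReal.ofReal_ne_top,
    ENNReal.toReal_ofReal hs'.le, one_div_one_div]
  have e : ∀ ω, ‖U ω ^ s‖ₑ ^ (1 / s) = ENNReal.ofReal (U ω) := fun ω => by
    rw [Real.enorm_of_nonneg (Real.rpow_nonneg (hU ω) s),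
      ENNReal.ofReal_rpow_of_nonneg (Real.rpow_nonneg (hU ω) s) hs'.le, one_div,
      Real.rpow_rpow_inv (hU ω) hs.ne']
  simp only [e]
  rw [← ENNReal.ofReal_rpow_of_nonneg hM hs.le]
  gcongr

/-- A centred function of a geometrically ergodic chain yields a geometric array. -/
theorem GeometricErgodicity.exists_geometricArray [IsProbabilityMeasure Pr] [IsMarkovKernel P]
    [IsProbabilityMeasure π] (hA : GeometricErgodicity P π μ₀ V) (hX : IsMarkovChain Pr X P μ₀)
    {s : ℝ} (hs0 : 0 < s) (hs : s ≤ 1) {f : E → ℝ} (hf : Measurable f) {c : ℝ}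
    (hfc : WBound (fun x => V x ^ s) f c) (h0 : ∫ x, f x ∂π = 0) :
    ∃ C ρ B : ℝ, GeometricArray Pr (chainFiltration hX.measurable) (1 / s) C ρ B
      (fun i ω => V (X i ω) ^ s) (fun r i ω => iterApply P r f (X i ω)) := by
  obtain ⟨ρ, C, hρ0, hρ1, hC, hdec⟩ := hA.exists_decay hs0 hs hf hfc h0
  obtain ⟨M, hM, hmom⟩ := hA.exists_moment_bound hX
  have hW : ∀ i, AEStronglyMeasurable (fun ω => V (X i ω) ^ s) Pr := fun i =>
    ((hA.measurable_V.comp (hX.measurable i)).pow_const s).aestronglyMeasurable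
  have hWn : ∀ i, eLpNorm (fun ω => V (X i ω) ^ s) (ENNReal.ofReal (1 / s)) Pr
      ≤ ENNReal.ofReal (M ^ s) := fun i =>
    eLpNorm_rpow_le (fun ω => (hA.V_pos _).le) hs0 hM (hmom i)
  have hW0 : ∀ i ω, 0 ≤ V (X i ω) ^ s := fun i ω => Real.rpow_nonneg (hA.V_pos _).le _
  have hWi : ∀ i, Integrable (fun ω => V (X i ω) ^ s) Pr := fun i =>
    MemLp.integrable (q := ENNReal.ofReal (1 / s))
      (by rw [ENNReal.one_le_ofReal, le_div_iff₀ hs0]; linarith)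
      ⟨hW i, (hWn i).trans_lt ENNReal.ofReal_lt_top⟩
  have hint : ∀ r i, Integrable (fun ω => iterApply P r f (X i ω)) Pr := fun r i =>
    ((hWi i).const_mul (C * ρ ^ r)).mono'
      ((measurable_iterApply hf r).comp (hX.measurable i)).aestronglyMeasurable
      (ae_of_all _ fun ω => hdec r (X i ω))
  refine ⟨C, ρ, M ^ s, hρ0, hρ1, hC.le, by positivity, fun r i => ?_, fun r i => ?_,
    fun r i ω => hdec r (X i ω), hW, hW0, hWn⟩
  · exact ((measurable_iterApply hf r).comp
      (measurable_chainFiltration hX.measurable i)).stronglyMeasurable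
  · have e : ∀ ω, ∫ y, iterApply P r f y ∂(P (X i ω)) = iterApply P (r + 1) f (X i ω) :=
      fun ω => (hA.iterApply_succ hs hf hfc r (X i ω)).symm
    have := hX.condExp_comp i (measurable_iterApply hf r) (hint r (i + 1))
      (by simpa only [e] using hint (r + 1) i)
    simpa only [e] using this

theorem measurable_kernelEstimator {h : E → ℝ} (hh : Measurable h) (hX : ∀ n, Measurable (X n))
    (w : ℝ → ℝ) (b : ℕ → ℝ) (n : ℕ) : Measurable (kernelEstimator w b h X n) := by
  have hc : ∀ j, Measurable fun ω => h (X j ω) := fun j => hh.comp (hX j)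
  have hm : Measurable (sampleMean h X n) :=
    (Finset.measurable_fun_sum _ fun j _ => hc j).const_mul _
  have hs : ∀ k, Measurable (sampleAutocov h X n k) := fun k => by
    unfold sampleAutocov
    split_ifs
    · exact measurable_const
    · exact (Finset.measurable_fun_sum _ fun j _ =>
        ((hc _).sub hm).mul ((hc _).sub hm)).const_mul _
  exact Finset.measurable_fun_sum _ fun k _ => (hs k).const_mul _

omit mΩ [MeasurableSpace E] in
theorem kernelEstimator_zero (w : ℝ → ℝ) (b : ℕ → ℝ) (h : E → ℝ) :
    kernelEstimator w b h X 0 = fun _ => 0 := by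
  ext ω
  exact Finset.sum_eq_zero fun k _ => by simp [sampleAutocov]

/-- Block bounds for the kernel estimator along a geometrically ergodic chain. -/
theorem GeometricErgodicity.exists_block_bound [IsProbabilityMeasure Pr] [IsMarkovKernel P]
    [IsProbabilityMeasure π] (hA : GeometricErgodicity P π μ₀ V) (hX : IsMarkovChain Pr X P μ₀)
    {β : ℝ} (hβ0 : 0 < β) (hβ1 : β < 1 / 2) {h : E → ℝ} (hh : InLW (fun x => V x ^ β) h)
    {w : ℝ → ℝ} (hw : SmoothKernel w 2) {δ c : ℝ} {b : ℕ → ℝ} (hc : 0 < c)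
    (hb : ∀ n : ℕ, 1 ≤ n → b n = c * (n : ℝ) ^ (-δ)) (hδ0 : 0 < δ)
    (hδ : δ + max (2 * β) (1 / 2) < 1) :
    ∃ ε : ℕ → ℝ, Summable ε ∧ ∀ k : ℕ, HasMaximalBound Pr (1 / (2 * β))
      {n : ℕ | 2 ^ k ≤ n ∧ n < 2 * 2 ^ k}
      (fun n ω => kernelEstimator w b h X n ω - sigmaSq P π (centre π h)) (ε k) := by
  obtain ⟨hm, d, hd⟩ := hh
  have hp : 1 < 1 / (2 * β) := by rw [lt_div_iff₀ (by positivity)]; linarith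
  have hβ' : β ≤ 1 := by linarith
  have h2β : 2 * β ≤ 1 := by linarith
  have hcm := measurable_centre (π := π) hm
  have hcb := hA.wBound_centre hβ0.le hd
  have hc0 := integral_centre (hA.integrable_pi hβ' hm hd)
  obtain ⟨-, hvm, ⟨d', hvd⟩, hvσ⟩ := hA.sigmaSqFinite hβ0 hβ1.le hcm hcb hc0
  obtain ⟨C, ρ, B, harr⟩ := hA.exists_geometricArray hX hβ0 hβ' hcm hcb hc0
  have hvm' := measurable_centre (π := π) hvm
  -- Two arrays are used: `h̄`, of class `V^β`, has `1/β = 2p` moments; the centred variance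
  -- density, of class `V^(2β)`, has `p` moments and gives the ergodic average converging to
  -- `σ²(h)`.
  obtain ⟨C₂, ρ₂, B₂, harr₂⟩ := hA.exists_geometricArray hX (by positivity : 0 < 2 * β) h2β hvm'
    (hA.wBound_centre (by positivity) hvd) (integral_centre (hA.integrable_pi h2β hvm hvd))
  obtain ⟨CT, hCT, hT⟩ := harr₂.exists_maximalBound_sum hp
  obtain ⟨L, hL⟩ := hw.exists_lipschitz two_ne_zero
  have e2p : 1 / β = 2 * (1 / (2 * β)) := by field_simp
  rw [e2p] at harr
  have einv : 1 / (1 / (2 * β)) = 2 * β := one_div_one_div _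
  obtain ⟨C', η, _, hη, hblock⟩ := harr.exists_maximalBound_estimator hp (f := h) (X := X)
    (e := ∫ y, h y ∂π) (fun j ω => by rw [iterApply_zero hcm]; rfl)
    (σ2 := sigmaSq P π (centre π h)) hCT
    (by
      intro k
      have e : ∀ x, centre π (varianceDensity P (centre π h)) x
          = varianceDensity P (centre π h) x - sigmaSq P π (centre π h) := fun x => by
        rw [← hvσ, centre]
      have := hT k
      simp only [iterApply_zero hvm', e, varianceDensity] at this
      simpa only [iterApply_zero hcm] using this)
    hL (fun x hx => hw.supp x (hx.trans (le_abs_self x))) hw.even hw.zero hc hb hδ0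
    (by rwa [einv])
  exact ⟨_, summable_block_rate hη C', hblock⟩

end Markov

end KernelVariance

end

/-! ### The main theorem -/

theorem corollary4p1
    {Ω E : Type*} [MeasurableSpace Ω] [MeasurableSpace E] [MeasurableSpace.CountablyGenerated E]
    (Pr : Measure Ω) [IsProbabilityMeasure Pr]
    (P : Kernel E E) [IsMarkovKernel P]
    (π μ₀ : Measure E) [IsProbabilityMeasure π] [IsProbabilityMeasure μ₀]
    (X : ℕ → Ω → E) (hX : KernelVariance.IsMarkovChain Pr X P μ₀)
    (V : E → ℝ) (hA1 : KernelVariance.GeometricErgodicity P π μ₀ V)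
    (β : ℝ) (hβ0 : 0 < β) (hβ1 : β < 1 / 2)
    (h : E → ℝ) (hh : KernelVariance.InLW (fun x => V x ^ β) h) :
    -- the asymptotic variance is well defined and finite
    (Integrable h π ∧ KernelVariance.SigmaSqFinite P π (KernelVariance.centre π h)) ∧
    ∀ w : ℝ → ℝ, KernelVariance.SmoothKernel w 2 →
    ∀ (δ c : ℝ) (b : ℕ → ℝ), 0 < c → (∀ n : ℕ, 1 ≤ n → b n = c * (n : ℝ) ^ (-δ)) →
      -- convergence in `L^p` with `p = 1 / (2β)`
      (δ = KernelVariance.bandwidthExponent β →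
        (∀ n, MemLp (KernelVariance.kernelEstimator w b h X n)
          (ENNReal.ofReal (1 / (2 * β))) Pr) ∧
        Tendsto (fun n => eLpNorm (fun ω => KernelVariance.kernelEstimator w b h X n ω
            - KernelVariance.sigmaSq P π (KernelVariance.centre π h))
          (ENNReal.ofReal (1 / (2 * β))) Pr) atTop (𝓝 0)) ∧
      -- almost sure convergence
      ((β < 1 / 4 ∧ 2 * β < δ ∧ δ < 1 / 2) ∨
        (δ = KernelVariance.bandwidthExponent β ∧
          ∃ r : ℕ, 2 ≤ r ∧ 1 + 2 * β / δ < r ∧ KernelVariance.SmoothKernel w (r + 1)) →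
        ∀ᵐ ω ∂Pr, Tendsto (fun n => KernelVariance.kernelEstimator w b h X n ω) atTop
          (𝓝 (KernelVariance.sigmaSq P π (KernelVariance.centre π h)))) := by
  have hβ' : β ≤ 1 := by linarith
  have hp : 1 ≤ 1 / (2 * β) := by rw [le_div_iff₀ (by positivity)]; linarith
  obtain ⟨hm, d, hd⟩ := hh
  have hi : Integrable h π := hA1.integrable_pi hβ' hm hd
  refine ⟨⟨hi, (hA1.sigmaSqFinite hβ0 hβ1.le (KernelVariance.measurable_centre hm)
    (hA1.wBound_centre hβ0.le hd) (KernelVariance.integral_centre hi)).1⟩, ?_⟩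
  intro w hw δ c b hc hb
  -- With `κ = max(2β, 1/2) < 1` one has `δ_β = (2/3)(1-κ)`, strictly between 0 and `1 - κ`.
  have hexp : δ = KernelVariance.bandwidthExponent β → 0 < δ ∧ δ + max (2 * β) (1 / 2) < 1 := by
    intro hδ
    have h1 : max (2 * β) (1 / 2) < 1 := max_lt (by linarith) (by norm_num)
    rw [KernelVariance.bandwidthExponent, max_comm] at hδ
    constructor <;> linarith
  constructor
  · intro hδ
    obtain ⟨ε, hε, hbd⟩ := hA1.exists_block_bound hX hβ0 hβ1 ⟨hm, d, hd⟩ hw hc hb (hexp hδ).1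
      (hexp hδ).2
    refine ⟨fun n => ?_, (KernelVariance.tendsto_zero_of_block_bounds hp hε hbd).1⟩
    -- The bandwidth is unconstrained at `n = 0`, and dyadic blocks start at 1; there the estimator
    -- vanishes.
    rcases Nat.eq_zero_or_pos n with rfl | hn
    · rw [KernelVariance.kernelEstimator_zero]
      exact MemLp.zero
    · have hmeas := KernelVariance.measurable_kernelEstimator hm hX.measurable w b n
      have h1 : MemLp (fun ω => KernelVariance.kernelEstimator w b h X n ω
          - KernelVariance.sigmaSq P π (KernelVariance.centre π h))
          (ENNReal.ofReal (1 / (2 * β))) Pr :=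
        ⟨(hmeas.sub_const _).aestronglyMeasurable,
          ((hbd _).eLpNorm_le (KernelVariance.mem_dyadic_block hn)).trans_lt
            ENNReal.ofReal_lt_top⟩
      have h2 := h1.add (memLp_const (KernelVariance.sigmaSq P π (KernelVariance.centre π h)))
      refine h2.ae_eq (ae_of_all _ fun ω => ?_)
      simp
  · intro hcase
    -- Both cases reduce to the same rate condition; in case (i), `β < 1/4` makes the maximum `1/2`,
    -- and `δ < 1/2` concludes.
    have hδ : 0 < δ ∧ δ + max (2 * β) (1 / 2) < 1 := by
      rcases hcase with ⟨h1, h2, h3⟩ | ⟨h1, -⟩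
      · refine ⟨by linarith, ?_⟩
        rw [max_eq_right (by linarith)]
        linarith
      · exact hexp h1
    obtain ⟨ε, hε, hbd⟩ := hA1.exists_block_bound hX hβ0 hβ1 ⟨hm, d, hd⟩ hw hc hb hδ.1 hδ.2
    filter_upwards [(KernelVariance.tendsto_zero_of_block_bounds hp hε hbd).2] with ω hω
    simpa using hω.add_const (KernelVariance.sigmaSq P π (KernelVariance.centre π h))
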